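/- **Theorem (Riemannian elliptic case).** Let $M$ be an oriented smooth surface with a smooth Riemannian metric $\boldsymbol g$ whose Gauss curvature $K$ is everywhere positive, and let $q=K^{-3/4}$. *The system.* For a local oriented orthonormal framing $f$ on an open set $U\subset M$ let $\eta^1,\eta^2$ be the dual coframe and $\eta^1_2=-\eta^2_1$ the connection form, so that $d\eta^1=-\eta^1_2\wedge\eta^2$, $d\eta^2=-\eta^2_1\wedge\eta^1$, $d\eta^1_2=K\,\eta^1\wedge\eta^2$. Let $\mathcal F_{\mathbb R^3}$ be the orthonormal frame bundle of Euclidean $\mathbb R^3$, with base point $\rho$, frame vectors $\mathsf e_i$, canonical forms $\omega^i$ and connection forms $\omega^i_j$ defined by $d\rho=\mathsf e_i\omega^i$, $d\mathsf e_j=\mathsf e_i\omega^i_j$. The isometric embedding system $\mathcal I$ is the differential ideal generated by $$\theta_0=\omega^3,\quad \theta_1=\omega^1-\eta^1,\quad \theta_2=\omega^2-\eta^2,\quad \theta_3=\omega^1_2-\eta^1_2$$ on the $8$-manifold $U\times\mathcal F_{\mathbb R^3}$ (this is the pull-back by $f$ of the system on $\mathcal F_M\times\mathcal F_{\mathbb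 R^3}$ given by the same formulas). *Darboux integrability.* For a system $V$ of subspaces of the complexified cotangent spaces, its derived system $V'$ consists of the values of the smooth local sections $\omega$ of $V$ with $d\omega\equiv0$ mod $V$, and $V^\infty$ denotes the final element of the derived flag $V\supseteq V'\supseteq V''\supseteq\cdots$. Two such systems $\hat V,\check V$ form a Darboux pair if $\hat V+\check V^\infty=\hat V^\infty+\check V=T^*\otimes\mathbb C$, $\hat V^\infty\cap\check V^\infty=0$, and $d\omega\in\Lambda^2\hat V+\Lambda^2\check V$ for all local sections $\omega$ of $\hat V\cap\check V$. We say that $\mathcal I$ is Darboux integrable (with complex-conjugate singular systems) if, for every such framing, about each point of $U\times\mathcal F_{\mathbb R^3}$ there are a complex coframe $(\theta^1,\dots,\theta^r,\sigma^1,\dots,\sigma^p,\bar\sigma^1,\dots,\bar\sigma^p)$ with $p\ge2$ and $2$-forms $\Omega^1,\dots,\Omega^s\in\Lambda^2(\sigma^1,\dots,\sigma^p)$, $s\ge1$, such that $\mathcal I\otimes\mathbb C$ is generated algebraically by the $\theta^i$, $\Omega^b$ and $\bar\Omega^b$; the singular systems generated algebraically by $\{\theta^i,\sigma^a,\bar\Omega^b\}$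 and by $\{\theta^i,\bar\sigma^a,\Omega^b\}$ are Pfaffian (generated, as differential ideals, by their $1$-forms); and $\operatorname{span}\{\theta^i,\sigma^a\}$, $\operatorname{span}\{\theta^i,\bar\sigma^a\}$ form a Darboux pair. *Claim.* $\mathcal I$ is Darboux integrable if and only if, for every local oriented orthonormal framing, $$q_{11}=q_{22}=3q^{-1/3},\qquad q_{12}=q_{21}=0,$$ where the components $q_i,q_{ij}$ of the covariant derivatives of $q$ are defined by $dq=q_i\eta^i$ and $dq_i=q_j\eta^j_i+q_{ij}\eta^j$. -/

import Mathlib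

open scoped ContDiff Manifold Topology

noncomputable section

namespace DarbouxEmbedding

/-! ## Differential forms of degree one and two on a normed space

A `1`-covector on `E` with values in `F` is an element of `E →L[ℝ] F`; a `2`-covector is a (skew)
bilinear map `E →L[ℝ] E →L[ℝ] F`.  A differential form is a function from `E` to covectors. -/

section Forms

variable {E : Type*} [NormedAddCommGroup E] [NormedSpace ℝ E]

/-- The exterior derivative of a `1`-form: `dψ(v, w) = (D_v ψ)(w) - (D_w ψ)(v)`. -/
def extD {F : Type*} [NormedAddCommGroup F] [NormedSpace ℝ F]
    (ψ : E → E →L[ℝ] F) (x : E) : E →L[ℝ] E →L[ℝ] F :=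
  fderiv ℝ ψ x - (fderiv ℝ ψ x).flip

/-- The wedge product of two real `1`-covectors: `(α ∧ β)(v, w) = α v * β w - α w * β v`. -/
def wedgeR (α β : E →L[ℝ] ℝ) : E →L[ℝ] E →L[ℝ] ℝ :=
  α.smulRight β - (α.smulRight β).flip

/-- The wedge product of two complex `1`-covectors. -/
def wedge (α β : E →L[ℝ] ℂ) : E →L[ℝ] E →L[ℝ] ℂ :=
  α.smulRight β - (α.smulRight β).flip

theorem wedgeR_apply (α β : E →L[ℝ] ℝ) (v w : E) :
    wedgeR α β v w = α v * β w - α w * β v := by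
  simp [wedgeR]

theorem wedge_apply (α β : E →L[ℝ] ℂ) (v w : E) :
    wedge α β v w = α v * β w - α w * β v := by
  simp [wedge]

theorem extD_apply {F : Type*} [NormedAddCommGroup F] [NormedSpace ℝ F]
    (ψ : E → E →L[ℝ] F) (x v w : E) :
    extD ψ x v w = fderiv ℝ ψ x v w - fderiv ℝ ψ x w v := by
  simp [extD]

/-- `extD` is Mathlib's exterior derivative of the corresponding alternating `1`-form. -/
theorem extDeriv_ofSubsingleton_apply {F : Type*} [NormedAddCommGroup F] [NormedSpace ℝ F]
    (ψ : E → E →L[ℝ] F) (x : E) (h : DifferentiableAt ℝ ψ x) (v w : E) :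
    extDeriv (fun y => ContinuousAlternatingMap.ofSubsingletonLIE (𝕜 := ℝ) (E := E) (F := F)
      (0 : Fin 1) (ψ y)) x ![v, w] = extD ψ x v w := by
  have hd : DifferentiableAt ℝ (fun y => ContinuousAlternatingMap.ofSubsingletonLIE (𝕜 := ℝ)
      (E := E) (F := F) (0 : Fin 1) (ψ y)) x :=
    (ContinuousAlternatingMap.ofSubsingletonLIE (𝕜 := ℝ) (E := E) (F := F)
      (0 : Fin 1)).differentiable.differentiableAt.comp x h
  rw [extDeriv_apply hd]
  have key : ∀ z : E, fderiv ℝ (fun y => ψ y z) x = (fderiv ℝ ψ x).flip z := by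
    intro z
    have := (h.hasFDerivAt.clm_apply (hasFDerivAt_const z x)).fderiv
    rw [this]
    ext a
    simp
  simp [Fin.sum_univ_two, extD_apply, Fin.removeNth, key, sub_eq_add_neg]

/-- The complexification of a real `1`-covector. -/
def complexify (α : E →L[ℝ] ℝ) : E →L[ℝ] ℂ := Complex.ofRealCLM.comp α

/-- The complex conjugate of a complex `1`-covector. -/
def conjOne (α : E →L[ℝ] ℂ) : E →L[ℝ] ℂ := (Complex.conjCLE : ℂ →L[ℝ] ℂ).comp α

/-- The complex conjugate of a complex `2`-covector. -/
def conjTwo (β : E →L[ℝ] E →L[ℝ] ℂ) : E →L[ℝ] E →L[ℝ] ℂ :=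
  (ContinuousLinearMap.compL ℝ E ℂ ℂ (Complex.conjCLE : ℂ →L[ℝ] ℂ)).comp β

theorem conjOne_apply (α : E →L[ℝ] ℂ) (v : E) : conjOne α v = star (α v) := by
  simp [conjOne]

theorem conjTwo_apply (β : E →L[ℝ] E →L[ℝ] ℂ) (v w : E) :
    conjTwo β v w = star (β v w) := by
  simp [conjTwo]

/-- `T* ∧ V`: the degree-two part of the algebraic ideal generated by the covectors in `V`. -/
def idealTwo (V : Submodule ℂ (E →L[ℝ] ℂ)) : Submodule ℂ (E →L[ℝ] E →L[ℝ] ℂ) :=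
  Submodule.span ℂ {β | ∃ α γ : E →L[ℝ] ℂ, γ ∈ V ∧ β = wedge α γ}

/-- `Λ² V`: the span of the products of two covectors in `V`. -/
def extTwo (V : Submodule ℂ (E →L[ℝ] ℂ)) : Submodule ℂ (E →L[ℝ] E →L[ℝ] ℂ) :=
  Submodule.span ℂ {β | ∃ α γ : E →L[ℝ] ℂ, α ∈ V ∧ γ ∈ V ∧ β = wedge α γ}

/-! ## Pfaffian systems and derived flags -/

/-- The family of subspaces of the complexified cotangent spaces spanned by some `1`-forms. -/
def spanSystem {ι : Type*} (θ : ι → E → E →L[ℝ] ℂ) (x : E) : Submodule ℂ (E →L[ℝ] ℂ) :=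
  Submodule.span ℂ (Set.range fun i => θ i x)

/-- `ψ` is, on a neighbourhood of `x`, a smooth section of the system `V`. -/
def IsLocalSection (V : E → Submodule ℂ (E →L[ℝ] ℂ)) (x : E) (ψ : E → E →L[ℝ] ℂ) : Prop :=
  ∀ᶠ y in 𝓝 x, ContDiffAt ℝ ∞ ψ y ∧ ψ y ∈ V y

/-- The derived system of `V`: the values of the smooth local sections `ψ` of `V` such that
`dψ ≡ 0 mod V`. -/
def derivedSystem (V : E → Submodule ℂ (E →L[ℝ] ℂ)) (x : E) : Submodule ℂ (E →L[ℝ] ℂ) :=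
  Submodule.span ℂ {α | ∃ ψ : E → E →L[ℝ] ℂ, IsLocalSection V x ψ ∧
    (∀ᶠ y in 𝓝 x, extD ψ y ∈ idealTwo (V y)) ∧ ψ x = α}

/-- `V^∞`: the final element of the derived flag `V ⊇ V' ⊇ V'' ⊇ …`. -/
def finalDerived (V : E → Submodule ℂ (E →L[ℝ] ℂ)) (x : E) : Submodule ℂ (E →L[ℝ] ℂ) :=
  ⨅ k : ℕ, derivedSystem^[k] V x

/-- Darboux pairs of (complex) Pfaffian systems on the open set `O`. -/
structure IsDarbouxPair (O : Set E) (V W : E → Submodule ℂ (E →L[ℝ] ℂ)) : Prop where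
  sup_right : ∀ x ∈ O, V x ⊔ finalDerived W x = ⊤
  sup_left : ∀ x ∈ O, finalDerived V x ⊔ W x = ⊤
  inf_eq : ∀ x ∈ O, finalDerived V x ⊓ finalDerived W x = ⊥
  d_mem : ∀ x ∈ O, ∀ ψ : E → E →L[ℝ] ℂ, IsLocalSection (fun y => V y ⊓ W y) x ψ →
    extD ψ x ∈ extTwo (V x) ⊔ extTwo (W x)

/-! ## Exterior differential systems generated by one-forms, and Darboux integrability -/

/-- The degree-two part, at `x`, of the differential ideal generated by the `1`-forms `θ i`: it is
spanned by the `α ∧ θ i` and the `dθ i`. -/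
def differentialIdealTwo {ι : Type*} (θ : ι → E → E →L[ℝ] ℂ) (x : E) :
    Submodule ℂ (E →L[ℝ] E →L[ℝ] ℂ) :=
  idealTwo (spanSystem θ x) ⊔ Submodule.span ℂ (Set.range fun i => extD (θ i) x)

/-- The degree-two part, at `x`, of the algebraic ideal generated by the `1`-forms `θ i` and the
`2`-forms `Ω b`. -/
def algebraicIdealTwo {ι κ : Type*} (θ : ι → E → E →L[ℝ] ℂ) (Ω : κ → E → E →L[ℝ] E →L[ℝ] ℂ)
    (x : E) : Submodule ℂ (E →L[ℝ] E →L[ℝ] ℂ) :=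
  idealTwo (spanSystem θ x) ⊔ Submodule.span ℂ (Set.range fun b => Ω b x)

/-- A decomposition of type `[p, q]`, on the open set `O`, of the differential system generated by
the `1`-forms `ϑ`: a coframe `(θ, σ, τ)` and `2`-forms `Ω b ∈ Λ²(σ)`, `Ψ c ∈ Λ²(τ)` such that the
system is generated algebraically by `θ`, `Ω`, `Ψ`. -/
structure IsDecomposition {ι : Type*} (O : Set E) (ϑ : ι → E → E →L[ℝ] ℂ) {r p q s t : ℕ}
    (θ : Fin r → E → E →L[ℝ] ℂ) (σ : Fin p → E → E →L[ℝ] ℂ) (τ : Fin q → E → E →L[ℝ] ℂ)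
    (Ω : Fin s → E → E →L[ℝ] E →L[ℝ] ℂ) (Ψ : Fin t → E → E →L[ℝ] E →L[ℝ] ℂ) : Prop where
  two_le_p : 2 ≤ p
  two_le_q : 2 ≤ q
  one_le_s : 1 ≤ s
  one_le_t : 1 ≤ t
  smooth_θ : ∀ i, ContDiffOn ℝ ∞ (θ i) O
  smooth_σ : ∀ a, ContDiffOn ℝ ∞ (σ a) O
  smooth_τ : ∀ a, ContDiffOn ℝ ∞ (τ a) O
  smooth_Ω : ∀ b, ContDiffOn ℝ ∞ (Ω b) O
  smooth_Ψ : ∀ b, ContDiffOn ℝ ∞ (Ψ b) O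
  coframe_linearIndependent : ∀ x ∈ O, LinearIndependent ℂ
    (Sum.elim (fun i => θ i x) (Sum.elim (fun a => σ a x) (fun a => τ a x)))
  coframe_span : ∀ x ∈ O, spanSystem θ x ⊔ spanSystem σ x ⊔ spanSystem τ x = ⊤
  Ω_mem : ∀ x ∈ O, ∀ b, Ω b x ∈ extTwo (spanSystem σ x)
  Ψ_mem : ∀ x ∈ O, ∀ b, Ψ b x ∈ extTwo (spanSystem τ x)
  degree_one : ∀ x ∈ O, spanSystem ϑ x = spanSystem θ x
  degree_two : ∀ x ∈ O, differentialIdealTwo ϑ x = algebraicIdealTwo θ (Sum.elim Ω Ψ) x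

/-- The singular system generated algebraically by `θ`, `σ` and `Ψ` is Pfaffian: it is the
differential ideal generated by its `1`-forms `θ`, `σ`. -/
def SingularSystemIsPfaffian (O : Set E) {r p t : ℕ} (θ : Fin r → E → E →L[ℝ] ℂ)
    (σ : Fin p → E → E →L[ℝ] ℂ) (Ψ : Fin t → E → E →L[ℝ] E →L[ℝ] ℂ) : Prop :=
  ∀ x ∈ O, differentialIdealTwo (Sum.elim θ σ) x = algebraicIdealTwo (Sum.elim θ σ) Ψ x

/-- The differential system generated by the real `1`-forms `ϑ` on the open set `O` is Darboux
integrable by means of complex-conjugate singular systems: about each point, its complexification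
has a decomposition `(θ, σ, σ̄; Ω, Ω̄)` whose singular systems are Pfaffian and whose singular
Pfaffian systems `{θ, σ}` and `{θ, σ̄}` form a Darboux pair. -/
def IsEllipticDarbouxIntegrable {ι : Type*} (O : Set E) (ϑ : ι → E → E →L[ℝ] ℝ) : Prop :=
  ∀ x ∈ O, ∃ O' ⊆ O, IsOpen O' ∧ x ∈ O' ∧ ∃ (r p s : ℕ)
    (θ : Fin r → E → E →L[ℝ] ℂ) (σ : Fin p → E → E →L[ℝ] ℂ)
    (Ω : Fin s → E → E →L[ℝ] E →L[ℝ] ℂ),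
    IsDecomposition O' (fun i y => complexify (ϑ i y)) θ σ (fun a y => conjOne (σ a y))
      Ω (fun b y => conjTwo (Ω b y)) ∧
    SingularSystemIsPfaffian O' θ σ (fun b y => conjTwo (Ω b y)) ∧
    SingularSystemIsPfaffian O' θ (fun a y => conjOne (σ a y)) Ω ∧
    IsDarbouxPair O' (spanSystem (Sum.elim θ σ))
      (spanSystem (Sum.elim θ fun a y => conjOne (σ a y)))

end Forms

/-! ## Oriented Riemannian surfaces and their local orthonormal framings -/

/-- The model plane. -/
abbrev Plane := EuclideanSpace ℝ (Fin 2)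

/-- Euclidean three-space. -/
abbrev Space := EuclideanSpace ℝ (Fin 3)

/-- The model of the product of a surface with the orthonormal frame bundle of `ℝ³`. -/
abbrev Model8 := EuclideanSpace ℝ (Fin 8)

section Surface

variable {M : Type*} [TopologicalSpace M] [ChartedSpace Plane M] [IsManifold (𝓡 2) ∞ M]

variable (M) in
/-- The atlas of `M` is oriented: all coordinate changes have positive Jacobian determinant. -/
def IsOrientedAtlas : Prop :=
  ∀ e ∈ atlas Plane M, ∀ e' ∈ atlas Plane M, ∀ u ∈ (e.symm ≫ₕ e').source,
    0 < (fderiv ℝ (e.symm ≫ₕ e') u).det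

variable (M) in
/-- Smooth Riemannian metrics on the surface `M`. -/
abbrev Metric :=
  Bundle.ContMDiffRiemannianMetric (𝓡 2) ∞ Plane (fun x : M => TangentSpace (𝓡 2) x)

/-- The expression of the metric in the chart `e`. -/
def metricInChart (g : Metric M) (e : OpenPartialHomeomorph M Plane) (u a b : Plane) : ℝ :=
  g.inner (e.symm u) (mfderiv (𝓡 2) (𝓡 2) e.symm u a) (mfderiv (𝓡 2) (𝓡 2) e.symm u b)

/-- A local section of the bundle of oriented orthonormal frames over an open subset of the domain
of the chart `e`, written in this chart: the frame `v`, the dual coframe `η` (the pull-backs of the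
canonical forms) and the connection form `η12` (the pull-back of `η¹₂`), which is determined by the
structure equations `dη¹ = -η¹₂ ∧ η²`, `dη² = -η²₁ ∧ η¹ = η¹₂ ∧ η¹`. -/
structure LocalFraming (g : Metric M) (e : OpenPartialHomeomorph M Plane) where
  U : Set Plane
  isOpen_U : IsOpen U
  U_subset : U ⊆ e.target
  v : Fin 2 → Plane → Plane
  η : Fin 2 → Plane → Plane →L[ℝ] ℝ
  η12 : Plane → Plane →L[ℝ] ℝ
  smooth_v : ∀ i, ContDiffOn ℝ ∞ (v i) U
  smooth_η : ∀ i, ContDiffOn ℝ ∞ (η i) U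
  smooth_η12 : ContDiffOn ℝ ∞ η12 U
  orthonormal : ∀ u ∈ U, ∀ i j, metricInChart g e u (v i u) (v j u) = if i = j then 1 else 0
  oriented : ∀ u ∈ U, 0 < v 0 u 0 * v 1 u 1 - v 0 u 1 * v 1 u 0
  dual : ∀ u ∈ U, ∀ i j, η i u (v j u) = if i = j then 1 else 0
  dη_zero : ∀ u ∈ U, extD (η 0) u = -wedgeR (η12 u) (η 1 u)
  dη_one : ∀ u ∈ U, extD (η 1) u = wedgeR (η12 u) (η 0 u)

/-- `K` is the Gauss curvature of `g`: the structure equation `dη¹₂ = K η¹ ∧ η²` holds for all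
local oriented orthonormal framings. -/
def IsGaussCurvature (g : Metric M) (K : M → ℝ) : Prop :=
  ∀ e ∈ atlas Plane M, ∀ φ : LocalFraming g e, ∀ u ∈ φ.U,
    extD φ.η12 u = K (e.symm u) • wedgeR (φ.η 0 u) (φ.η 1 u)

namespace LocalFraming

variable {g : Metric M} {e : OpenPartialHomeomorph M Plane} (φ : LocalFraming g e)

/-- The connection forms `η^i_j`, a skew matrix of `1`-forms with `η^1_2 = η12`. -/
def conn (i j : Fin 2) (u : Plane) : Plane →L[ℝ] ℝ :=
  !![0, φ.η12 u; -φ.η12 u, 0] i j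

/-- The components `f_i` of the first covariant derivative: `df = f_i η^i`. -/
def cov (f : M → ℝ) (i : Fin 2) (u : Plane) : ℝ :=
  fderiv ℝ (fun w => f (e.symm w)) u (φ.v i u)

/-- The components `f_ij` of the second covariant derivative: `df_i = f_j η^j_i + f_ij η^j`. -/
def cov₂ (f : M → ℝ) (i j : Fin 2) (u : Plane) : ℝ :=
  fderiv ℝ (φ.cov f i) u (φ.v j u) - ∑ k, φ.cov f k u * φ.conn k i u (φ.v j u)

end LocalFraming

/-! ## The isometric embedding system -/

/-- Smooth local coordinates on the `8`-manifold `U × F`, where `U` is an open subset of the plane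
and `F` is the orthonormal frame bundle of Euclidean `ℝ³`: a smooth local diffeomorphism from an
open set of `ℝ⁸`, that is, an immersion `y ↦ (base y, pos y, frame y)` with values in `U × F`. -/
structure FramePatch (U : Set Plane) where
  O : Set Model8
  isOpen_O : IsOpen O
  base : Model8 → Plane
  pos : Model8 → Space
  frame : Fin 3 → Model8 → Space
  smooth_base : ContDiffOn ℝ ∞ base O
  smooth_pos : ContDiffOn ℝ ∞ pos O
  smooth_frame : ∀ i, ContDiffOn ℝ ∞ (frame i) O
  base_mem : ∀ y ∈ O, base y ∈ U
  frame_orthonormal : ∀ y ∈ O, Orthonormal ℝ fun i => frame i y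
  immersion : ∀ y ∈ O, ∀ w : Model8, fderiv ℝ base y w = 0 → fderiv ℝ pos y w = 0 →
    (∀ i, fderiv ℝ (frame i) y w = 0) → w = 0

namespace FramePatch

variable {U : Set Plane} (c : FramePatch U)

/-- The canonical forms `ω^i` of the frame bundle of `ℝ³`: `dρ = e_i ω^i`. -/
def omega (i : Fin 3) (y : Model8) : Model8 →L[ℝ] ℝ :=
  (innerSL ℝ (c.frame i y)).comp (fderiv ℝ c.pos y)

/-- The connection forms `ω^i_j` of the frame bundle of `ℝ³`: `de_j = e_i ω^i_j`. -/
def omegaConn (i j : Fin 3) (y : Model8) : Model8 →L[ℝ] ℝ :=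
  (innerSL ℝ (c.frame i y)).comp (fderiv ℝ (c.frame j) y)

/-- The pull-back of a `1`-form on the surface to the product. -/
def pull (α : Plane → Plane →L[ℝ] ℝ) (y : Model8) : Model8 →L[ℝ] ℝ :=
  (α (c.base y)).comp (fderiv ℝ c.base y)

end FramePatch

/-- The generators `θ₀ = ω³`, `θ₁ = ω¹ - η¹`, `θ₂ = ω² - η²`, `θ₃ = ω¹₂ - η¹₂` of the isometric
embedding system, pulled back by the framing `φ` to the product of `φ.U` with the frame bundle of
`ℝ³` and written in the local coordinates `c` of this product. -/
def embeddingForms {g : Metric M} {e : OpenPartialHomeomorph M Plane} (φ : LocalFraming g e)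
    (c : FramePatch φ.U) : Fin 4 → Model8 → Model8 →L[ℝ] ℝ :=
  ![c.omega 2, c.omega 0 - c.pull (φ.η 0), c.omega 1 - c.pull (φ.η 1), c.omegaConn 0 1 - c.pull φ.η12]

/-- The isometric embedding system of `(M, g)` into Euclidean `ℝ³` is Darboux integrable, with
complex-conjugate singular systems: this holds for its pull-back by any local oriented orthonormal
framing, in all local coordinates. -/
def EmbeddingSystemIsDarbouxIntegrable (g : Metric M) : Prop :=
  ∀ e ∈ atlas Plane M, ∀ (φ : LocalFraming g e) (c : FramePatch φ.U),
    IsEllipticDarbouxIntegrable c.O (embeddingForms φ c)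

end Surface

end DarbouxEmbedding

end

/-!
Write the Gauss curvature as `K = k²`, let `p` be half of the logarithmic differential of `k`, and
let `m` be the symmetric tensor with `2 k m = ∇p - p ⊗ p + k² g`. Since `q = k^(-3/2)`, the
equations for the second covariant derivative of `q` are equivalent to `k m = p ⊗ p`
(`LocalFraming.integrableAt_iff_cov₂`), and the theorem says that this tensor equation
characterizes Darboux integrability. The forms `θ₀, …, θ₃` are completed to a coframe of the
eight-manifold by `ω¹₃`, `ω²₃`, `η¹`, `η²`. The structure equations of this coframe, together with
`k`, `p`, `m` and their derivatives, are all that matters for most of the argument; they are the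
content of the structure `EmbeddingCoframe`.

Modulo `θ`, the two-forms of the system are spanned by `ω¹₃ ∧ η¹ + ω²₃ ∧ η²` and
`ω¹₃ ∧ ω²₃ - k² η¹ ∧ η²`. By the Plücker relation the decomposable ones are, up to factors,
`σ¹ ∧ σ²` and its conjugate, where `σ¹ = ω¹₃ - i k η²` and `σ² = ω²₃ + i k η¹`. Hence the singular
systems of any decomposition are `V = {θ, σ}` and its conjugate
(`EmbeddingCoframe.rankCondition_of_decomposition`). Replacing `k` by `-k` acts as complex
conjugation, so only one of them has to be studied.

The derived flag of `V` drops to rank five and then to rank three, and the elements of rank three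
are explicit (`derivedSystem_singular_le`, `derivedSystem_singular₁_le`).

* If `k m = p ⊗ p`, then the forms `k σʲ - i pⱼ θ₃` span a Frobenius system inside `V`
  (`extD_firstIntegral_mem`). It has rank two and is complementary to the conjugate of `V`, while
  the rank three bounds for `V` and its conjugate meet in zero. This gives the Darboux pair.
* Conversely, a Darboux pair forces the final derived system to contain forms congruent to `σ¹` and
  `σ²` modulo the conjugate of `V`. Evaluating their exterior derivatives on complex vectors
  annihilated by the rank three system gives polynomial conditions on `k`, `p`, `m` and `∇m`
  (`RankCondition`). Where `p ≠ 0` they leave only `k m = p ⊗ p` and `k m = -p^⊥ ⊗ p^⊥`, and the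
  second equation, once differentiated, contradicts the conditions on `∇m`
  (`LocalFraming.integrableAt_of_grad_ne_zero`). Where `p` vanishes identically the curvature is
  constant, and the conditions fail outright.

To pass from the product back to the surface one needs one coordinate patch through a given point;
it is provided by the angles of a moving frame of `ℝ³` (`anglePatch`).
-/

noncomputable section

namespace DarbouxEmbedding

/-! ### Exterior calculus of one-forms and complex tangent vectors -/

section Calculus

variable {E : Type*} [NormedAddCommGroup E] [NormedSpace ℝ E]

theorem extD_skew {F : Type*} [NormedAddCommGroup F] [NormedSpace ℝ F]
    (ψ : E → E →L[ℝ] F) (x v w : E) : extD ψ x v w = -extD ψ x w v := by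
  simp [extD_apply]

theorem extD_congr {F : Type*} [NormedAddCommGroup F] [NormedSpace ℝ F]
    {ψ φ : E → E →L[ℝ] F} {x : E} (h : ψ =ᶠ[𝓝 x] φ) : extD ψ x = extD φ x := by
  simp [extD, h.fderiv_eq]

theorem wedge_add_left (α β γ : E →L[ℝ] ℂ) : wedge (α + β) γ = wedge α γ + wedge β γ := by
  ext v w; simp [wedge_apply]; ring

theorem wedge_add_right (α β γ : E →L[ℝ] ℂ) : wedge α (β + γ) = wedge α β + wedge α γ := by
  ext v w; simp [wedge_apply]; ring

theorem complexify_apply (α : E →L[ℝ] ℝ) (v : E) : complexify α v = (α v : ℂ) := rfl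

theorem conjOne_complexify (α : E →L[ℝ] ℝ) : conjOne (complexify α) = complexify α := by
  ext v; simp [conjOne_apply, complexify_apply]

/-- The Leibniz rule `d(∑ fᵢ αᵢ) = ∑ (dfᵢ ∧ αᵢ + fᵢ dαᵢ)`. -/
theorem extD_sum_smul {ι : Type*} [Fintype ι] {f : ι → E → ℂ} {G : ι → E → E →L[ℝ] ℂ} {x : E}
    (hf : ∀ i, DifferentiableAt ℝ (f i) x) (hG : ∀ i, DifferentiableAt ℝ (G i) x) :
    extD (fun y => ∑ i, f i y • G i y) x =
      ∑ i, (wedge (fderiv ℝ (f i) x) (G i x) + f i x • extD (G i) x) := by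
  have h : HasFDerivAt (fun y => ∑ i, f i y • G i y)
      (∑ i, (f i x • fderiv ℝ (G i) x + (fderiv ℝ (f i) x).smulRight (G i x))) x :=
    HasFDerivAt.fun_sum fun i _ => (hf i).hasFDerivAt.smul (hG i).hasFDerivAt
  ext v w
  simp only [extD_apply, h.fderiv, sum_apply, add_apply, smul_apply,
    ContinuousLinearMap.smulRight_apply, wedge_apply, smul_eq_mul, ← Finset.sum_sub_distrib]
  exact Finset.sum_congr rfl fun i _ => by ring

theorem extD_complexify {ψ : E → E →L[ℝ] ℝ} {x : E} (h : DifferentiableAt ℝ ψ x) (v w : E) :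
    extD (fun y => complexify (ψ y)) x v w = (extD ψ x v w : ℂ) := by
  have : HasFDerivAt (fun y => complexify (ψ y))
      ((ContinuousLinearMap.compL ℝ E ℝ ℂ Complex.ofRealCLM).comp (fderiv ℝ ψ x)) x :=
    (ContinuousLinearMap.compL ℝ E ℝ ℂ Complex.ofRealCLM).hasFDerivAt.comp x h.hasFDerivAt
  simp [extD_apply, this.fderiv]

theorem contDiffOn_complexify {ψ : E → E →L[ℝ] ℝ} {O : Set E} {n : WithTop ℕ∞}
    (h : ContDiffOn ℝ n ψ O) : ContDiffOn ℝ n (fun y => complexify (ψ y)) O :=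
  (ContinuousLinearMap.compL ℝ E ℝ ℂ Complex.ofRealCLM).contDiff.comp_contDiffOn h

/-- The value of a complex covector on the complex tangent vector `X.1 + i X.2`. -/
def cev (X : E × E) : (E →L[ℝ] ℂ) →ₗ[ℂ] ℂ where
  toFun α := α X.1 + Complex.I * α X.2
  map_add' α β := by simp; ring
  map_smul' c α := by simp; ring

/-- The value of a complex two-covector on a pair of complex tangent vectors. -/
def cev₂ (X Y : E × E) : (E →L[ℝ] E →L[ℝ] ℂ) →ₗ[ℂ] ℂ where
  toFun β := β X.1 Y.1 + Complex.I * β X.1 Y.2 + Complex.I * β X.2 Y.1 - β X.2 Y.2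
  map_add' α β := by simp; ring
  map_smul' c α := by simp; ring

theorem cev_apply (X : E × E) (α : E →L[ℝ] ℂ) : cev X α = α X.1 + Complex.I * α X.2 := rfl

theorem cev₂_apply (X Y : E × E) (β : E →L[ℝ] E →L[ℝ] ℂ) :
    cev₂ X Y β = β X.1 Y.1 + Complex.I * β X.1 Y.2 + Complex.I * β X.2 Y.1 - β X.2 Y.2 := rfl

theorem cev_real (v : E) (α : E →L[ℝ] ℂ) : cev (v, 0) α = α v := by simp [cev_apply]

theorem cev₂_real (v w : E) (β : E →L[ℝ] E →L[ℝ] ℂ) : cev₂ (v, 0) (w, 0) β = β v w := by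
  simp [cev₂_apply]

theorem cev₂_wedge (X Y : E × E) (α β : E →L[ℝ] ℂ) :
    cev₂ X Y (wedge α β) = cev X α * cev Y β - cev Y α * cev X β := by
  simp only [cev₂_apply, cev_apply, wedge_apply]
  linear_combination (α Y.2 * β X.2 - α X.2 * β Y.2) * Complex.I_sq

/-! ### Ideals generated by a subspace of covectors -/

theorem wedge_mem_idealTwo {V : Submodule ℂ (E →L[ℝ] ℂ)} (α : E →L[ℝ] ℂ) {γ : E →L[ℝ] ℂ}
    (h : γ ∈ V) : wedge α γ ∈ idealTwo V :=
  Submodule.subset_span ⟨α, γ, h, rfl⟩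

theorem wedge_mem_idealTwo' {V : Submodule ℂ (E →L[ℝ] ℂ)} (α : E →L[ℝ] ℂ) {γ : E →L[ℝ] ℂ}
    (h : γ ∈ V) : wedge γ α ∈ idealTwo V := by
  have : wedge γ α = wedge (-α) γ := by ext v w; simp [wedge_apply]; ring
  rw [this]; exact wedge_mem_idealTwo _ h

theorem wedge_mem_extTwo {V : Submodule ℂ (E →L[ℝ] ℂ)} {α γ : E →L[ℝ] ℂ} (h' : α ∈ V)
    (h : γ ∈ V) : wedge α γ ∈ extTwo V :=
  Submodule.subset_span ⟨α, γ, h', h, rfl⟩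

theorem idealTwo_mono {V W : Submodule ℂ (E →L[ℝ] ℂ)} (h : V ≤ W) : idealTwo V ≤ idealTwo W :=
  Submodule.span_mono fun _ ⟨α, γ, hγ, e⟩ => ⟨α, γ, h hγ, e⟩

/-- A two-covector in the ideal of `V` vanishes on the complex vectors annihilated by `V`. -/
theorem cev₂_eq_zero {V : Submodule ℂ (E →L[ℝ] ℂ)} {X Y : E × E} (hX : ∀ γ ∈ V, cev X γ = 0)
    (hY : ∀ γ ∈ V, cev Y γ = 0) {β : E →L[ℝ] E →L[ℝ] ℂ} (hβ : β ∈ idealTwo V) :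
    cev₂ X Y β = 0 := by
  have : idealTwo V ≤ LinearMap.ker (cev₂ X Y) := by
    refine Submodule.span_le.2 ?_
    rintro _ ⟨α, γ, hγ, rfl⟩
    simp [cev₂_wedge, hX γ hγ, hY γ hγ]
  exact this hβ

theorem cev_spanSystem {ι : Type*} {θ : ι → E → E →L[ℝ] ℂ} {x : E} {X : E × E}
    (h : ∀ i, cev X (θ i x) = 0) : ∀ γ ∈ spanSystem θ x, cev X γ = 0 := by
  intro γ hγ
  have : spanSystem θ x ≤ LinearMap.ker (cev X) := by
    refine Submodule.span_le.2 ?_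
    rintro _ ⟨i, rfl⟩
    exact h i
  exact this hγ

theorem mem_spanSystem {ι : Type*} (θ : ι → E → E →L[ℝ] ℂ) (x : E) (i : ι) :
    θ i x ∈ spanSystem θ x := Submodule.subset_span ⟨i, rfl⟩

theorem spanSystem_le {ι : Type*} {θ : ι → E → E →L[ℝ] ℂ} {x : E}
    {V : Submodule ℂ (E →L[ℝ] ℂ)} (h : ∀ i, θ i x ∈ V) : spanSystem θ x ≤ V := by
  refine Submodule.span_le.2 ?_
  rintro _ ⟨i, rfl⟩
  exact h i

theorem mem_spanSystem_iff {ι : Type*} [Fintype ι] {θ : ι → E → E →L[ℝ] ℂ} {x : E}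
    {γ : E →L[ℝ] ℂ} : γ ∈ spanSystem θ x ↔ ∃ f : ι → ℂ, ∑ i, f i • θ i x = γ :=
  Submodule.mem_span_range_iff_exists_fun ℂ

theorem spanSystem_sumElim {ι κ : Type*} (θ : ι → E → E →L[ℝ] ℂ) (σ : κ → E → E →L[ℝ] ℂ)
    (x : E) : spanSystem (Sum.elim θ σ) x = spanSystem θ x ⊔ spanSystem σ x := by
  rw [spanSystem, spanSystem, spanSystem, ← Submodule.span_union]
  congr 1
  ext α
  simp

/-- The second exterior power of a plane is a line. -/
theorem mem_extTwo_pair {σ : Fin 2 → E → E →L[ℝ] ℂ} {x : E} {β : E →L[ℝ] E →L[ℝ] ℂ}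
    (h : β ∈ extTwo (spanSystem σ x)) : ∃ s : ℂ, β = s • wedge (σ 0 x) (σ 1 x) := by
  have : extTwo (spanSystem σ x) ≤ Submodule.span ℂ {wedge (σ 0 x) (σ 1 x)} := by
    refine Submodule.span_le.2 ?_
    rintro _ ⟨α, γ, hα, hγ, rfl⟩
    obtain ⟨f, rfl⟩ := mem_spanSystem_iff.1 hα
    obtain ⟨g, rfl⟩ := mem_spanSystem_iff.1 hγ
    refine Submodule.mem_span_singleton.2 ⟨f 0 * g 1 - f 1 * g 0, ?_⟩
    ext v w
    simp [wedge_apply, Fin.sum_univ_two]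
    ring
  obtain ⟨s, hs⟩ := Submodule.mem_span_singleton.1 (this h)
  exact ⟨s, hs.symm⟩

/-! ### Derived systems -/

theorem derivedSystem_mono {V W : E → Submodule ℂ (E →L[ℝ] ℂ)} {x : E}
    (h : ∀ᶠ y in 𝓝 x, V y ≤ W y) : derivedSystem V x ≤ derivedSystem W x := by
  refine Submodule.span_mono ?_
  rintro α ⟨ψ, hs, hd, rfl⟩
  refine ⟨ψ, ?_, ?_, rfl⟩
  · filter_upwards [h, hs] with y hy hy' using ⟨hy'.1, hy hy'.2⟩
  · filter_upwards [h, hd] with y hy hy' using idealTwo_mono hy hy'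

theorem iterate_derivedSystem_mono (n : ℕ) {V W : E → Submodule ℂ (E →L[ℝ] ℂ)} {x : E}
    (h : ∀ᶠ y in 𝓝 x, V y ≤ W y) : derivedSystem^[n] V x ≤ derivedSystem^[n] W x := by
  suffices H : ∀ᶠ y in 𝓝 x, derivedSystem^[n] V y ≤ derivedSystem^[n] W y from H.self_of_nhds
  induction n with
  | zero => exact h
  | succ n ih =>
    filter_upwards [ih.eventually_nhds] with y hy
    rw [Function.iterate_succ_apply', Function.iterate_succ_apply']
    exact derivedSystem_mono hy

theorem finalDerived_mono {V W : E → Submodule ℂ (E →L[ℝ] ℂ)} {x : E}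
    (h : ∀ᶠ y in 𝓝 x, V y ≤ W y) : finalDerived V x ≤ finalDerived W x :=
  iInf_mono fun n => iterate_derivedSystem_mono n h

/-- Near a point, a smooth section of a system spanned by `Gᵢ` that has a smooth dual family of
vector fields `nⱼ` is a combination of the `Gᵢ` with differentiable coefficients. -/
theorem IsLocalSection.exists_coeff {m : ℕ} {O : Set E} (hO : IsOpen O)
    {G : Fin m → E → E →L[ℝ] ℂ} {n : Fin m → E → E}
    (hn : ∀ i, ContDiffOn ℝ ∞ (n i) O)
    (hGn : ∀ y ∈ O, ∀ i j, G i y (n j y) = if i = j then 1 else 0)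
    {x : E} (hx : x ∈ O) {ψ : E → E →L[ℝ] ℂ} (hψ : IsLocalSection (spanSystem G) x ψ) :
    ∃ f : Fin m → E → ℂ, (∀ i, DifferentiableAt ℝ (f i) x) ∧
      ψ =ᶠ[𝓝 x] fun y => ∑ i, f i y • G i y := by
  refine ⟨fun i y => ψ y (n i y), fun i => ?_, ?_⟩
  · have h1 : DifferentiableAt ℝ ψ x := hψ.self_of_nhds.1.differentiableAt (by simp)
    have h2 : DifferentiableAt ℝ (n i) x :=
      ((hn i).contDiffAt (hO.mem_nhds hx)).differentiableAt (by simp)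
    exact h1.clm_apply h2
  · filter_upwards [hψ, hO.mem_nhds hx] with y hy hyO
    obtain ⟨f, hf⟩ := mem_spanSystem_iff.1 hy.2
    have : ∀ i, ψ y (n i y) = f i := by
      intro i
      rw [← hf]
      simp [hGn y hyO]
    simp only [this, hf]

/-- An upper bound for the derived system of a system with a smooth dual frame. It suffices to
consider the values of the coefficients at the given point, since the terms `dfᵢ ∧ Gᵢ` lie in the
ideal. -/
theorem derivedSystem_le {m : ℕ} {O : Set E} (hO : IsOpen O)
    {G : Fin m → E → E →L[ℝ] ℂ} {n : Fin m → E → E}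
    (hG : ∀ y ∈ O, ∀ i, DifferentiableAt ℝ (G i) y) (hn : ∀ i, ContDiffOn ℝ ∞ (n i) O)
    (hGn : ∀ y ∈ O, ∀ i j, G i y (n j y) = if i = j then 1 else 0)
    {x : E} (hx : x ∈ O) {V : Submodule ℂ (E →L[ℝ] ℂ)}
    (H : ∀ f : Fin m → ℂ, ∑ i, f i • extD (G i) x ∈ idealTwo (spanSystem G x) →
      ∑ i, f i • G i x ∈ V) :
    derivedSystem (spanSystem G) x ≤ V := by
  refine Submodule.span_le.2 ?_
  rintro _ ⟨ψ, hs, hd, rfl⟩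
  obtain ⟨f, hf, hψ⟩ := hs.exists_coeff hO hn hGn hx
  have h1 : extD ψ x = _ := (extD_congr hψ).trans (extD_sum_smul hf (hG x hx))
  have h2 := hd.self_of_nhds
  rw [hψ.self_of_nhds]
  refine H (fun i => f i x) ?_
  rw [h1, Finset.sum_add_distrib] at h2
  refine (Submodule.add_mem_iff_right _ ?_).1 h2
  exact Submodule.sum_mem _ fun i _ => wedge_mem_idealTwo _ (mem_spanSystem G x i)

/-- A Frobenius-integrable subsystem lies in the final derived system. -/
theorem le_finalDerived {ι : Type*} {O : Set E} (hO : IsOpen O) {G : ι → E → E →L[ℝ] ℂ}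
    {V : E → Submodule ℂ (E →L[ℝ] ℂ)} (hG : ∀ i, ContDiffOn ℝ ∞ (G i) O)
    (hV : ∀ y ∈ O, ∀ i, G i y ∈ V y)
    (hd : ∀ y ∈ O, ∀ i, extD (G i) y ∈ idealTwo (spanSystem G y)) {x : E} (hx : x ∈ O) :
    spanSystem G x ≤ finalDerived V x := by
  refine le_iInf fun n => ?_
  induction n generalizing x with
  | zero => exact spanSystem_le (hV x hx)
  | succ n ih =>
    rw [Function.iterate_succ_apply']
    refine spanSystem_le fun i => Submodule.subset_span ⟨G i, ?_, ?_, rfl⟩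
    · filter_upwards [hO.mem_nhds hx] with y hy
      exact ⟨(hG i).contDiffAt (hO.mem_nhds hy), ih hy (mem_spanSystem G y i)⟩
    · filter_upwards [hO.mem_nhds hx] with y hy
      exact idealTwo_mono (ih hy) (hd y hy i)

end Calculus

/-! ### The structure equations of the isometric embedding system -/

section Structure

/-- The structure equations of the coframe `(θ₀, θ₁, θ₂, θ₃, ω¹₃, ω²₃, η¹, η²)`, as bilinear
functions of the components `x`, `y` of two tangent vectors. Here `η¹₂ = h₀ η¹ + h₁ η²` and `k²` is
the Gauss curvature. -/
def structureForm {R : Type*} [CommRing R] (k h₀ h₁ : R) (x y : Fin 8 → R) : Fin 8 → R :=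
  ![x 4 * (y 1 + y 6) - y 4 * (x 1 + x 6) + (x 5 * (y 2 + y 7) - y 5 * (x 2 + x 7)),
    -((x 3 + (h₀ * x 6 + h₁ * x 7)) * (y 2 + y 7) - (y 3 + (h₀ * y 6 + h₁ * y 7)) * (x 2 + x 7))
      - (x 4 * y 0 - y 4 * x 0) + ((h₀ * x 6 + h₁ * x 7) * y 7 - (h₀ * y 6 + h₁ * y 7) * x 7),
    (x 3 + (h₀ * x 6 + h₁ * x 7)) * (y 1 + y 6) - (y 3 + (h₀ * y 6 + h₁ * y 7)) * (x 1 + x 6)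
      - (x 5 * y 0 - y 5 * x 0) - ((h₀ * x 6 + h₁ * x 7) * y 6 - (h₀ * y 6 + h₁ * y 7) * x 6),
    x 4 * y 5 - y 4 * x 5 - k ^ 2 * (x 6 * y 7 - y 6 * x 7),
    -((x 3 + (h₀ * x 6 + h₁ * x 7)) * y 5 - (y 3 + (h₀ * y 6 + h₁ * y 7)) * x 5),
    (x 3 + (h₀ * x 6 + h₁ * x 7)) * y 4 - (y 3 + (h₀ * y 6 + h₁ * y 7)) * x 4,
    -((h₀ * x 6 + h₁ * x 7) * y 7 - (h₀ * y 6 + h₁ * y 7) * x 7),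
    (h₀ * x 6 + h₁ * x 7) * y 6 - (h₀ * y 6 + h₁ * y 7) * x 6]

/-- The exterior derivative of the form with components `g` in a coframe as in `structureForm`,
if the components are functions on the surface with `dg = r η¹ + s η²`. -/
def structureD (k h₀ h₁ : ℂ) (g r s x y : Fin 8 → ℂ) : ℂ :=
  ∑ a, ((r a * x 6 + s a * x 7) * y a - (r a * y 6 + s a * y 7) * x a +
    g a * structureForm k h₀ h₁ x y a)

variable {E : Type*} [NormedAddCommGroup E] [NormedSpace ℝ E]

/-- The local geometry of the isometric embedding system: the coframe
`(θ₀, θ₁, θ₂, θ₃, ω¹₃, ω²₃, η¹, η²)` with its dual frame and structure equations, and the functions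
on the surface which enter: `k` is one of the two square roots of the Gauss curvature, `p` is the
logarithmic differential of `k`, up to a factor two, and `2 k m` is `∇p - p ⊗ p + k²`,
a symmetric tensor with components `m 0`, `m 1`, `m 2` for the index pairs `11`, `12`, `22`. -/
structure EmbeddingCoframe (O : Set E) where
  isOpen_O : IsOpen O
  χ : Fin 8 → E → E →L[ℝ] ℝ
  e : Fin 8 → E → E
  k : E → ℝ
  h : Fin 2 → E → ℝ
  p : Fin 2 → E → ℝ
  m : Fin 3 → E → ℝ
  dm : Fin 3 → Fin 2 → E → ℝ
  smooth_χ : ∀ a, ContDiffOn ℝ ∞ (χ a) O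
  smooth_e : ∀ a, ContDiffOn ℝ ∞ (e a) O
  smooth_k : ContDiffOn ℝ ∞ k O
  smooth_p : ∀ i, ContDiffOn ℝ ∞ (p i) O
  k_ne_zero : ∀ y ∈ O, k y ≠ 0
  dual : ∀ y ∈ O, ∀ a b, χ a y (e b y) = if a = b then 1 else 0
  expand : ∀ y ∈ O, ∀ v, ∑ a, χ a y v • e a y = v
  extD_χ : ∀ y ∈ O, ∀ v w, ∀ a, extD (χ a) y v w =
    structureForm (k y) (h 0 y) (h 1 y) (fun b => χ b y v) (fun b => χ b y w) a
  deriv_k : ∀ y ∈ O, HasFDerivAt k ((2 * k y * p 0 y) • χ 6 y + (2 * k y * p 1 y) • χ 7 y) y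
  deriv_p0 : ∀ y ∈ O, HasFDerivAt (p 0)
    ((-p 1 y * h 0 y + (2 * k y * m 0 y + p 0 y ^ 2 - k y ^ 2)) • χ 6 y +
      (-p 1 y * h 1 y + (2 * k y * m 1 y + p 0 y * p 1 y)) • χ 7 y) y
  deriv_p1 : ∀ y ∈ O, HasFDerivAt (p 1)
    ((p 0 y * h 0 y + (2 * k y * m 1 y + p 0 y * p 1 y)) • χ 6 y +
      (p 0 y * h 1 y + (2 * k y * m 2 y + p 1 y ^ 2 - k y ^ 2)) • χ 7 y) y
  deriv_m : ∀ y ∈ O, ∀ i, HasFDerivAt (m i) (dm i 0 y • χ 6 y + dm i 1 y • χ 7 y) y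

namespace EmbeddingCoframe

variable {O : Set E} (D : EmbeddingCoframe O)

/-- The same geometry with the other square root of the Gauss curvature. On complex forms with
coefficients in `i k` this is complex conjugation. -/
def neg : EmbeddingCoframe O where
  __ := D
  k y := -D.k y
  m i y := -D.m i y
  dm i j y := -D.dm i j y
  smooth_k := D.smooth_k.neg
  k_ne_zero y hy := neg_ne_zero.2 (D.k_ne_zero y hy)
  extD_χ y hy v w a := by
    rw [D.extD_χ y hy v w a]
    simp [structureForm]
  deriv_k y hy := by
    refine (D.deriv_k y hy).neg.congr_fderiv ?_
    ext v; simp; ring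
  deriv_p0 y hy := by
    refine (D.deriv_p0 y hy).congr_fderiv ?_
    ext v; simp
  deriv_p1 y hy := by
    refine (D.deriv_p1 y hy).congr_fderiv ?_
    ext v; simp
  deriv_m y hy i := by
    refine (D.deriv_m y hy i).neg.congr_fderiv ?_
    ext v; simp; ring

/-- The complexified coframe. -/
def X (a : Fin 8) (y : E) : E →L[ℝ] ℂ := complexify (D.χ a y)

/-- The complex covector with given components in the coframe. -/
def cov (y : E) (z : Fin 8 → ℂ) : E →L[ℝ] ℂ := ∑ a, z a • D.X a y

/-- The complex tangent vector with given components in the dual frame. -/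
def vec (y : E) (z : Fin 8 → ℂ) : E × E :=
  (∑ a, (z a).re • D.e a y, ∑ a, (z a).im • D.e a y)

/-- The family of complex one-forms with given components in the coframe. -/
def sys {ι : Type*} (c : ι → E → Fin 8 → ℂ) (i : ι) (y : E) : E →L[ℝ] ℂ := D.cov y (c i y)

theorem X_apply (a : Fin 8) (y v : E) : D.X a y v = (D.χ a y v : ℂ) := rfl

theorem neg_X : D.neg.X = D.X := rfl
theorem neg_cov : D.neg.cov = D.cov := rfl

theorem neg_k (y : E) : D.neg.k y = -D.k y := rfl
theorem neg_p : D.neg.p = D.p := rfl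
theorem neg_m (i : Fin 3) (y : E) : D.neg.m i y = -D.m i y := rfl

variable {D} {y : E}

theorem nhds_O (D : EmbeddingCoframe O) (hy : y ∈ O) : O ∈ 𝓝 y := D.isOpen_O.mem_nhds hy

theorem smooth_X (a : Fin 8) : ContDiffOn ℝ ∞ (D.X a) O := contDiffOn_complexify (D.smooth_χ a)

theorem differentiableAt_X (a : Fin 8) (hy : y ∈ O) : DifferentiableAt ℝ (D.X a) y :=
  ((D.smooth_X a).contDiffAt (D.nhds_O hy)).differentiableAt (by simp)

theorem X_e (hy : y ∈ O) (a b : Fin 8) : D.X a y (D.e b y) = if a = b then 1 else 0 := by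
  rw [X_apply, D.dual y hy]
  split_ifs <;> simp

theorem cov_e (hy : y ∈ O) (z : Fin 8 → ℂ) (b : Fin 8) : D.cov y z (D.e b y) = z b := by
  simp [cov, X_e hy]

theorem cov_components (hy : y ∈ O) (α : E →L[ℝ] ℂ) : D.cov y (fun a => α (D.e a y)) = α := by
  ext v
  conv_rhs => rw [← D.expand y hy v]
  simp [cov, X_apply, mul_comm]

theorem cov_injective (hy : y ∈ O) {z w : Fin 8 → ℂ} (h : D.cov y z = D.cov y w) : z = w := by
  funext b
  rw [← D.cov_e hy z b, h, D.cov_e hy]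

theorem cov_add (y : E) (z w : Fin 8 → ℂ) : D.cov y z + D.cov y w = D.cov y (z + w) := by
  ext v
  simp [cov, add_mul, Finset.sum_add_distrib]

theorem cov_smul (y : E) (c : ℂ) (z : Fin 8 → ℂ) : c • D.cov y z = D.cov y (c • z) := by
  ext v
  simp [cov, Finset.mul_sum, mul_assoc]

theorem cov_sum {ι : Type*} [Fintype ι] (y : E) (f : ι → ℂ) (z : ι → Fin 8 → ℂ) :
    ∑ i, f i • D.cov y (z i) = D.cov y (∑ i, f i • z i) := by
  ext v
  simp only [cov, sum_apply, smul_apply, smul_eq_mul, Finset.mul_sum, Finset.sum_apply,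
    Pi.smul_apply, Finset.sum_mul, mul_assoc]
  exact Finset.sum_comm

theorem mem_sys_iff {ι : Type*} [Fintype ι] (hy : y ∈ O) {c : ι → E → Fin 8 → ℂ}
    {z : Fin 8 → ℂ} :
    D.cov y z ∈ spanSystem (D.sys c) y ↔ ∃ f : ι → ℂ, ∑ i, f i • c i y = z := by
  rw [mem_spanSystem_iff]
  constructor
  · rintro ⟨f, hf⟩
    exact ⟨f, D.cov_injective hy ((D.cov_sum y f fun i => c i y).symm.trans hf)⟩
  · rintro ⟨f, rfl⟩
    exact ⟨f, D.cov_sum y f fun i => c i y⟩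

theorem cev_vec (hy : y ∈ O) (z : Fin 8 → ℂ) (a : Fin 8) : cev (D.vec y z) (D.X a y) = z a := by
  simp only [cev_apply, vec, map_sum, map_smul, X_e hy]
  simp [mul_comm Complex.I, Complex.re_add_im]

theorem cev_vec_cov (hy : y ∈ O) (z w : Fin 8 → ℂ) :
    cev (D.vec y z) (D.cov y w) = ∑ a, w a * z a := by
  simp [cov, cev_vec hy]

theorem cev₂_extD_X (hy : y ∈ O) (a : Fin 8) (Y Z : E × E) :
    cev₂ Y Z (extD (D.X a) y) = structureForm (D.k y : ℂ) (D.h 0 y) (D.h 1 y)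
      (fun b => cev Y (D.X b y)) (fun b => cev Z (D.X b y)) a := by
  have hd : DifferentiableAt ℝ (D.χ a) y :=
    ((D.smooth_χ a).contDiffAt (D.nhds_O hy)).differentiableAt (by simp)
  have key : ∀ v w, extD (D.X a) y v w = structureForm (D.k y : ℂ) (D.h 0 y) (D.h 1 y)
      (fun b => (D.χ b y v : ℂ)) (fun b => (D.χ b y w : ℂ)) a := by
    intro v w
    rw [show D.X a = fun y => complexify (D.χ a y) from rfl, extD_complexify hd, D.extD_χ y hy]
    fin_cases a <;> simp [structureForm]
  simp only [cev₂_apply, cev_apply, X_apply, key]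
  generalize D.k y = k
  fin_cases a <;> simp only [structureForm, Fin.zero_eta, Fin.mk_one, Fin.reduceFinMk,
    Matrix.cons_val] <;> ring_nf <;> simp only [Complex.I_sq] <;> ring

/-- `g` is differentiable at `y` with `dg = r η¹ + s η²`. -/
def HasBaseDeriv (D : EmbeddingCoframe O) (g : E → ℂ) (r s : ℂ) (y : E) : Prop :=
  HasFDerivAt g (r • D.X 6 y + s • D.X 7 y) y

theorem HasBaseDeriv.const (c : ℂ) : D.HasBaseDeriv (fun _ => c) 0 0 y := by
  refine (hasFDerivAt_const (𝕜 := ℝ) c y).congr_fderiv ?_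
  ext v
  simp

theorem HasBaseDeriv.const_mul {g : E → ℂ} {r s : ℂ} (c : ℂ) (h : D.HasBaseDeriv g r s y) :
    D.HasBaseDeriv (fun y => c * g y) (c * r) (c * s) y := by
  have := HasFDerivAt.const_mul h c
  refine this.congr_fderiv ?_
  ext v
  simp
  ring

theorem HasBaseDeriv.neg {g : E → ℂ} {r s : ℂ} (h : D.HasBaseDeriv g r s y) :
    D.HasBaseDeriv (fun y => -g y) (-r) (-s) y := by
  refine (HasFDerivAt.neg h).congr_fderiv ?_
  ext v
  simp
  ring

theorem HasBaseDeriv.ofReal {g : E → ℝ} {r s : ℝ}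
    (h : HasFDerivAt g (r • D.χ 6 y + s • D.χ 7 y) y) :
    D.HasBaseDeriv (fun y => (g y : ℂ)) r s y := by
  have := (Complex.ofRealCLM.hasFDerivAt (x := g y)).comp y h
  refine this.congr_fderiv ?_
  ext v
  simp [X_apply]

theorem hasFDerivAt_k_sq (hy : y ∈ O) :
    HasFDerivAt (fun y => D.k y ^ 2)
      ((4 * D.k y ^ 2 * D.p 0 y) • D.χ 6 y + (4 * D.k y ^ 2 * D.p 1 y) • D.χ 7 y) y := by
  refine ((D.deriv_k y hy).pow 2).congr_fderiv ?_
  ext v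
  simp
  ring

/-- The exterior derivative of a form whose components are functions on the surface. -/
theorem cev₂_extD_cov (hy : y ∈ O) {g : E → Fin 8 → ℂ} {r s : Fin 8 → ℂ}
    (hg : ∀ a, D.HasBaseDeriv (fun y => g y a) (r a) (s a) y) (Y Z : E × E) :
    cev₂ Y Z (extD (fun y => D.cov y (g y)) y) =
      structureD (D.k y) (D.h 0 y) (D.h 1 y) (g y) r s
        (fun b => cev Y (D.X b y)) (fun b => cev Z (D.X b y)) := by
  have h := extD_sum_smul (f := fun a y => g y a) (G := D.X) (fun a => (hg a).differentiableAt)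
    (fun a => D.differentiableAt_X a hy)
  have h' : (fun y => D.cov y (g y)) = fun y => ∑ a, g y a • D.X a y := rfl
  rw [h', h, structureD, map_sum]
  refine Finset.sum_congr rfl fun a _ => ?_
  have h2 : fderiv ℝ (fun y => g y a) y = r a • D.X 6 y + s a • D.X 7 y := (hg a).fderiv
  rw [map_add, cev₂_wedge, map_smul, cev₂_extD_X hy, h2]
  simp

theorem differentiableAt_cov (hy : y ∈ O) {g : E → Fin 8 → ℂ} {r s : Fin 8 → ℂ}
    (hg : ∀ a, D.HasBaseDeriv (fun y => g y a) (r a) (s a) y) :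
    DifferentiableAt ℝ (fun y => D.cov y (g y)) y := by
  have : (fun y => D.cov y (g y)) = fun y => ∑ a, g y a • D.X a y := rfl
  rw [this]
  exact DifferentiableAt.fun_sum fun a _ =>
    (hg a).differentiableAt.smul (D.differentiableAt_X a hy)

end EmbeddingCoframe

end Structure

/-! ### The derived flag of a singular system -/

section DerivedFlag

variable {E : Type*} [NormedAddCommGroup E] [NormedSpace ℝ E] {O : Set E}

namespace EmbeddingCoframe

variable {D : EmbeddingCoframe O} {y : E}

/-- A derived system of a system whose components are functions on the surface, in terms of the
structure equations: the two-form `∑ fᵢ dGᵢ` vanishes on the complex vectors which the system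
annihilates. -/
theorem mem_derivedSystem_sys {n : ℕ} {c : Fin n → E → Fin 8 → ℂ} {r s : Fin n → E → Fin 8 → ℂ}
    (j : Fin n → Fin 8)
    (hc : ∀ y ∈ O, ∀ i a, D.HasBaseDeriv (fun y => c i y a) (r i y a) (s i y a) y)
    (hj : ∀ y i i', c i y (j i') = if i = i' then 1 else 0) (hy : y ∈ O)
    {ψ : E →L[ℝ] ℂ} (hψ : ψ ∈ derivedSystem (spanSystem (D.sys c)) y) :
    ∃ f : Fin n → ℂ, ψ = D.cov y (∑ i, f i • c i y) ∧
      ∀ z w : Fin 8 → ℂ, (∀ i, ∑ a, c i y a * z a = 0) → (∀ i, ∑ a, c i y a * w a = 0) →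
        ∑ i, f i * structureD (D.k y) (D.h 0 y) (D.h 1 y) (c i y) (r i y) (s i y) z w = 0 := by
  let V : Submodule ℂ (E →L[ℝ] ℂ) :=
    { carrier := {ψ | ∃ f : Fin n → ℂ, ψ = D.cov y (∑ i, f i • c i y) ∧
        ∀ z w : Fin 8 → ℂ, (∀ i, ∑ a, c i y a * z a = 0) → (∀ i, ∑ a, c i y a * w a = 0) →
          ∑ i, f i * structureD (D.k y) (D.h 0 y) (D.h 1 y) (c i y) (r i y) (s i y) z w = 0}
      zero_mem' := ⟨0, by ext v; simp [cov], by simp⟩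
      add_mem' := by
        rintro _ _ ⟨f, rfl, hf⟩ ⟨g, rfl, hg⟩
        refine ⟨f + g, by simp [cov_add, add_smul, Finset.sum_add_distrib], fun z w hz hw => ?_⟩
        simp [add_mul, Finset.sum_add_distrib, hf z w hz hw, hg z w hz hw]
      smul_mem' := by
        rintro a _ ⟨f, rfl, hf⟩
        refine ⟨a • f, by simp [cov_smul, Finset.smul_sum, mul_smul], fun z w hz hw => ?_⟩
        simp [mul_assoc, ← Finset.mul_sum, hf z w hz hw] }
  refine (?_ : derivedSystem (spanSystem (D.sys c)) y ≤ V) hψ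
  refine derivedSystem_le (n := fun i => D.e (j i)) D.isOpen_O
    (fun y hy i => D.differentiableAt_cov hy (hc y hy i)) (fun i => D.smooth_e _)
    (fun y hy i i' => ?_) hy fun f hf => ⟨f, D.cov_sum y f fun i => c i y, fun z w hz hw => ?_⟩
  · exact (cov_e hy _ _).trans (hj y i i')
  · have ann : ∀ z : Fin 8 → ℂ, (∀ i, ∑ a, c i y a * z a = 0) →
        ∀ γ ∈ spanSystem (D.sys c) y, cev (D.vec y z) γ = 0 := fun z hz =>
      cev_spanSystem fun i => (cev_vec_cov hy _ _).trans (hz i)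
    have h := cev₂_eq_zero (ann z hz) (ann w hw) hf
    rw [map_sum] at h
    rw [← h]
    refine Finset.sum_congr rfl fun i _ => ?_
    rw [map_smul, smul_eq_mul, D.cev₂_extD_cov hy (hc y hy i)]
    simp only [cev_vec hy]

open Complex (I)

variable (D)

/-- The components of the singular system `(θ₀, θ₁, θ₂, θ₃, σ¹, σ²)`, where
`σ¹ = ω¹₃ - i k η²` and `σ² = ω²₃ + i k η¹`. -/
def singular : Fin 6 → E → Fin 8 → ℂ := fun i y =>
  ![![1, 0, 0, 0, 0, 0, 0, 0], ![0, 1, 0, 0, 0, 0, 0, 0], ![0, 0, 1, 0, 0, 0, 0, 0],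
    ![0, 0, 0, 1, 0, 0, 0, 0], ![0, 0, 0, 0, 1, 0, 0, -(I * D.k y)],
    ![0, 0, 0, 0, 0, 1, I * D.k y, 0]] i

/-- The components of five forms that span a system containing the first derived system of the
singular system. -/
def singular₁ : Fin 5 → E → Fin 8 → ℂ := fun i y =>
  ![![0, 1, 0, 0, 0, 0, 0, 0], ![0, 0, 1, 0, 0, 0, 0, 0], ![I * D.k y, 0, 0, 1, 0, 0, 0, 0],
    ![-D.p 0 y, 0, 0, 0, 1, 0, 0, -(I * D.k y)], ![-D.p 1 y, 0, 0, 0, 0, 1, I * D.k y, 0]] i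

/-- The components of three forms that span a system containing the second derived system of the
singular system. -/
def singular₂ : Fin 3 → E → Fin 8 → ℂ := fun i y =>
  ![![I * D.k y, D.p 1 y, -D.p 0 y, 1, 0, 0, 0, 0],
    ![-D.p 0 y, I * D.m 1 y, -(I * D.m 0 y), 0, 1, 0, 0, -(I * D.k y)],
    ![-D.p 1 y, I * D.m 2 y, -(I * D.m 1 y), 0, 0, 1, I * D.k y, 0]] i

/-- The components of `dk` in the directions of the surface. -/
def dk (i : Fin 2) (y : E) : ℝ := 2 * D.k y * D.p i y

/-- The components of `dp` in the directions of the surface; the first index is that of `p`, the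
second one that of the direction. -/
def dp : Fin 2 → Fin 2 → E → ℝ := fun i j y =>
  !![-D.p 1 y * D.h 0 y + (2 * D.k y * D.m 0 y + D.p 0 y ^ 2 - D.k y ^ 2),
      -D.p 1 y * D.h 1 y + (2 * D.k y * D.m 1 y + D.p 0 y * D.p 1 y);
    D.p 0 y * D.h 0 y + (2 * D.k y * D.m 1 y + D.p 0 y * D.p 1 y),
      D.p 0 y * D.h 1 y + (2 * D.k y * D.m 2 y + D.p 1 y ^ 2 - D.k y ^ 2)] i j

/-- The derivatives of the components of `singular` in the directions of the surface. -/
def singularD (j : Fin 2) : Fin 6 → E → Fin 8 → ℂ := fun i y =>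
  ![0, 0, 0, 0, ![0, 0, 0, 0, 0, 0, 0, -(I * D.dk j y)], ![0, 0, 0, 0, 0, 0, I * D.dk j y, 0]] i

/-- The derivatives of the components of `singular₁` in the directions of the surface. -/
def singular₁D (j : Fin 2) : Fin 5 → E → Fin 8 → ℂ := fun i y =>
  ![0, 0, ![I * D.dk j y, 0, 0, 0, 0, 0, 0, 0],
    ![-D.dp 0 j y, 0, 0, 0, 0, 0, 0, -(I * D.dk j y)],
    ![-D.dp 1 j y, 0, 0, 0, 0, 0, I * D.dk j y, 0]] i

/-- The derivatives of the components of `singular₂` in the directions of the surface. -/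
def singular₂D (j : Fin 2) : Fin 3 → E → Fin 8 → ℂ := fun i y =>
  ![![I * D.dk j y, D.dp 1 j y, -D.dp 0 j y, 0, 0, 0, 0, 0],
    ![-D.dp 0 j y, I * D.dm 1 j y, -(I * D.dm 0 j y), 0, 0, 0, 0, -(I * D.dk j y)],
    ![-D.dp 1 j y, I * D.dm 2 j y, -(I * D.dm 1 j y), 0, 0, 0, I * D.dk j y, 0]] i

variable {D}

theorem hasBaseDeriv_k (hy : y ∈ O) :
    D.HasBaseDeriv (fun y => (D.k y : ℂ)) (D.dk 0 y) (D.dk 1 y) y :=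
  HasBaseDeriv.ofReal (D.deriv_k y hy)

theorem hasBaseDeriv_p (hy : y ∈ O) (i : Fin 2) :
    D.HasBaseDeriv (fun y => (D.p i y : ℂ)) (D.dp i 0 y) (D.dp i 1 y) y := by
  fin_cases i
  · exact HasBaseDeriv.ofReal (D.deriv_p0 y hy)
  · exact HasBaseDeriv.ofReal (D.deriv_p1 y hy)

theorem hasBaseDeriv_m (hy : y ∈ O) (i : Fin 3) :
    D.HasBaseDeriv (fun y => (D.m i y : ℂ)) (D.dm i 0 y) (D.dm i 1 y) y :=
  HasBaseDeriv.ofReal (D.deriv_m y hy i)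

theorem hasBaseDeriv_singular (y : E) (hy : y ∈ O) (i : Fin 6) (a : Fin 8) :
    D.HasBaseDeriv (fun y => D.singular i y a) (D.singularD 0 i y a) (D.singularD 1 i y a) y := by
  have hk := (hasBaseDeriv_k (D := D) hy).const_mul I
  fin_cases i <;> fin_cases a <;>
    first | exact HasBaseDeriv.const _ | exact hk | exact hk.neg

theorem hasBaseDeriv_singular₁ (y : E) (hy : y ∈ O) (i : Fin 5) (a : Fin 8) :
    D.HasBaseDeriv (fun y => D.singular₁ i y a) (D.singular₁D 0 i y a) (D.singular₁D 1 i y a)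
      y := by
  have hk := (hasBaseDeriv_k (D := D) hy).const_mul I
  have hp := hasBaseDeriv_p (D := D) hy
  fin_cases i <;> fin_cases a <;>
    first | exact HasBaseDeriv.const _ | exact hk | exact hk.neg | exact (hp _).neg

theorem hasBaseDeriv_singular₂ (y : E) (hy : y ∈ O) (i : Fin 3) (a : Fin 8) :
    D.HasBaseDeriv (fun y => D.singular₂ i y a) (D.singular₂D 0 i y a) (D.singular₂D 1 i y a)
      y := by
  have hk := (hasBaseDeriv_k (D := D) hy).const_mul I
  have hp := hasBaseDeriv_p (D := D) hy
  have hm := fun i => (hasBaseDeriv_m (D := D) hy i).const_mul I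
  fin_cases i <;> fin_cases a <;>
    first
    | exact HasBaseDeriv.const _ | exact hk | exact hk.neg | exact hp _ | exact (hp _).neg
    | exact hm _ | exact (hm _).neg

theorem derivedSystem_singular_le (hy : y ∈ O) :
    derivedSystem (spanSystem (D.sys D.singular)) y ≤ spanSystem (D.sys D.singular₁) y := by
  intro ψ hψ
  obtain ⟨f, rfl, hf⟩ := mem_derivedSystem_sys ![0, 1, 2, 3, 4, 5]
    D.hasBaseDeriv_singular (by intro y i i'; fin_cases i <;> fin_cases i' <;> rfl) hy hψ
  have h1 := hf ![0, 0, 0, 0, 0, -(I * D.k y), 1, 0] ![0, 0, 0, 0, I * D.k y, 0, 0, 1]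
    (by intro i; fin_cases i <;> simp [singular, Fin.sum_univ_eight])
    (by intro i; fin_cases i <;> simp [singular, Fin.sum_univ_eight])
  simp [structureD, structureForm, singular, singularD, dk, Fin.sum_univ_eight,
    Fin.sum_univ_six] at h1
  have hk : (D.k y : ℂ) ≠ 0 := by exact_mod_cast D.k_ne_zero y hy
  have h2 : f 0 = I * D.k y * f 3 - D.p 0 y * f 4 - D.p 1 y * f 5 := by
    refine mul_left_cancel₀ (mul_ne_zero (mul_ne_zero two_ne_zero Complex.I_ne_zero) hk) ?_
    linear_combination (-1) * h1 + (-(D.k y : ℂ) ^ 2 * f 3) * Complex.I_sq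
  refine (mem_sys_iff hy).2 ⟨![f 1, f 2, f 3, f 4, f 5], ?_⟩
  funext a
  fin_cases a <;> simp [singular, singular₁, Fin.sum_univ_five, Fin.sum_univ_six, h2]
  ring

theorem derivedSystem_singular₁_le (hy : y ∈ O) :
    derivedSystem (spanSystem (D.sys D.singular₁)) y ≤ spanSystem (D.sys D.singular₂) y := by
  intro ψ hψ
  obtain ⟨f, rfl, hf⟩ := mem_derivedSystem_sys ![1, 2, 3, 4, 5]
    D.hasBaseDeriv_singular₁ (by intro y i i'; fin_cases i <;> fin_cases i' <;> rfl) hy hψ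
  have a0 : ∀ i, ∑ a, D.singular₁ i y a *
      (![1, 0, 0, -(I * D.k y), D.p 0 y, D.p 1 y, 0, 0] : Fin 8 → ℂ) a = 0 := by
    intro i; fin_cases i <;> simp [singular₁, Fin.sum_univ_eight]
  have h1 := hf _ ![0, 0, 0, 0, 0, -(I * D.k y), 1, 0] a0
    (by intro i; fin_cases i <;> simp [singular₁, Fin.sum_univ_eight])
  have h2 := hf _ ![0, 0, 0, 0, I * D.k y, 0, 0, 1] a0
    (by intro i; fin_cases i <;> simp [singular₁, Fin.sum_univ_eight])
  simp [structureD, structureForm, singular₁, singular₁D, dk, dp, Fin.sum_univ_eight,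
    Fin.sum_univ_five] at h1 h2
  have hk : (D.k y : ℂ) ≠ 0 := by exact_mod_cast D.k_ne_zero y hy
  have hk' : 2 * I * (D.k y : ℂ) ≠ 0 := mul_ne_zero (mul_ne_zero two_ne_zero Complex.I_ne_zero) hk
  have h3 : f 1 = -D.p 0 y * f 2 - I * D.m 0 y * f 3 - I * D.m 1 y * f 4 := by
    refine mul_left_cancel₀ hk' ?_
    linear_combination (-1) * h1 +
      (2 * D.k y * D.m 0 y * f 3 + 2 * D.k y * D.m 1 y * f 4 - (D.k y : ℂ) ^ 2 * f 3) * Complex.I_sq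
  have h4 : f 0 = D.p 1 y * f 2 + I * D.m 1 y * f 3 + I * D.m 2 y * f 4 := by
    refine mul_left_cancel₀ hk' ?_
    linear_combination h2 -
      (2 * D.k y * D.m 1 y * f 3 + 2 * D.k y * D.m 2 y * f 4 - (D.k y : ℂ) ^ 2 * f 4) * Complex.I_sq
  refine (mem_sys_iff hy).2 ⟨![f 2, f 3, f 4], ?_⟩
  funext a
  fin_cases a <;>
    simp [singular₁, singular₂, Fin.sum_univ_five, Fin.sum_univ_three, h3, h4] <;> ring

end EmbeddingCoframe

end DerivedFlag

/-! ### Pointwise conditions for a large final derived system -/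

section Necessity

variable {E : Type*} [NormedAddCommGroup E] [NormedSpace ℝ E] {O : Set E}

namespace EmbeddingCoframe

open Complex (I)

variable {D : EmbeddingCoframe O} {y : E}

theorem finalDerived_singular_le (hy : y ∈ O) :
    finalDerived (spanSystem (D.sys D.singular)) y ≤ spanSystem (D.sys D.singular₂) y := by
  refine (iInf_le _ 2).trans ?_
  refine (derivedSystem_mono ?_).trans (derivedSystem_singular₁_le hy)
  filter_upwards [D.nhds_O hy] with z hz using derivedSystem_singular_le hz

/-- The final derived system is also contained in the derived system of the system of rank three,
which puts further conditions on its members. -/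
theorem finalDerived_singular_le' (hy : y ∈ O) :
    finalDerived (spanSystem (D.sys D.singular)) y ≤
      derivedSystem (spanSystem (D.sys D.singular₂)) y := by
  refine (iInf_le _ 3).trans ?_
  rw [Function.iterate_succ_apply']
  refine derivedSystem_mono ?_
  filter_upwards [D.nhds_O hy] with z hz
  refine le_trans ?_ (derivedSystem_singular₁_le hz)
  refine derivedSystem_mono ?_
  filter_upwards [D.nhds_O hz] with z hz using derivedSystem_singular_le hz

/-- Conditions on `k`, `p`, `m` at a point that hold if the final derived system of the singular
system and the conjugate singular system span the cotangent space. Here `m₀ j` stands for the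
component `m₁₁;ⱼ` of the covariant derivative of `m`, and `μ`, `ν` are the imaginary parts of the
coefficients of `singular₂ 0` in two forms of the final derived system. -/
def RankCondition (k : ℝ) (p : Fin 2 → ℝ) (m : Fin 3 → ℝ) (m₀ : Fin 2 → ℝ) : Prop :=
  ∃ μ ν : ℝ,
    k * (m 2 - m 0) - (p 0 ^ 2 + p 1 ^ 2) - (m 0 * m 2 - m 1 ^ 2) = 2 * k * p 0 * μ ∧
    -m 1 = p 1 * μ ∧ -m 1 = p 0 * ν ∧
    k * (m 0 - m 2) - (p 0 ^ 2 + p 1 ^ 2) - (m 0 * m 2 - m 1 ^ 2) = 2 * k * p 1 * ν ∧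
    2 * (p 0 * m 0 + p 1 * m 1) =
      -μ * (-(m 0 * m 2 - m 1 ^ 2) + k * (m 0 + m 2) + (p 0 ^ 2 + p 1 ^ 2)) ∧
    2 * (p 0 * m 1 + p 1 * m 2) =
      -ν * (-(m 0 * m 2 - m 1 ^ 2) + k * (m 0 + m 2) + (p 0 ^ 2 + p 1 ^ 2)) ∧
    2 * p 0 * m 0 - m₀ 0 = 2 * k * μ * (m 0 - k) ∧
    2 * p 0 * m 1 - m₀ 1 = 2 * k * μ * m 1

theorem rankCondition_of_sup_eq_top (hy : y ∈ O)
    (h : finalDerived (spanSystem (D.sys D.singular)) y ⊔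
      spanSystem (D.sys D.neg.singular) y = ⊤) :
    RankCondition (D.k y) (fun i => D.p i y) (fun i => D.m i y)
      (fun j => D.dm 0 j y + 2 * D.h j y * D.m 1 y) := by
  have hk0 := D.k_ne_zero y hy
  have hk : I * (D.k y : ℂ) ≠ 0 := mul_ne_zero Complex.I_ne_zero (by exact_mod_cast hk0)
  -- The section of the final derived system that is congruent to `σ¹` or `σ²` modulo the conjugate
  -- singular system has components `(x, 1, 0)` or `(x, 0, 1)` in the second derived system.
  have key : ∀ j : Fin 2, ∃ x : ℂ, ∀ z w : Fin 8 → ℂ,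
      (∀ i, ∑ a, D.singular₂ i y a * z a = 0) → (∀ i, ∑ a, D.singular₂ i y a * w a = 0) →
      x * structureD (D.k y) (D.h 0 y) (D.h 1 y) (D.singular₂ 0 y) (D.singular₂D 0 0 y)
        (D.singular₂D 1 0 y) z w +
      structureD (D.k y) (D.h 0 y) (D.h 1 y) (D.singular₂ j.succ y) (D.singular₂D 0 j.succ y)
        (D.singular₂D 1 j.succ y) z w = 0 := by
    intro j
    have htop : D.cov y (D.singular (j.natAdd 4) y) ∈ finalDerived (spanSystem (D.sys D.singular)) y
      ⊔ spanSystem (D.sys D.neg.singular) y := by rw [h]; trivial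
    obtain ⟨ψ, hψ, w, hw, hsum⟩ := Submodule.mem_sup.1 htop
    obtain ⟨f, rfl, hf⟩ := mem_derivedSystem_sys ![3, 4, 5] D.hasBaseDeriv_singular₂
      (by intro y i i'; fin_cases i <;> fin_cases i' <;> rfl) hy (finalDerived_singular_le' hy hψ)
    obtain ⟨g, hg⟩ := mem_spanSystem_iff.1 hw
    rw [← hg, show ∑ i, g i • D.sys D.neg.singular i y = D.cov y (∑ i, g i • D.neg.singular i y)
      from D.cov_sum y g fun i => D.neg.singular i y, cov_add] at hsum
    have hv := cov_injective hy hsum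
    have e4 := congrFun hv 4
    have e5 := congrFun hv 5
    have e6 := congrFun hv 6
    have e7 := congrFun hv 7
    refine ⟨f 0, fun z w hz hw => ?_⟩
    have hf' := hf z w hz hw
    rw [Fin.sum_univ_three] at hf'
    fin_cases j
    · simp [singular, singular₂, Fin.sum_univ_three, Fin.sum_univ_six, neg_k] at e4 e5 e6 e7
      have h1 : f 1 = 1 := by
        refine mul_left_cancel₀ hk ?_
        linear_combination (I * D.k y / 2) * e4 - (1 / 2) * e7
      have h2 : f 2 = 0 := by
        refine mul_left_cancel₀ hk ?_
        linear_combination (I * D.k y / 2) * e5 + (1 / 2) * e6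
      simpa [h1, h2] using hf'
    · simp [singular, singular₂, Fin.sum_univ_three, Fin.sum_univ_six, neg_k] at e4 e5 e6 e7
      have h1 : f 1 = 0 := by
        refine mul_left_cancel₀ hk ?_
        linear_combination (I * D.k y / 2) * e4 - (1 / 2) * e7
      have h2 : f 2 = 1 := by
        refine mul_left_cancel₀ hk ?_
        linear_combination (I * D.k y / 2) * e5 + (1 / 2) * e6
      simpa [h1, h2] using hf'
  -- Complex vectors that annihilate the second derived system.
  have a6 : ∀ i, ∑ a, D.singular₂ i y a *
      (![0, 0, 0, 0, 0, -(I * D.k y), 1, 0] : Fin 8 → ℂ) a = 0 := by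
    intro i; fin_cases i <;> simp [singular₂, Fin.sum_univ_eight]
  have a7 : ∀ i, ∑ a, D.singular₂ i y a *
      (![0, 0, 0, 0, I * D.k y, 0, 0, 1] : Fin 8 → ℂ) a = 0 := by
    intro i; fin_cases i <;> simp [singular₂, Fin.sum_univ_eight]
  have a0 : ∀ i, ∑ a, D.singular₂ i y a *
      (![1, 0, 0, -(I * D.k y), D.p 0 y, D.p 1 y, 0, 0] : Fin 8 → ℂ) a = 0 := by
    intro i; fin_cases i <;> simp [singular₂, Fin.sum_univ_eight]
  have a1 : ∀ i, ∑ a, D.singular₂ i y a *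
      (![0, 1, 0, -D.p 1 y, -(I * D.m 1 y), -(I * D.m 2 y), 0, 0] : Fin 8 → ℂ) a = 0 := by
    intro i; fin_cases i <;> simp [singular₂, Fin.sum_univ_eight]
  have a2 : ∀ i, ∑ a, D.singular₂ i y a *
      (![0, 0, 1, D.p 0 y, I * D.m 0 y, I * D.m 1 y, 0, 0] : Fin 8 → ℂ) a = 0 := by
    intro i; fin_cases i <;> simp [singular₂, Fin.sum_univ_eight]
  obtain ⟨x, hx⟩ := key 0
  obtain ⟨x', hx'⟩ := key 1
  have b01 := congrArg Complex.re (hx _ _ a0 a1)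
  have b02 := congrArg Complex.re (hx _ _ a0 a2)
  have b12 := congrArg Complex.im (hx _ _ a1 a2)
  have b26 := congrArg Complex.im (hx _ _ a2 a6)
  have b27 := congrArg Complex.im (hx _ _ a2 a7)
  have c01 := congrArg Complex.re (hx' _ _ a0 a1)
  have c02 := congrArg Complex.re (hx' _ _ a0 a2)
  have c12 := congrArg Complex.im (hx' _ _ a1 a2)
  simp [structureD, structureForm, singular₂, singular₂D, dk, dp, Fin.sum_univ_eight, pow_two]
    at b01 b02 b12 b26 b27 c01 c02 c12
  refine ⟨x.im, x'.im, ?_, ?_, ?_, ?_, ?_, ?_, ?_, ?_⟩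
  · linear_combination b01
  · refine mul_left_cancel₀ (mul_ne_zero two_ne_zero hk0) ?_
    linear_combination b02
  · refine mul_left_cancel₀ (mul_ne_zero two_ne_zero hk0) ?_
    linear_combination c01
  · linear_combination c02
  · linear_combination b12
  · linear_combination c12
  · linear_combination -b26
  · linear_combination -b27

end EmbeddingCoframe

end Necessity

/-! ### Identification of the singular systems -/

section Identification

variable {E : Type*} [NormedAddCommGroup E] [NormedSpace ℝ E] {O : Set E}

namespace EmbeddingCoframe

open Complex (I)

/-- The choice of the square root of the Gauss curvature is immaterial. -/
theorem RankCondition.neg {k : ℝ} {p : Fin 2 → ℝ} {m : Fin 3 → ℝ} {m₀ : Fin 2 → ℝ}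
    (h : RankCondition (-k) p (fun i => -m i) (fun j => -m₀ j)) : RankCondition k p m m₀ := by
  obtain ⟨μ, ν, h1, h2, h3, h4, h5, h6, h7, h8⟩ := h
  refine ⟨-μ, -ν, ?_, ?_, ?_, ?_, ?_, ?_, ?_, ?_⟩
  · linear_combination h1
  · linear_combination -h2
  · linear_combination -h3
  · linear_combination h4
  · linear_combination -h5
  · linear_combination -h6
  · linear_combination -h7
  · linear_combination -h8

variable {D : EmbeddingCoframe O} {y : E}

theorem linearIndependent_X (hy : y ∈ O) : LinearIndependent ℂ fun a => D.X a y := by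
  rw [Fintype.linearIndependent_iff]
  intro g hg a
  have := congrArg (fun α : E →L[ℝ] ℂ => α (D.e a y)) hg
  simpa [X_e hy] using this

theorem span_X (hy : y ∈ O) : Submodule.span ℂ (Set.range fun a => D.X a y) = ⊤ := by
  rw [eq_top_iff]
  intro α _
  rw [← D.cov_components hy α]
  exact (Submodule.mem_span_range_iff_exists_fun ℂ).2 ⟨_, rfl⟩

variable (D) in
/-- The generators of the isometric embedding system, complexified. -/
def theta (i : Fin 4) : E → E →L[ℝ] ℂ := D.X (i.castAdd 4)

/-- A decomposition of the isometric embedding system has four real generators and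
two-dimensional singular directions. -/
theorem ranks_of_decomposition (hy : y ∈ O) {r p : ℕ} {θ : Fin r → E → E →L[ℝ] ℂ}
    {σ τ : Fin p → E → E →L[ℝ] ℂ}
    (hli : LinearIndependent ℂ
      (Sum.elim (fun i => θ i y) (Sum.elim (fun a => σ a y) (fun a => τ a y))))
    (hspan : spanSystem θ y ⊔ spanSystem σ y ⊔ spanSystem τ y = ⊤)
    (h1 : spanSystem D.theta y = spanSystem θ y) : r = 4 ∧ p = 2 := by
  have hθ : LinearIndependent ℂ (fun i => θ i y) := by
    simpa using hli.comp Sum.inl Sum.inl_injective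
  have hX : LinearIndependent ℂ (fun i => D.theta i y) :=
    (D.linearIndependent_X hy).comp (Fin.castAdd 4) (Fin.castAdd_injective 4 4)
  have e1 : Module.finrank ℂ (spanSystem θ y) = r :=
    (finrank_span_eq_card hθ).trans (Fintype.card_fin r)
  have e2 : Module.finrank ℂ (spanSystem D.theta y) = 4 :=
    (finrank_span_eq_card hX).trans (Fintype.card_fin 4)
  have hr : r = 4 := by rw [← e1, ← h1, e2]
  have e3 : Module.finrank ℂ (E →L[ℝ] ℂ) = 8 := by
    have := finrank_span_eq_card (D.linearIndependent_X hy)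
    rw [D.span_X hy, finrank_top] at this
    simpa using this
  have e4 : Module.finrank ℂ (E →L[ℝ] ℂ) = r + (p + p) := by
    have e5 : Submodule.span ℂ (Set.range
        (Sum.elim (fun i => θ i y) (Sum.elim (fun a => σ a y) (fun a => τ a y)))) = ⊤ := by
      rw [Set.Sum.elim_range, Set.Sum.elim_range, Submodule.span_union, Submodule.span_union,
        ← sup_assoc]
      exact hspan
    have := finrank_span_eq_card hli
    rw [e5, finrank_top] at this
    simpa using this
  exact ⟨hr, by omega⟩

theorem extD_X_apply (hy : y ∈ O) (a b c : Fin 8) :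
    extD (D.X a) y (D.e b y) (D.e c y) = structureForm (D.k y : ℂ) (D.h 0 y) (D.h 1 y)
      (fun i => if i = b then 1 else 0) (fun i => if i = c then 1 else 0) a := by
  rw [← cev₂_real, cev₂_extD_X hy]
  simp only [cev_real, X_e hy]

theorem idealTwo_theta_apply (hy : y ∈ O) {β : E →L[ℝ] E →L[ℝ] ℂ}
    (hβ : β ∈ idealTwo (spanSystem D.theta y)) (i j : Fin 4) :
    β (D.e (i.natAdd 4) y) (D.e (j.natAdd 4) y) = 0 := by
  rw [← cev₂_real]
  have ann : ∀ i : Fin 4, ∀ γ ∈ spanSystem D.theta y, cev (D.e (i.natAdd 4) y, 0) γ = 0 :=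
    fun i => cev_spanSystem fun j => by
      rw [cev_real, theta, X_e hy, if_neg]
      fin_cases i <;> fin_cases j <;> decide
  exact cev₂_eq_zero (ann i) (ann j) hβ

/-- Modulo `θ`, the two-forms of the isometric embedding system are combinations of
`ω¹₃ ∧ η¹ + ω²₃ ∧ η²` and `ω¹₃ ∧ ω²₃ - k² η¹ ∧ η²`. -/
theorem differentialIdealTwo_apply (hy : y ∈ O) {β : E →L[ℝ] E →L[ℝ] ℂ}
    (hβ : β ∈ differentialIdealTwo D.theta y) :
    β (D.e 4 y) (D.e 7 y) = 0 ∧ β (D.e 5 y) (D.e 6 y) = 0 ∧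
      β (D.e 5 y) (D.e 7 y) = β (D.e 4 y) (D.e 6 y) ∧
      β (D.e 6 y) (D.e 7 y) = -(D.k y : ℂ) ^ 2 * β (D.e 4 y) (D.e 5 y) := by
  obtain ⟨β₁, h₁, β₂, h₂, rfl⟩ := Submodule.mem_sup.1 hβ
  obtain ⟨f, rfl⟩ := (Submodule.mem_span_range_iff_exists_fun ℂ).1 h₂
  have z := D.idealTwo_theta_apply hy h₁
  have z45 := z 0 1
  have z46 := z 0 2
  have z47 := z 0 3
  have z56 := z 1 2
  have z57 := z 1 3
  have z67 := z 2 3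
  simp only [Fin.reduceNatAdd] at z45 z46 z47 z56 z57 z67
  simp [Fin.sum_univ_four, theta, extD_X_apply hy, structureForm, z45, z46, z47, z56, z57, z67]
  ring

/-- The Plücker relation for a decomposable two-form of the isometric embedding system. -/
theorem plucker (hy : y ∈ O) {σ : Fin 2 → E → E →L[ℝ] ℂ} {β : E →L[ℝ] E →L[ℝ] ℂ}
    (hσ : β ∈ extTwo (spanSystem σ y)) (hβ : β ∈ differentialIdealTwo D.theta y) :
    (β (D.e 4 y) (D.e 6 y) - I * D.k y * β (D.e 4 y) (D.e 5 y)) *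
      (β (D.e 4 y) (D.e 6 y) + I * D.k y * β (D.e 4 y) (D.e 5 y)) = 0 := by
  obtain ⟨d47, -, d57, d67⟩ := D.differentialIdealTwo_apply hy hβ
  obtain ⟨s, hs⟩ := mem_extTwo_pair hσ
  have hP : ∀ a c, β (D.e a y) (D.e c y) = s * (σ 0 y (D.e a y) * σ 1 y (D.e c y) -
      σ 0 y (D.e c y) * σ 1 y (D.e a y)) := fun a c => by
    rw [hs]; simp [wedge_apply]
  have pl : β (D.e 4 y) (D.e 5 y) * β (D.e 6 y) (D.e 7 y) -
      β (D.e 4 y) (D.e 6 y) * β (D.e 5 y) (D.e 7 y) +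
      β (D.e 4 y) (D.e 7 y) * β (D.e 5 y) (D.e 6 y) = 0 := by
    simp only [hP]; ring
  rw [d47, d57, d67] at pl
  linear_combination -pl - (D.k y : ℂ) ^ 2 * β (D.e 4 y) (D.e 5 y) ^ 2 * Complex.I_sq

/-- Since `dθ₀` is not in the ideal of `θ`, some generator `Ω b` is not either. -/
theorem exists_generator (hy : y ∈ O) {s : ℕ} {Ω : Fin s → E → E →L[ℝ] E →L[ℝ] ℂ}
    {θ : Fin 4 → E → E →L[ℝ] ℂ} (h1 : spanSystem D.theta y = spanSystem θ y)
    (h2 : differentialIdealTwo D.theta y =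
      algebraicIdealTwo θ (Sum.elim Ω fun b y => conjTwo (Ω b y)) y) :
    ∃ b, Ω b y (D.e 4 y) (D.e 6 y) ≠ 0 := by
  by_contra! hcon
  have hmem : extD (D.theta 0) y ∈ differentialIdealTwo D.theta y :=
    Submodule.mem_sup_right (Submodule.subset_span ⟨0, rfl⟩)
  rw [h2] at hmem
  obtain ⟨β₁, h₁, β₂, h₂, hsum⟩ := Submodule.mem_sup.1 hmem
  obtain ⟨f, rfl⟩ := (Submodule.mem_span_range_iff_exists_fun ℂ).1 h₂
  rw [← h1] at h₁
  have z := D.idealTwo_theta_apply hy h₁ 0 2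
  simp only [Fin.reduceNatAdd] at z
  have := congrArg (fun β : E →L[ℝ] E →L[ℝ] ℂ => β (D.e 4 y) (D.e 6 y)) hsum
  simp [z, theta, extD_X_apply hy, structureForm, hcon, conjTwo_apply] at this

/-- If the two-form `Ω` of the decomposition is a multiple of `σ¹ ∧ σ²` at a point, not of its
conjugate, then the same is true nearby, and the singular system is the one spanned by `θ` and
`σ¹ = ω¹₃ - i k η²`, `σ² = ω²₃ + i k η¹`. -/
theorem rankCondition_of_decomposition {O' : Set E} (hO' : IsOpen O') (hsub : O' ⊆ O)
    (hy : y ∈ O') {θ : Fin 4 → E → E →L[ℝ] ℂ} {σ : Fin 2 → E → E →L[ℝ] ℂ}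
    {Ω : E → E →L[ℝ] E →L[ℝ] ℂ} (hθ : ∀ z ∈ O', spanSystem D.theta z = spanSystem θ z)
    (hΩ : ContDiffOn ℝ ∞ Ω O') (hΩσ : ∀ z ∈ O', Ω z ∈ extTwo (spanSystem σ z))
    (hΩd : ∀ z ∈ O', Ω z ∈ differentialIdealTwo D.theta z)
    (hne : Ω y (D.e 4 y) (D.e 6 y) ≠ 0)
    (hpos : Ω y (D.e 4 y) (D.e 6 y) = I * D.k y * Ω y (D.e 4 y) (D.e 5 y))
    (htop : finalDerived (spanSystem (Sum.elim θ σ)) y ⊔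
      spanSystem (Sum.elim θ fun a y => conjOne (σ a y)) y = ⊤) :
    RankCondition (D.k y) (fun i => D.p i y) (fun i => D.m i y)
      (fun j => D.dm 0 j y + 2 * D.h j y * D.m 1 y) := by
  have hcont : ∀ a b, ContinuousAt (fun z => Ω z (D.e a z) (D.e b z)) y := fun a b => by
    have h1 := (hΩ.contDiffAt (hO'.mem_nhds hy)).continuousAt
    have h2 : ∀ a, ContinuousAt (D.e a) y := fun a =>
      ((D.smooth_e a).contDiffAt (D.nhds_O (hsub hy))).continuousAt
    exact (h1.clm_apply (h2 a)).clm_apply (h2 b)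
  have hkc : ContinuousAt (fun z => (D.k z : ℂ)) y :=
    Complex.continuous_ofReal.continuousAt.comp
      ((D.smooth_k.contDiffAt (D.nhds_O (hsub hy))).continuousAt)
  have hne' : ∀ᶠ z in 𝓝 y, Ω z (D.e 4 z) (D.e 6 z) + I * D.k z * Ω z (D.e 4 z) (D.e 5 z) ≠ 0 := by
    refine ContinuousAt.eventually_ne
      ((hcont 4 6).add ((continuousAt_const.mul hkc).mul (hcont 4 5))) ?_
    rw [← hpos, ← two_mul]
    exact mul_ne_zero two_ne_zero hne
  have hmem : ∀ᶠ z in 𝓝 y, z ∈ O' ∧ ∀ a, σ a z (D.e 6 z) = I * D.k z * σ a z (D.e 5 z) ∧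
      σ a z (D.e 7 z) = -(I * D.k z) * σ a z (D.e 4 z) := by
    filter_upwards [hne', hO'.mem_nhds hy] with z hz hzO
    obtain ⟨d47, d56, d57, d67⟩ := D.differentialIdealTwo_apply (hsub hzO) (hΩd z hzO)
    obtain ⟨s, hs⟩ := mem_extTwo_pair (hΩσ z hzO)
    have hP : ∀ a b, Ω z (D.e a z) (D.e b z) = s * (σ 0 z (D.e a z) * σ 1 z (D.e b z) -
        σ 0 z (D.e b z) * σ 1 z (D.e a z)) := fun a b => by
      rw [hs]; simp [wedge_apply]
    have hsq := D.plucker (hsub hzO) (hΩσ z hzO) (hΩd z hzO)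
    have h46 : Ω z (D.e 4 z) (D.e 6 z) = I * D.k z * Ω z (D.e 4 z) (D.e 5 z) :=
      sub_eq_zero.1 ((mul_eq_zero.1 hsq).resolve_right hz)
    have h45 : Ω z (D.e 4 z) (D.e 5 z) ≠ 0 := fun h0 => hz (by rw [h46, h0]; ring)
    refine ⟨hzO, fun a => ?_⟩
    -- `σ` divides `Ω`.
    have t : ∀ b c d, σ a z (D.e b z) * Ω z (D.e c z) (D.e d z) -
        σ a z (D.e c z) * Ω z (D.e b z) (D.e d z) +
        σ a z (D.e d z) * Ω z (D.e b z) (D.e c z) = 0 := fun b c d => by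
      simp only [hP]
      fin_cases a <;> simp <;> ring
    constructor
    · refine mul_right_cancel₀ h45 ?_
      linear_combination t 4 5 6 - σ a z (D.e 4 z) * d56 + σ a z (D.e 5 z) * h46
    · refine mul_right_cancel₀ h45 ?_
      linear_combination t 4 5 7 - σ a z (D.e 4 z) * d57 + σ a z (D.e 5 z) * d47 -
        σ a z (D.e 4 z) * h46
  have hθle : ∀ z ∈ O', ∀ D' : EmbeddingCoframe O, D'.X = D.X →
      spanSystem θ z ≤ spanSystem (D'.sys D'.singular) z := by
    intro z hz D' hD'
    rw [← hθ z hz]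
    refine spanSystem_le fun i => ?_
    have : D.theta i z = D'.sys D'.singular (i.castAdd 2) z := by
      rw [sys, cov, hD', theta]
      ext v
      fin_cases i <;> simp [singular, Fin.sum_univ_eight]
    rw [this]
    exact mem_spanSystem _ _ _
  have hle : ∀ᶠ z in 𝓝 y, spanSystem (Sum.elim θ σ) z ≤ spanSystem (D.sys D.singular) z := by
    filter_upwards [hmem] with z hz
    rw [spanSystem_sumElim]
    refine sup_le (hθle z hz.1 D rfl) (spanSystem_le fun a => ?_)
    rw [← D.cov_components (hsub hz.1) (σ a z), mem_sys_iff (hsub hz.1)]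
    refine ⟨fun i => σ a z (D.e (i.castAdd 2) z), ?_⟩
    funext b
    fin_cases b <;>
      simp [singular, Fin.sum_univ_six, (hz.2 a).1, (hz.2 a).2, mul_comm]
  have hle' : spanSystem (Sum.elim θ fun a y => conjOne (σ a y)) y ≤
      spanSystem (D.sys D.neg.singular) y := by
    have hz := hmem.self_of_nhds
    rw [spanSystem_sumElim]
    refine sup_le (hθle y hy D.neg rfl) (spanSystem_le fun a => ?_)
    rw [← D.cov_components (hsub hy) (conjOne (σ a y)), mem_sys_iff (hsub hy)]
    refine ⟨fun i => conjOne (σ a y) (D.e (i.castAdd 2) y), ?_⟩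
    funext b
    fin_cases b <;>
      simp [singular, neg_k, Fin.sum_univ_six, (hz.2 a).1, (hz.2 a).2, mul_comm, conjOne_apply]
  refine rankCondition_of_sup_eq_top (hsub hy) (top_le_iff.1 ?_)
  rw [← htop]
  exact sup_le_sup (finalDerived_mono hle) hle'

/-- Darboux integrability of the isometric embedding system implies the rank condition. -/
theorem rankCondition_of_isEllipticDarbouxIntegrable {ϑ : Fin 4 → E → E →L[ℝ] ℝ}
    (hϑ : ∀ i, ϑ i = D.χ (i.castAdd 4)) (hint : IsEllipticDarbouxIntegrable O ϑ) (hy : y ∈ O) :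
    RankCondition (D.k y) (fun i => D.p i y) (fun i => D.m i y)
      (fun j => D.dm 0 j y + 2 * D.h j y * D.m 1 y) := by
  obtain ⟨O', hsub, hO', hyO', r, p, s, θ, σ, Ω, dec, -, -, pair⟩ := hint y hy
  have htheta : (fun i y => complexify (ϑ i y)) = D.theta := by
    funext i z
    rw [hϑ]; rfl
  have hdeg1 : ∀ z ∈ O', spanSystem D.theta z = spanSystem θ z := by
    rw [← htheta]; exact dec.degree_one
  have hdeg2 := dec.degree_two
  rw [htheta] at hdeg2
  have hli := dec.coframe_linearIndependent y hyO'
  have hspan := dec.coframe_span y hyO'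
  obtain ⟨rfl, rfl⟩ := ranks_of_decomposition (D := D) (θ := θ) (σ := σ)
    (τ := fun a y => conjOne (σ a y)) hy hli hspan (hdeg1 y hyO')
  have hΩd : ∀ b, ∀ z ∈ O', Ω b z ∈ differentialIdealTwo D.theta z := by
    intro b z hz
    rw [hdeg2 z hz]
    exact Submodule.mem_sup_right (Submodule.subset_span ⟨Sum.inl b, rfl⟩)
  obtain ⟨b, hb⟩ := D.exists_generator hy (hdeg1 y hyO') (hdeg2 y hyO')
  have htop := pair.sup_left y hyO'
  rcases mul_eq_zero.1 (D.plucker hy (dec.Ω_mem y hyO' b) (hΩd b y hyO')) with h | h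
  · exact rankCondition_of_decomposition hO' hsub hyO' hdeg1 (dec.smooth_Ω b)
      (fun z hz => dec.Ω_mem z hz b) (hΩd b) hb (sub_eq_zero.1 h) htop
  · have h' : Ω b y (D.e 4 y) (D.e 6 y) = I * D.neg.k y * Ω b y (D.e 4 y) (D.e 5 y) := by
      rw [neg_k]
      push_cast
      linear_combination h
    have hr := rankCondition_of_decomposition (D := D.neg) hO' hsub hyO' hdeg1 (dec.smooth_Ω b)
      (fun z hz => dec.Ω_mem z hz b) (hΩd b) hb h' htop
    have e : (fun j => D.neg.dm 0 j y + 2 * D.neg.h j y * D.neg.m 1 y) =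
        fun j => -(D.dm 0 j y + 2 * D.h j y * D.m 1 y) := by
      funext j
      show -D.dm 0 j y + 2 * D.h j y * (-D.m 1 y) = _
      ring
    rw [e] at hr
    exact RankCondition.neg hr

end EmbeddingCoframe

end Identification

/-! ### Integrability of the singular systems -/

section Sufficiency

variable {E : Type*} [NormedAddCommGroup E] [NormedSpace ℝ E] {O : Set E}

theorem conjTwo_wedge (α β : E →L[ℝ] ℂ) :
    conjTwo (wedge α β) = wedge (conjOne α) (conjOne β) := by
  ext v w
  simp [conjTwo_apply, conjOne_apply, wedge_apply]

theorem contDiffOn_wedge [FiniteDimensional ℝ E] {α β : E → E →L[ℝ] ℂ}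
    (hα : ContDiffOn ℝ ∞ α O) (hβ : ContDiffOn ℝ ∞ β O) :
    ContDiffOn ℝ ∞ (fun y => wedge (α y) (β y)) O := by
  refine contDiffOn_clm_apply.2 fun v => contDiffOn_clm_apply.2 fun w => ?_
  simp only [wedge_apply]
  exact ((hα.clm_apply contDiffOn_const).mul (hβ.clm_apply contDiffOn_const)).sub
    ((hα.clm_apply contDiffOn_const).mul (hβ.clm_apply contDiffOn_const))

/-- Two-forms modulo the ideal of a system of corank two. -/
theorem mem_idealTwo_sup_span {V : Submodule ℂ (E →L[ℝ] ℂ)} {τ : Fin 2 → E → E →L[ℝ] ℂ} {y : E}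
    (h : V ⊔ spanSystem τ y = ⊤) (α γ : E →L[ℝ] ℂ) :
    wedge α γ ∈ idealTwo V ⊔ Submodule.span ℂ {wedge (τ 0 y) (τ 1 y)} := by
  have hα : α ∈ V ⊔ spanSystem τ y := by rw [h]; trivial
  have hγ : γ ∈ V ⊔ spanSystem τ y := by rw [h]; trivial
  obtain ⟨v, hv, t, ht, rfl⟩ := Submodule.mem_sup.1 hα
  obtain ⟨v', hv', t', ht', rfl⟩ := Submodule.mem_sup.1 hγ
  rw [wedge_add_right, wedge_add_left v t t']
  refine add_mem (Submodule.mem_sup_left (wedge_mem_idealTwo _ hv'))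
    (add_mem (Submodule.mem_sup_left (wedge_mem_idealTwo' _ hv)) (Submodule.mem_sup_right ?_))
  obtain ⟨s, hs⟩ := mem_extTwo_pair (wedge_mem_extTwo ht ht')
  exact Submodule.mem_span_singleton.2 ⟨s, hs.symm⟩

/-- The ideal generated by the intersection of two complementary systems. -/
theorem idealTwo_le_extTwo_sup {V W T : Submodule ℂ (E →L[ℝ] ℂ)} (h : V ⊔ W = ⊤) (hV : T ≤ V)
    (hW : T ≤ W) : idealTwo T ≤ extTwo V ⊔ extTwo W := by
  refine Submodule.span_le.2 ?_
  rintro _ ⟨α, γ, hγ, rfl⟩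
  have hα : α ∈ V ⊔ W := by rw [h]; trivial
  obtain ⟨v, hv, w, hw, rfl⟩ := Submodule.mem_sup.1 hα
  rw [wedge_add_left]
  exact add_mem (Submodule.mem_sup_left (wedge_mem_extTwo hv (hV hγ)))
    (Submodule.mem_sup_right (wedge_mem_extTwo hw (hW hγ)))

namespace EmbeddingCoframe

open Complex (I)

variable {D : EmbeddingCoframe O} {y : E}

theorem contDiffOn_cov {g : E → Fin 8 → ℂ} (hg : ∀ a, ContDiffOn ℝ ∞ (fun y => g y a) O) :
    ContDiffOn ℝ ∞ (fun y => D.cov y (g y)) O := by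
  have : (fun y => D.cov y (g y)) = fun y => ∑ a, g y a • D.X a y := rfl
  rw [this]
  exact ContDiffOn.sum fun a _ => (hg a).smul (D.smooth_X a)

theorem contDiffOn_ofReal {f : E → ℝ} (hf : ContDiffOn ℝ ∞ f O) :
    ContDiffOn ℝ ∞ (fun y => (f y : ℂ)) O :=
  Complex.ofRealCLM.contDiff.comp_contDiffOn hf

variable (D) in
/-- The forms `σ¹ = ω¹₃ - i k η²` and `σ² = ω²₃ + i k η¹`. -/
def sigma (a : Fin 2) : E → E →L[ℝ] ℂ := D.sys D.singular (a.natAdd 4)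

theorem sigma_eq (a : Fin 2) (y : E) : D.sigma a y =
    D.cov y (![![0, 0, 0, 0, 1, 0, 0, -(I * D.k y)], ![0, 0, 0, 0, 0, 1, I * D.k y, 0]] a) := by
  fin_cases a <;> rfl

theorem sigma_zero_apply (y v : E) : D.sigma 0 y v = D.X 4 y v - I * D.k y * D.X 7 y v := by
  simp [sigma_eq, cov, Fin.sum_univ_eight]
  ring

theorem sigma_one_apply (y v : E) : D.sigma 1 y v = D.X 5 y v + I * D.k y * D.X 6 y v := by
  simp [sigma_eq, cov, Fin.sum_univ_eight]

theorem smooth_sigma (a : Fin 2) : ContDiffOn ℝ ∞ (D.sigma a) O := by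
  have hk : ContDiffOn ℝ ∞ (fun y => I * (D.k y : ℂ)) O :=
    contDiffOn_const.mul (contDiffOn_ofReal D.smooth_k)
  refine (contDiffOn_cov (D := D) (g := D.singular (a.natAdd 4)) fun b => ?_)
  fin_cases a <;> fin_cases b <;> first | exact contDiffOn_const | exact hk | exact hk.neg

theorem conjOne_X (a : Fin 8) (y : E) : conjOne (D.X a y) = D.X a y := conjOne_complexify _

theorem conjOne_sigma (a : Fin 2) (y : E) : conjOne (D.sigma a y) = D.neg.sigma a y := by
  have hX : ∀ b v, star (D.X b y v) = D.X b y v := fun b v => by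
    rw [← conjOne_apply, conjOne_X]
  have hX' : ∀ b v, (starRingEnd ℂ) (D.X b y v) = D.X b y v := hX
  ext v
  rw [conjOne_apply]
  fin_cases a
  · show star (D.sigma 0 y v) = D.neg.sigma 0 y v
    rw [sigma_zero_apply, sigma_zero_apply, neg_X, neg_k]
    simp [hX']
  · show star (D.sigma 1 y v) = D.neg.sigma 1 y v
    rw [sigma_one_apply, sigma_one_apply, neg_X, neg_k]
    simp [hX']

theorem sigma_neg_neg : D.neg.neg.sigma = D.sigma := by
  funext a y
  ext v
  fin_cases a
  · show D.neg.neg.sigma 0 y v = D.sigma 0 y v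
    simp [sigma_zero_apply, neg_X, neg_k]
  · show D.neg.neg.sigma 1 y v = D.sigma 1 y v
    simp [sigma_one_apply, neg_X, neg_k]

theorem theta_eq (i : Fin 4) (y : E) : D.theta i y = D.sys D.singular (i.castAdd 2) y := by
  ext v
  fin_cases i <;> simp [theta, sys, cov, singular, Fin.sum_univ_eight]

theorem spanSystem_theta_sigma :
    spanSystem (Sum.elim D.theta D.sigma) = spanSystem (D.sys D.singular) := by
  funext y
  refine le_antisymm (spanSystem_le ?_) (spanSystem_le fun i => ?_)
  · rintro (i | a)
    · show D.theta i y ∈ _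
      rw [theta_eq]
      exact mem_spanSystem _ _ _
    · exact mem_spanSystem (D.sys D.singular) y (a.natAdd 4)
  · refine Fin.addCases (m := 4) (n := 2) (fun i => ?_) (fun a => ?_) i
    · rw [← theta_eq]
      exact mem_spanSystem (Sum.elim D.theta D.sigma) y (Sum.inl i)
    · exact mem_spanSystem (Sum.elim D.theta D.sigma) y (Sum.inr a)

theorem two_I_k_ne_zero (hy : y ∈ O) : 2 * I * (D.k y : ℂ) ≠ 0 :=
  mul_ne_zero (mul_ne_zero two_ne_zero Complex.I_ne_zero) (by exact_mod_cast D.k_ne_zero y hy)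

theorem singular_sup_sigma (hy : y ∈ O) :
    spanSystem (D.sys D.singular) y ⊔ spanSystem D.neg.sigma y = ⊤ := by
  have hk : (D.k y : ℂ) ≠ 0 := by exact_mod_cast D.k_ne_zero y hy
  rw [eq_top_iff]
  intro α _
  rw [← D.cov_components hy α]
  set z : Fin 8 → ℂ := fun a => α (D.e a y)
  have h : D.cov y z = D.cov y (∑ i, (![z 0, z 1, z 2, z 3,
      (z 4 * (I * D.k y) - z 7) / (2 * I * D.k y), (z 5 * (I * D.k y) + z 6) / (2 * I * D.k y)] :
        Fin 6 → ℂ) i • D.singular i y) +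
      ∑ a, (![(z 4 * (I * D.k y) + z 7) / (2 * I * D.k y),
        (z 5 * (I * D.k y) - z 6) / (2 * I * D.k y)] : Fin 2 → ℂ) a • D.neg.sigma a y := by
    simp only [sigma_eq, neg_cov]
    rw [cov_sum, cov_add]
    congr 1
    funext a
    fin_cases a <;>
      simp [singular, Fin.sum_univ_six, Fin.sum_univ_two, neg_k] <;> field_simp <;> ring
  rw [h]
  exact add_mem (Submodule.mem_sup_left ((mem_sys_iff hy).2 ⟨_, rfl⟩))
    (Submodule.mem_sup_right (mem_spanSystem_iff.2 ⟨_, rfl⟩))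

theorem coframe_linearIndependent (hy : y ∈ O) : LinearIndependent ℂ
    (Sum.elim (fun i => D.theta i y)
      (Sum.elim (fun a => D.sigma a y) (fun a => D.neg.sigma a y))) := by
  have hk := D.two_I_k_ne_zero hy
  rw [Fintype.linearIndependent_iff]
  intro g hg
  have ev := fun b => congrArg (fun α : E →L[ℝ] ℂ => α (D.e b y)) hg
  have e0 := ev 0
  have e1 := ev 1
  have e2 := ev 2
  have e3 := ev 3
  have e4 := ev 4
  have e5 := ev 5
  have e6 := ev 6
  have e7 := ev 7
  simp [Fin.sum_univ_four, theta, sigma_zero_apply, sigma_one_apply, neg_X, neg_k, X_e hy]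
    at e0 e1 e2 e3 e4 e5 e6 e7
  have s0 : g (Sum.inr (Sum.inl 0)) = 0 := mul_left_cancel₀ hk (by
    linear_combination I * D.k y * e4 - e7)
  have s1 : g (Sum.inr (Sum.inl 1)) = 0 := mul_left_cancel₀ hk (by
    linear_combination I * D.k y * e5 + e6)
  have t0 : g (Sum.inr (Sum.inr 0)) = 0 := by simpa [s0] using e4
  have t1 : g (Sum.inr (Sum.inr 1)) = 0 := by simpa [s1] using e5
  rintro (i | a | a)
  · fin_cases i <;> assumption
  · fin_cases a <;> assumption
  · fin_cases a <;> assumption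

theorem extD_X_real (hy : y ∈ O) (a : Fin 8) (v w : E) :
    extD (D.X a) y v w = structureForm (D.k y : ℂ) (D.h 0 y) (D.h 1 y)
      (fun b => D.X b y v) (fun b => D.X b y w) a := by
  rw [← cev₂_real, cev₂_extD_X hy]
  simp only [cev_real]

theorem theta_mem (i : Fin 4) : D.X (i.castAdd 4) y ∈ spanSystem D.theta y :=
  mem_spanSystem D.theta y i

/-- `σ¹ ∧ σ²` in terms of the two-forms `dθ₀` and `dθ₃`. -/
theorem wedge_sigma_eq (hy : y ∈ O) : wedge (D.sigma 0 y) (D.sigma 1 y) =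
    extD (D.theta 3) y + (I * D.k y) • (extD (D.theta 0) y +
      wedge (-D.X 4 y) (D.X 1 y) + wedge (-D.X 5 y) (D.X 2 y)) := by
  ext v w
  simp [wedge_apply, sigma_zero_apply, sigma_one_apply, theta, extD_X_real hy, structureForm]
  linear_combination (D.k y : ℂ) ^ 2 * (D.X 6 y v * D.X 7 y w - D.X 6 y w * D.X 7 y v) *
    Complex.I_sq

theorem wedge_sigma_mem (hy : y ∈ O) :
    wedge (D.sigma 0 y) (D.sigma 1 y) ∈ differentialIdealTwo D.theta y := by
  have hd : ∀ i, extD (D.theta i) y ∈ differentialIdealTwo D.theta y := fun i =>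
    Submodule.mem_sup_right (Submodule.subset_span ⟨i, rfl⟩)
  rw [wedge_sigma_eq hy]
  refine add_mem (hd 3) (Submodule.smul_mem _ _ (add_mem (add_mem (hd 0) ?_) ?_))
  · exact Submodule.mem_sup_left (wedge_mem_idealTwo _ (theta_mem 1))
  · exact Submodule.mem_sup_left (wedge_mem_idealTwo _ (theta_mem 2))

variable (D) in
/-- The two-form `σ¹ ∧ σ²`, as a family with one member. -/
def Omega (_ : Fin 1) (y : E) : E →L[ℝ] E →L[ℝ] ℂ := wedge (D.sigma 0 y) (D.sigma 1 y)

theorem conjTwo_Omega (b : Fin 1) (y : E) : conjTwo (D.Omega b y) = D.neg.Omega b y := by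
  simp only [Omega, conjTwo_wedge, conjOne_sigma]

theorem extD_theta_mem (hy : y ∈ O) (i : Fin 4) :
    extD (D.theta i) y ∈ algebraicIdealTwo D.theta (Sum.elim D.Omega D.neg.Omega) y := by
  have hk : (D.k y : ℂ) ≠ 0 := by exact_mod_cast D.k_ne_zero y hy
  have hΩ : wedge (D.sigma 0 y) (D.sigma 1 y) ∈
      algebraicIdealTwo D.theta (Sum.elim D.Omega D.neg.Omega) y :=
    Submodule.mem_sup_right (Submodule.subset_span ⟨Sum.inl 0, rfl⟩)
  have hΩ' : wedge (D.neg.sigma 0 y) (D.neg.sigma 1 y) ∈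
      algebraicIdealTwo D.theta (Sum.elim D.Omega D.neg.Omega) y :=
    Submodule.mem_sup_right (Submodule.subset_span ⟨Sum.inr 0, rfl⟩)
  have hw : ∀ (α : E →L[ℝ] ℂ) (i : Fin 4), wedge α (D.X (i.castAdd 4) y) ∈
      algebraicIdealTwo D.theta (Sum.elim D.Omega D.neg.Omega) y := fun α i =>
    Submodule.mem_sup_left (wedge_mem_idealTwo _ (theta_mem i))
  have e0 : extD (D.theta 0) y = (2 * I * (D.k y : ℂ))⁻¹ • (wedge (D.sigma 0 y) (D.sigma 1 y) +
      (-1 : ℂ) • wedge (D.neg.sigma 0 y) (D.neg.sigma 1 y)) + wedge (D.X 4 y) (D.X 1 y) +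
      wedge (D.X 5 y) (D.X 2 y) := by
    ext v w
    simp [wedge_apply, sigma_zero_apply, sigma_one_apply, theta, extD_X_real hy, structureForm,
      neg_X, neg_k]
    field_simp
    linear_combination 2 * D.k y * (D.X 4 y v * D.X 6 y w - D.X 4 y w * D.X 6 y v +
      D.X 5 y v * D.X 7 y w - D.X 5 y w * D.X 7 y v) * Complex.I_sq
  have e1 : extD (D.theta 1) y = wedge (-((D.h 0 y : ℂ) • D.X 6 y + (D.h 1 y : ℂ) • D.X 7 y +
      D.X 3 y)) (D.X 2 y) + wedge (D.X 7 y) (D.X 3 y) + wedge (-D.X 4 y) (D.X 0 y) := by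
    ext v w
    simp [wedge_apply, theta, extD_X_real hy, structureForm]
    ring
  have e2 : extD (D.theta 2) y = wedge ((D.h 0 y : ℂ) • D.X 6 y + (D.h 1 y : ℂ) • D.X 7 y +
      D.X 3 y) (D.X 1 y) + wedge (-D.X 6 y) (D.X 3 y) + wedge (-D.X 5 y) (D.X 0 y) := by
    ext v w
    simp [wedge_apply, theta, extD_X_real hy, structureForm]
    ring
  have e3 : extD (D.theta 3) y = (2 : ℂ)⁻¹ • (wedge (D.sigma 0 y) (D.sigma 1 y) +
      wedge (D.neg.sigma 0 y) (D.neg.sigma 1 y)) := by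
    ext v w
    simp [wedge_apply, sigma_zero_apply, sigma_one_apply, theta, extD_X_real hy, structureForm,
      neg_X, neg_k]
    linear_combination (-(D.k y : ℂ) ^ 2 * (D.X 6 y v * D.X 7 y w - D.X 6 y w * D.X 7 y v)) *
      Complex.I_sq
  fin_cases i
  · show extD (D.theta 0) y ∈ _
    rw [e0]
    exact add_mem (add_mem (Submodule.smul_mem _ _ (add_mem hΩ (Submodule.smul_mem _ _ hΩ')))
      (hw _ 1)) (hw _ 2)
  · show extD (D.theta 1) y ∈ _
    rw [e1]
    exact add_mem (add_mem (hw _ 2) (hw _ 3)) (hw _ 0)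
  · show extD (D.theta 2) y ∈ _
    rw [e2]
    exact add_mem (add_mem (hw _ 1) (hw _ 3)) (hw _ 0)
  · show extD (D.theta 3) y ∈ _
    rw [e3]
    exact Submodule.smul_mem _ _ (add_mem hΩ hΩ')

theorem differentialIdealTwo_theta (hy : y ∈ O) : differentialIdealTwo D.theta y =
    algebraicIdealTwo D.theta (Sum.elim D.Omega D.neg.Omega) y := by
  refine le_antisymm (sup_le le_sup_left (Submodule.span_le.2 ?_))
    (sup_le le_sup_left (Submodule.span_le.2 ?_))
  · rintro _ ⟨i, rfl⟩
    exact extD_theta_mem hy i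
  · rintro _ ⟨b | b, rfl⟩
    · exact D.wedge_sigma_mem hy
    · exact D.neg.wedge_sigma_mem hy

/-- A skew two-covector is a combination of products of covectors. -/
theorem eq_sum_wedge (hy : y ∈ O) {β : E →L[ℝ] E →L[ℝ] ℂ} (hβ : ∀ v w, β v w = -β w v) :
    β = ∑ a, ∑ b, (β (D.e a y) (D.e b y) / 2) • wedge (D.X a y) (D.X b y) := by
  have key : ∀ v w, β v w = ∑ a, ∑ b, D.X a y v * D.X b y w * β (D.e a y) (D.e b y) := by
    intro v w
    conv_lhs => rw [← D.expand y hy v, ← D.expand y hy w]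
    simp only [map_sum, map_smul, sum_apply, smul_apply, Complex.real_smul, X_apply,
      Finset.mul_sum]
    rw [Finset.sum_comm]
    exact Finset.sum_congr rfl fun a _ => Finset.sum_congr rfl fun b _ => by ring
  ext v w
  have h2 : β v w = (β v w - β w v) / 2 := by rw [hβ w v]; ring
  rw [h2, key v w, key w v]
  simp only [sum_apply, smul_apply, wedge_apply, smul_eq_mul]
  rw [← Finset.sum_sub_distrib, Finset.sum_div]
  refine Finset.sum_congr rfl fun a _ => ?_
  rw [← Finset.sum_sub_distrib, Finset.sum_div]
  exact Finset.sum_congr rfl fun b _ => by ring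

theorem singularSystemIsPfaffian : SingularSystemIsPfaffian O D.theta D.sigma D.neg.Omega := by
  intro y hy
  have hV : spanSystem (Sum.elim D.theta D.sigma) y = spanSystem (D.sys D.singular) y := by
    rw [spanSystem_theta_sigma]
  refine le_antisymm (sup_le le_sup_left (Submodule.span_le.2 ?_))
    (sup_le le_sup_left (Submodule.span_le.2 ?_))
  · rintro _ ⟨i, rfl⟩
    show extD (Sum.elim D.theta D.sigma i) y ∈ _
    rw [D.eq_sum_wedge hy (extD_skew _ _)]
    refine sum_mem fun a _ => sum_mem fun b _ => Submodule.smul_mem _ _ ?_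
    have h := mem_idealTwo_sup_span (D.singular_sup_sigma hy) (D.X a y) (D.X b y)
    rw [← hV] at h
    refine (?_ : _ ≤ algebraicIdealTwo (Sum.elim D.theta D.sigma) D.neg.Omega y) h
    exact sup_le_sup_left (Submodule.span_mono (by rintro _ rfl; exact ⟨0, rfl⟩)) _
  · rintro _ ⟨b, rfl⟩
    refine (?_ : differentialIdealTwo D.theta y ≤ _) (D.neg.wedge_sigma_mem hy)
    refine sup_le_sup (idealTwo_mono ?_) (Submodule.span_mono ?_)
    · rw [spanSystem_sumElim]; exact le_sup_left
    · rintro _ ⟨i, rfl⟩; exact ⟨Sum.inl i, rfl⟩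

end EmbeddingCoframe

end Sufficiency

/-! ### Darboux pairs -/

section DarbouxPair

variable {E : Type*} [NormedAddCommGroup E] [NormedSpace ℝ E] {O : Set E}

namespace EmbeddingCoframe

open Complex (I)

variable {D : EmbeddingCoframe O} {y : E}

theorem inf_finalDerived (hy : y ∈ O) : finalDerived (spanSystem (D.sys D.singular)) y ⊓
    finalDerived (spanSystem (D.sys D.neg.singular)) y = ⊥ := by
  rw [eq_bot_iff]
  rintro ψ ⟨h₁, h₂⟩
  obtain ⟨f, hf⟩ := mem_spanSystem_iff.1 (finalDerived_singular_le hy h₁)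
  obtain ⟨g, hg⟩ := mem_spanSystem_iff.1 (finalDerived_singular_le (D := D.neg) hy h₂)
  have hfg : D.cov y (∑ i, f i • D.singular₂ i y) = D.cov y (∑ i, g i • D.neg.singular₂ i y) :=
    ((D.cov_sum y f _).symm.trans (hf.trans hg.symm)).trans (D.cov_sum y g _)
  have hv := cov_injective hy hfg
  have hk := D.two_I_k_ne_zero hy
  have e0 := congrFun hv 0
  have e3 := congrFun hv 3
  have e4 := congrFun hv 4
  have e5 := congrFun hv 5
  have e6 := congrFun hv 6
  have e7 := congrFun hv 7
  simp [singular₂, Fin.sum_univ_three, neg_k, neg_p] at e0 e3 e4 e5 e6 e7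
  have f1 : f 1 = 0 := mul_left_cancel₀ hk (by linear_combination -e7 + I * D.k y * e4)
  have f2 : f 2 = 0 := mul_left_cancel₀ hk (by linear_combination e6 + I * D.k y * e5)
  have f0 : f 0 = 0 := mul_left_cancel₀ hk (by
    linear_combination e0 + I * D.k y * e3 + D.p 0 y * e4 + D.p 1 y * e5)
  rw [Submodule.mem_bot, ← hf, Fin.sum_univ_three, f0, f1, f2]
  ext v
  simp

/-- Sections of both singular systems are combinations of the forms `θ`. -/
theorem singular_inf_le (hy : y ∈ O) : spanSystem (D.sys D.singular) y ⊓
    spanSystem (D.sys D.neg.singular) y ≤ spanSystem D.theta y := by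
  rintro ψ ⟨h₁, h₂⟩
  obtain ⟨f, hf⟩ := mem_spanSystem_iff.1 h₁
  obtain ⟨g, hg⟩ := mem_spanSystem_iff.1 h₂
  have hfg : D.cov y (∑ i, f i • D.singular i y) = D.cov y (∑ i, g i • D.neg.singular i y) :=
    ((D.cov_sum y f _).symm.trans (hf.trans hg.symm)).trans (D.cov_sum y g _)
  have hv := cov_injective hy hfg
  have hk := D.two_I_k_ne_zero hy
  have e4 := congrFun hv 4
  have e5 := congrFun hv 5
  have e6 := congrFun hv 6
  have e7 := congrFun hv 7
  simp [singular, Fin.sum_univ_six, neg_k] at e4 e5 e6 e7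
  have f4 : f 4 = 0 := mul_left_cancel₀ hk (by linear_combination -e7 + I * D.k y * e4)
  have f5 : f 5 = 0 := mul_left_cancel₀ hk (by linear_combination e6 + I * D.k y * e5)
  refine mem_spanSystem_iff.2 ⟨fun i => f (i.castAdd 2), ?_⟩
  rw [← hf]
  simp only [theta_eq]
  rw [Fin.sum_univ_four, Fin.sum_univ_six, f4, f5]
  ext v
  simp

theorem idealTwo_theta_le (hy : y ∈ O) : algebraicIdealTwo D.theta
    (Sum.elim D.Omega D.neg.Omega) y ≤
      extTwo (spanSystem (D.sys D.singular) y) ⊔ extTwo (spanSystem (D.sys D.neg.singular) y) := by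
  have hσ : ∀ (D' : EmbeddingCoframe O) (a : Fin 2),
      D'.sigma a y ∈ spanSystem (D'.sys D'.singular) y := fun D' a => mem_spanSystem _ _ _
  have hθ : ∀ D' : EmbeddingCoframe O,
      spanSystem D'.theta y ≤ spanSystem (D'.sys D'.singular) y := fun D' =>
    spanSystem_le fun i => by rw [theta_eq]; exact mem_spanSystem _ _ _
  refine sup_le (idealTwo_le_extTwo_sup ?_ (hθ D) (hθ D.neg)) (Submodule.span_le.2 ?_)
  · rw [eq_top_iff, ← D.singular_sup_sigma hy]
    exact sup_le_sup_left (spanSystem_le (hσ D.neg)) _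
  · rintro _ ⟨b | b, rfl⟩
    · exact Submodule.mem_sup_left (wedge_mem_extTwo (hσ D 0) (hσ D 1))
    · exact Submodule.mem_sup_right (wedge_mem_extTwo (hσ D.neg 0) (hσ D.neg 1))

theorem extD_section_mem (hy : y ∈ O) {ψ : E → E →L[ℝ] ℂ}
    (hψ : IsLocalSection (fun y => spanSystem (D.sys D.singular) y ⊓
      spanSystem (D.sys D.neg.singular) y) y ψ) :
    extD ψ y ∈ extTwo (spanSystem (D.sys D.singular) y) ⊔
      extTwo (spanSystem (D.sys D.neg.singular) y) := by
  have h : IsLocalSection (spanSystem D.theta) y ψ := by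
    filter_upwards [hψ, D.nhds_O hy] with z hz hzO using ⟨hz.1, D.singular_inf_le hzO hz.2⟩
  obtain ⟨f, hf, he⟩ := h.exists_coeff D.isOpen_O (n := fun i => D.e (i.castAdd 4))
    (fun i => D.smooth_e _) (fun z hz i j => by
      exact (X_e hz _ _).trans (if_congr (Fin.castAdd_injective 4 4).eq_iff rfl rfl)) hy
  refine idealTwo_theta_le hy ?_
  rw [extD_congr he, extD_sum_smul (G := D.theta) hf (fun i => D.differentiableAt_X _ hy)]
  refine sum_mem fun i _ => add_mem ?_ (Submodule.smul_mem _ _ (extD_theta_mem hy i))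
  exact Submodule.mem_sup_left (wedge_mem_idealTwo _ (theta_mem i))

variable (D) in
/-- The components of the forms `k σ¹ - i p₁ θ₃`, `k σ² - i p₂ θ₃` which span the final derived
system in the integrable case. -/
def firstIntegral : Fin 2 → E → Fin 8 → ℂ := fun i y =>
  ![![0, 0, 0, -(I * D.p 0 y), D.k y, 0, 0, -(I * (D.k y ^ 2 : ℝ))],
    ![0, 0, 0, -(I * D.p 1 y), 0, D.k y, I * (D.k y ^ 2 : ℝ), 0]] i

variable (D) in
/-- The derivatives of the components of `firstIntegral` in the directions of the surface. -/
def firstIntegralD (j : Fin 2) : Fin 2 → E → Fin 8 → ℂ := fun i y =>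
  ![![0, 0, 0, -(I * D.dp 0 j y), D.dk j y, 0, 0, -(I * (4 * D.k y ^ 2 * D.p j y : ℝ))],
    ![0, 0, 0, -(I * D.dp 1 j y), 0, D.dk j y, I * (4 * D.k y ^ 2 * D.p j y : ℝ), 0]] i

theorem hasBaseDeriv_firstIntegral (y : E) (hy : y ∈ O) (i : Fin 2) (a : Fin 8) :
    D.HasBaseDeriv (fun y => D.firstIntegral i y a) (D.firstIntegralD 0 i y a)
      (D.firstIntegralD 1 i y a) y := by
  have hk := hasBaseDeriv_k (D := D) hy
  have hp := fun i => (hasBaseDeriv_p (D := D) hy i).const_mul I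
  have hk2 := (HasBaseDeriv.ofReal (hasFDerivAt_k_sq (D := D) hy)).const_mul I
  fin_cases i <;> fin_cases a <;>
    first
    | exact HasBaseDeriv.const _ | exact hk | exact (hp _).neg | exact hk2 | exact hk2.neg

theorem smooth_firstIntegral (i : Fin 2) : ContDiffOn ℝ ∞ (D.sys D.firstIntegral i) O := by
  have hk : ContDiffOn ℝ ∞ (fun y => (D.k y : ℂ)) O := contDiffOn_ofReal D.smooth_k
  have hk2 : ContDiffOn ℝ ∞ (fun y => I * ((D.k y ^ 2 : ℝ) : ℂ)) O :=
    contDiffOn_const.mul (contDiffOn_ofReal (D.smooth_k.pow 2))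
  have hp : ∀ j, ContDiffOn ℝ ∞ (fun y => -(I * (D.p j y : ℂ))) O := fun j =>
    (contDiffOn_const.mul (contDiffOn_ofReal (D.smooth_p j))).neg
  refine contDiffOn_cov fun b => ?_
  fin_cases i <;> fin_cases b <;>
    first | exact contDiffOn_const | exact hk | exact hp _ | exact hk2 | exact hk2.neg

variable (D) in
/-- The condition `k m = p ⊗ p`: the second covariant derivative of `p` is `3 p ⊗ p - k²`. -/
def IntegrableAt (y : E) : Prop :=
  D.k y * D.m 0 y = D.p 0 y ^ 2 ∧ D.k y * D.m 1 y = D.p 0 y * D.p 1 y ∧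
    D.k y * D.m 2 y = D.p 1 y ^ 2

theorem IntegrableAt.neg (h : D.IntegrableAt y) : D.neg.IntegrableAt y := by
  obtain ⟨h0, h1, h2⟩ := h
  refine ⟨?_, ?_, ?_⟩ <;> rw [neg_k, neg_m, neg_p] <;> linarith

/-- In the integrable case, the forms of `firstIntegral` span a Frobenius system. -/
theorem extD_firstIntegral_mem (hy : y ∈ O) (hint : D.IntegrableAt y) (i : Fin 2) :
    extD (D.sys D.firstIntegral i) y ∈ idealTwo (spanSystem (D.sys D.firstIntegral) y) := by
  obtain ⟨h0, h1, h2⟩ := hint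
  have hk : (D.k y : ℂ) ≠ 0 := by exact_mod_cast D.k_ne_zero y hy
  have h0' : (D.m 0 y : ℂ) = D.p 0 y ^ 2 / D.k y := by
    rw [eq_div_iff hk]; rw [mul_comm]; exact_mod_cast h0
  have h1' : (D.m 1 y : ℂ) = D.p 0 y * D.p 1 y / D.k y := by
    rw [eq_div_iff hk]; rw [mul_comm]; exact_mod_cast h1
  have h2' : (D.m 2 y : ℂ) = D.p 1 y ^ 2 / D.k y := by
    rw [eq_div_iff hk]; rw [mul_comm]; exact_mod_cast h2
  set η₁₂ : E →L[ℝ] ℂ := (D.h 0 y : ℂ) • D.X 6 y + (D.h 1 y : ℂ) • D.X 7 y + D.X 3 y with hη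
  set τ : E →L[ℝ] ℂ := (2 * D.p 0 y : ℂ) • D.X 6 y + (2 * D.p 1 y : ℂ) • D.X 7 y with hτ
  set α := D.sys D.firstIntegral 0 y with hα
  set β := D.sys D.firstIntegral 1 y with hβ
  have hmα : α ∈ spanSystem (D.sys D.firstIntegral) y := mem_spanSystem _ _ _
  have hmβ : β ∈ spanSystem (D.sys D.firstIntegral) y := mem_spanSystem _ _ _
  -- `π` is the part of `ω¹₃` complementary to the first of the two forms.
  set π : E →L[ℝ] ℂ := (I * D.k y) • D.X 7 y + (I * D.p 0 y / D.k y) • D.X 3 y with hπ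
  have e0 : extD (D.sys D.firstIntegral 0) y = wedge τ α + wedge (-η₁₂) β +
      wedge ((I * D.p 0 y / D.k y) • D.X 5 y) α + wedge ((-(I * D.p 0 y / D.k y)) • π) β := by
    ext v w
    rw [← cev₂_real v w (extD (D.sys D.firstIntegral 0) y)]
    have := D.cev₂_extD_cov hy (D.hasBaseDeriv_firstIntegral y hy 0) (v, 0) (w, 0)
    rw [show D.sys D.firstIntegral 0 = fun y => D.cov y (D.firstIntegral 0 y) from rfl, this]
    simp [cev_real, structureD, structureForm, firstIntegral, firstIntegralD, dk, dp,
      Fin.sum_univ_eight, wedge_apply, hη, hτ, hα, hβ, hπ, sys, cov, h0', h1', h2']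
    field_simp
    ring_nf
    simp only [Complex.I_pow_three]
    ring
  have e1 : extD (D.sys D.firstIntegral 1) y = wedge τ β + wedge η₁₂ α +
      wedge ((I * D.p 1 y / D.k y) • D.X 5 y) α + wedge ((-(I * D.p 1 y / D.k y)) • π) β := by
    ext v w
    rw [← cev₂_real v w (extD (D.sys D.firstIntegral 1) y)]
    have := D.cev₂_extD_cov hy (D.hasBaseDeriv_firstIntegral y hy 1) (v, 0) (w, 0)
    rw [show D.sys D.firstIntegral 1 = fun y => D.cov y (D.firstIntegral 1 y) from rfl, this]
    simp [cev_real, structureD, structureForm, firstIntegral, firstIntegralD, dk, dp,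
      Fin.sum_univ_eight, wedge_apply, hη, hτ, hα, hβ, hπ, sys, cov, h0', h1', h2']
    field_simp
    ring_nf
    simp only [Complex.I_pow_three]
    ring
  fin_cases i
  · show extD (D.sys D.firstIntegral 0) y ∈ _
    rw [e0]
    exact add_mem (add_mem (add_mem (wedge_mem_idealTwo _ hmα) (wedge_mem_idealTwo _ hmβ))
      (wedge_mem_idealTwo _ hmα)) (wedge_mem_idealTwo _ hmβ)
  · show extD (D.sys D.firstIntegral 1) y ∈ _
    rw [e1]
    exact add_mem (add_mem (add_mem (wedge_mem_idealTwo _ hmβ) (wedge_mem_idealTwo _ hmα))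
      (wedge_mem_idealTwo _ hmα)) (wedge_mem_idealTwo _ hmβ)

theorem finalDerived_sup (hint : ∀ y ∈ O, D.IntegrableAt y) (hy : y ∈ O) :
    finalDerived (spanSystem (D.sys D.singular)) y ⊔
      spanSystem (D.sys D.neg.singular) y = ⊤ := by
  have hle : spanSystem (D.sys D.firstIntegral) y ≤
      finalDerived (spanSystem (D.sys D.singular)) y := by
    refine le_finalDerived D.isOpen_O D.smooth_firstIntegral (fun z hz i => ?_)
      (fun z hz i => D.extD_firstIntegral_mem hz (hint z hz) i) hy
    refine (mem_sys_iff hz).2 ⟨![0, 0, 0, -(I * D.p i z), ![(D.k z : ℂ), 0] i,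
      ![0, (D.k z : ℂ)] i], ?_⟩
    funext a
    fin_cases i <;> fin_cases a <;> simp [singular, firstIntegral, Fin.sum_univ_six] <;> ring
  have hk : (D.k y : ℂ) ≠ 0 := by exact_mod_cast D.k_ne_zero y hy
  rw [eq_top_iff]
  refine le_trans ?_ (sup_le_sup_right hle _)
  intro α _
  rw [← D.cov_components hy α]
  set z : Fin 8 → ℂ := fun a => α (D.e a y)
  set f₀ : ℂ := (z 4 * (I * D.k y) - z 7) / (2 * I * D.k y ^ 2) with hf₀
  set f₁ : ℂ := (z 5 * (I * D.k y) + z 6) / (2 * I * D.k y ^ 2) with hf₁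
  have h : D.cov y z = D.cov y (∑ a, (![f₀, f₁] : Fin 2 → ℂ) a • D.firstIntegral a y) +
      D.cov y (∑ i, (![z 0, z 1, z 2, z 3 + I * D.p 0 y * f₀ + I * D.p 1 y * f₁,
        z 4 - D.k y * f₀, z 5 - D.k y * f₁] : Fin 6 → ℂ) i • D.neg.singular i y) := by
    rw [cov_add]
    congr 1
    funext a
    fin_cases a <;>
      simp [singular, firstIntegral, Fin.sum_univ_six, Fin.sum_univ_two, neg_k] <;>
      simp only [hf₀, hf₁] <;> field_simp <;> ring
  rw [h]
  exact add_mem (Submodule.mem_sup_left ((mem_sys_iff hy).2 ⟨_, rfl⟩))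
    (Submodule.mem_sup_right ((mem_sys_iff (D := D.neg) hy).2 ⟨_, rfl⟩))

theorem singular_neg_neg :
    spanSystem (D.sys D.neg.neg.singular) = spanSystem (D.sys D.singular) := by
  rw [← spanSystem_theta_sigma (D := D), ← sigma_neg_neg]
  exact (spanSystem_theta_sigma (D := D.neg.neg)).symm

/-- If `k m = p ⊗ p`, then the isometric embedding system is Darboux integrable. -/
theorem isEllipticDarbouxIntegrable [FiniteDimensional ℝ E] {ϑ : Fin 4 → E → E →L[ℝ] ℝ}
    (hϑ : ∀ i, ϑ i = D.χ (i.castAdd 4)) (hint : ∀ y ∈ O, D.IntegrableAt y) :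
    IsEllipticDarbouxIntegrable O ϑ := by
  intro x hx
  have hconj : (fun a y => conjOne (D.sigma a y)) = D.neg.sigma := by
    funext a y; exact conjOne_sigma a y
  have hconj2 : (fun b y => conjTwo (D.Omega b y)) = D.neg.Omega := by
    funext b y; exact conjTwo_Omega b y
  have htheta : (fun i y => complexify (ϑ i y)) = D.theta := by
    funext i z
    rw [hϑ]; rfl
  refine ⟨O, le_rfl, D.isOpen_O, hx, 4, 2, 1, D.theta, D.sigma, D.Omega, ?_, ?_, ?_, ?_⟩
  · rw [hconj, hconj2, htheta]
    exact
      { two_le_p := le_rfl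
        two_le_q := le_rfl
        one_le_s := le_rfl
        one_le_t := le_rfl
        smooth_θ := fun i => D.smooth_X _
        smooth_σ := D.smooth_sigma
        smooth_τ := D.neg.smooth_sigma
        smooth_Ω := fun _ => contDiffOn_wedge (D.smooth_sigma 0) (D.smooth_sigma 1)
        smooth_Ψ := fun _ => contDiffOn_wedge (D.neg.smooth_sigma 0) (D.neg.smooth_sigma 1)
        coframe_linearIndependent := fun y hy => D.coframe_linearIndependent hy
        coframe_span := fun y hy => by
          rw [← spanSystem_sumElim, spanSystem_theta_sigma]
          exact D.singular_sup_sigma hy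
        Ω_mem := fun y _ _ => wedge_mem_extTwo (mem_spanSystem _ _ _) (mem_spanSystem _ _ _)
        Ψ_mem := fun y _ _ => wedge_mem_extTwo (mem_spanSystem _ _ _) (mem_spanSystem _ _ _)
        degree_one := fun _ _ => rfl
        degree_two := fun y hy => D.differentialIdealTwo_theta hy }
  · rw [hconj2]
    exact D.singularSystemIsPfaffian
  · rw [hconj]
    have := D.neg.singularSystemIsPfaffian
    have hO : D.neg.neg.Omega = D.Omega := by
      funext b y
      rw [Omega, Omega, sigma_neg_neg]
    rwa [hO] at this
  · rw [hconj, spanSystem_theta_sigma]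
    have e : spanSystem (Sum.elim D.theta D.neg.sigma) = spanSystem (D.sys D.neg.singular) :=
      spanSystem_theta_sigma (D := D.neg)
    rw [e]
    refine ⟨fun y hy => ?_, fun y hy => D.finalDerived_sup hint hy,
      fun y hy => D.inf_finalDerived hy, fun y hy ψ hψ => D.extD_section_mem hy hψ⟩
    have := D.neg.finalDerived_sup (fun y hy => (hint y hy).neg) hy
    rw [sup_comm, ← singular_neg_neg]
    exact this

end EmbeddingCoframe

end DarbouxPair

/-! ### The rank condition in terms of the curvature -/

section Algebra

/-- Where `p ≠ 0`, the algebraic part of the rank condition leaves two possibilities for the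
symmetric tensor `k m`, namely `p ⊗ p` and `- p^⊥ ⊗ p^⊥`. -/
theorem RankCondition.dichotomy {k : ℝ} {p : Fin 2 → ℝ} {m : Fin 3 → ℝ} {m₀ : Fin 2 → ℝ}
    (h : EmbeddingCoframe.RankCondition k p m m₀) (hk : k ≠ 0) (hp : p 0 ≠ 0 ∨ p 1 ≠ 0) :
    ((k * m 0 = p 0 ^ 2 ∧ k * m 1 = p 0 * p 1 ∧ k * m 2 = p 1 ^ 2) ∨
      (k * m 0 = -p 1 ^ 2 ∧ k * m 1 = p 0 * p 1 ∧ k * m 2 = -p 0 ^ 2)) ∧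
    2 * p 0 * m 0 - m₀ 0 = -2 * p 0 * (m 0 - k) ∧ 2 * p 0 * m 1 - m₀ 1 = -2 * p 0 * m 1 := by
  obtain ⟨μ, ν, h1, h2, h3, h4, h5, h6, h7, h8⟩ := h
  have hs : p 0 ^ 2 + p 1 ^ 2 ≠ 0 := by
    rcases hp with hp | hp
    · have := sq_nonneg (p 1); positivity
    · have := sq_nonneg (p 0); positivity
  obtain ⟨ρ, hμ, hν⟩ : ∃ ρ, μ = ρ * p 0 ∧ ν = ρ * p 1 := by
    refine ⟨(p 0 * μ + p 1 * ν) / (p 0 ^ 2 + p 1 ^ 2), ?_, ?_⟩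
    · field_simp
      linear_combination p 1 * (h3 - h2)
    · field_simp
      linear_combination p 0 * (h2 - h3)
  subst hμ hν
  -- The tensor `m` is a combination of the metric and of `p ⊗ p`.
  obtain ⟨a, ha⟩ : ∃ a, m 0 = a - ρ * p 0 ^ 2 := ⟨m 0 + ρ * p 0 ^ 2, by ring⟩
  have hm1 : m 1 = -ρ * p 0 * p 1 := by linear_combination -h2
  have hm2 : m 2 = a - ρ * p 1 ^ 2 := by
    have : 2 * k * (m 2 - (a - ρ * p 1 ^ 2)) = 0 := by
      linear_combination h1 - h4 + 2 * k * ha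
    have h' := (mul_eq_zero.1 this).resolve_left (mul_ne_zero two_ne_zero hk)
    linarith
  rw [ha, hm1, hm2] at h1 h4 h5 h6
  have hdet : -(p 0 ^ 2 + p 1 ^ 2) - (a ^ 2 - a * ρ * (p 0 ^ 2 + p 1 ^ 2)) =
      k * ρ * (p 0 ^ 2 + p 1 ^ 2) := by linear_combination (h1 + h4) / 2
  have h5' : p 0 * (a * (1 + k * ρ)) = 0 := by
    linear_combination (h5 - ρ * p 0 * hdet) / 2
  have h6' : p 1 * (a * (1 + k * ρ)) = 0 := by
    linear_combination (h6 - ρ * p 1 * hdet) / 2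
  have ha' : a * (1 + k * ρ) = 0 := by
    rcases hp with hp | hp
    · exact (mul_eq_zero.1 h5').resolve_left hp
    · exact (mul_eq_zero.1 h6').resolve_left hp
  have hρ : k * ρ = -1 := by
    rcases mul_eq_zero.1 ha' with h | h
    · subst h
      have : (p 0 ^ 2 + p 1 ^ 2) * (k * ρ + 1) = 0 := by linear_combination -hdet
      have h' := (mul_eq_zero.1 this).resolve_left hs
      linarith
    · linarith
  have hprod : a * (a - ρ * (p 0 ^ 2 + p 1 ^ 2)) = 0 := by
    linear_combination -hdet - (p 0 ^ 2 + p 1 ^ 2) * hρ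
  refine ⟨?_, ?_, ?_⟩
  · rcases mul_eq_zero.1 hprod with h | h
    · left
      refine ⟨?_, ?_, ?_⟩
      · rw [ha, h]; linear_combination -p 0 ^ 2 * hρ
      · rw [hm1]; linear_combination -p 0 * p 1 * hρ
      · rw [hm2, h]; linear_combination -p 1 ^ 2 * hρ
    · right
      refine ⟨?_, ?_, ?_⟩
      · rw [ha]; linear_combination k * h + p 1 ^ 2 * hρ
      · rw [hm1]; linear_combination -p 0 * p 1 * hρ
      · rw [hm2]; linear_combination k * h + p 0 ^ 2 * hρ
  · linear_combination h7 + 2 * p 0 * (m 0 - k) * hρ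
  · linear_combination h8 + 2 * p 0 * m 1 * hρ

end Algebra

section Plane

variable {M : Type*} [TopologicalSpace M] [ChartedSpace Plane M] [IsManifold (𝓡 2) ∞ M]

namespace LocalFraming

variable {g : Metric M} {e : OpenPartialHomeomorph M Plane} (φ : LocalFraming g e)

/-- The components of the connection form: `η¹₂ = h₁ η¹ + h₂ η²`. -/
def connCoeff (i : Fin 2) (u : Plane) : ℝ := φ.η12 u (φ.v i u)

/-- The components of the differential of a function on the plane. -/
def grad (ℓ : Plane → ℝ) (i : Fin 2) (u : Plane) : ℝ := fderiv ℝ ℓ u (φ.v i u)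

/-- The components of the second covariant derivative of a function on the plane. -/
def hess (ℓ : Plane → ℝ) (i j : Fin 2) (u : Plane) : ℝ :=
  fderiv ℝ (φ.grad ℓ i) u (φ.v j u) - ∑ k, φ.grad ℓ k u * φ.conn k i u (φ.v j u)

/-- The components, for the index pairs `11`, `12`, `22`, of the symmetric tensor
`(∇p - p ⊗ p + k² g) / 2k`, where `p = dℓ` and `k = exp 2ℓ`. -/
def tensor (ℓ : Plane → ℝ) (i : Fin 3) (u : Plane) : ℝ :=
  ![φ.hess ℓ 0 0 u - φ.grad ℓ 0 u ^ 2 + Real.exp (2 * ℓ u) ^ 2,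
    φ.hess ℓ 0 1 u - φ.grad ℓ 0 u * φ.grad ℓ 1 u,
    φ.hess ℓ 1 1 u - φ.grad ℓ 1 u ^ 2 + Real.exp (2 * ℓ u) ^ 2] i / (2 * Real.exp (2 * ℓ u))

variable {φ} {ℓ : Plane → ℝ} {u : Plane}

/-- A covector in terms of the coframe. -/
theorem covector_eq (hu : u ∈ φ.U) (α : Plane →L[ℝ] ℝ) :
    α = α (φ.v 0 u) • φ.η 0 u + α (φ.v 1 u) • φ.η 1 u := by
  have d := φ.dual u hu
  have hli : LinearIndependent ℝ (fun i => φ.v i u) := by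
    rw [Fintype.linearIndependent_iff]
    intro c hc i
    have := congrArg (φ.η i u) hc
    fin_cases i <;> simpa [Fin.sum_univ_two, d] using this
  have hspan := hli.span_eq_top_of_card_eq_finrank (by simp)
  refine ContinuousLinearMap.coe_injective (LinearMap.ext_on hspan ?_)
  rintro _ ⟨i, rfl⟩
  fin_cases i <;> simp [d]

theorem eq_zero_of_eta (hu : u ∈ φ.U) {w : Plane} (h0 : φ.η 0 u w = 0) (h1 : φ.η 1 u w = 0) :
    w = 0 := by
  have : ∀ α : Plane →L[ℝ] ℝ, α w = 0 := fun α => by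
    rw [covector_eq hu α]; simp [h0, h1]
  have h := this (innerSL ℝ w)
  simpa using h

theorem smooth_grad (hℓ : ContDiffOn ℝ ∞ ℓ φ.U) (i : Fin 2) :
    ContDiffOn ℝ ∞ (φ.grad ℓ i) φ.U :=
  (hℓ.fderiv_of_isOpen φ.isOpen_U (by simp)).clm_apply (φ.smooth_v i)

theorem smooth_connCoeff (i : Fin 2) : ContDiffOn ℝ ∞ (φ.connCoeff i) φ.U :=
  φ.smooth_η12.clm_apply (φ.smooth_v i)

theorem conn_apply (i j : Fin 2) (u w : Plane) : φ.conn i j u w =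
    !![0, φ.η12 u w; -φ.η12 u w, 0] i j := by
  fin_cases i <;> fin_cases j <;> simp [conn]

theorem hess_zero (ℓ : Plane → ℝ) (j : Fin 2) (u : Plane) : φ.hess ℓ 0 j u =
    fderiv ℝ (φ.grad ℓ 0) u (φ.v j u) + φ.grad ℓ 1 u * φ.connCoeff j u := by
  simp [hess, Fin.sum_univ_two, conn_apply, connCoeff]

theorem hess_one (ℓ : Plane → ℝ) (j : Fin 2) (u : Plane) : φ.hess ℓ 1 j u =
    fderiv ℝ (φ.grad ℓ 1) u (φ.v j u) - φ.grad ℓ 0 u * φ.connCoeff j u := by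
  simp [hess, Fin.sum_univ_two, conn_apply, connCoeff]

theorem smooth_hess (hℓ : ContDiffOn ℝ ∞ ℓ φ.U) (i j : Fin 2) :
    ContDiffOn ℝ ∞ (φ.hess ℓ i j) φ.U := by
  have h := smooth_grad hℓ
  have h1 : ∀ i, ContDiffOn ℝ ∞ (fun u => fderiv ℝ (φ.grad ℓ i) u (φ.v j u)) φ.U := fun i =>
    ((h i).fderiv_of_isOpen φ.isOpen_U (by simp)).clm_apply (φ.smooth_v j)
  fin_cases i
  · exact ((h1 0).add ((h 1).mul (smooth_connCoeff j))).congr fun u _ => hess_zero ℓ j u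
  · exact ((h1 1).sub ((h 0).mul (smooth_connCoeff j))).congr fun u _ => hess_one ℓ j u

theorem smooth_exp (hℓ : ContDiffOn ℝ ∞ ℓ φ.U) :
    ContDiffOn ℝ ∞ (fun u => Real.exp (2 * ℓ u)) φ.U :=
  (contDiffOn_const.mul hℓ).exp

theorem smooth_tensor (hℓ : ContDiffOn ℝ ∞ ℓ φ.U) (i : Fin 3) :
    ContDiffOn ℝ ∞ (φ.tensor ℓ i) φ.U := by
  have h := smooth_grad hℓ
  have hk := smooth_exp hℓ
  have h2 := smooth_hess hℓ
  have hne : ∀ u ∈ φ.U, 2 * Real.exp (2 * ℓ u) ≠ 0 := fun u _ => by positivity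
  fin_cases i
  · exact (((h2 0 0).sub ((h 0).pow 2)).add (hk.pow 2)).div (contDiffOn_const.mul hk) hne
  · exact ((h2 0 1).sub ((h 0).mul (h 1))).div (contDiffOn_const.mul hk) hne
  · exact (((h2 1 1).sub ((h 1).pow 2)).add (hk.pow 2)).div (contDiffOn_const.mul hk) hne

theorem differentiableAt_of_contDiffOn {f : Plane → ℝ} (hf : ContDiffOn ℝ ∞ f φ.U)
    (hu : u ∈ φ.U) : DifferentiableAt ℝ f u :=
  (hf.contDiffAt (φ.isOpen_U.mem_nhds hu)).differentiableAt (by simp)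

/-- The second covariant derivative of a function is symmetric. -/
theorem hess_symm (hℓ : ContDiffOn ℝ ∞ ℓ φ.U) (hu : u ∈ φ.U) :
    φ.hess ℓ 1 0 u = φ.hess ℓ 0 1 u := by
  have hU := φ.isOpen_U.mem_nhds hu
  have hη : ∀ i, DifferentiableAt ℝ (φ.η i) u := fun i =>
    ((φ.smooth_η i).contDiffAt hU).differentiableAt (by simp)
  have hg : ∀ i, DifferentiableAt ℝ (φ.grad ℓ i) u := fun i =>
    differentiableAt_of_contDiffOn (smooth_grad hℓ i) hu
  have he : fderiv ℝ ℓ =ᶠ[𝓝 u] fun w => φ.grad ℓ 0 w • φ.η 0 w + φ.grad ℓ 1 w • φ.η 1 w := by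
    filter_upwards [hU] with w hw using covector_eq hw _
  have hd := ((hg 0).hasFDerivAt.smul (hη 0).hasFDerivAt).add
    ((hg 1).hasFDerivAt.smul (hη 1).hasFDerivAt)
  have hd' := he.fderiv_eq.trans hd.fderiv
  have hs := (hℓ.contDiffAt hU).isSymmSndFDerivAt
    (by simpa using WithTop.coe_le_coe.2 (le_top : (2 : ℕ∞) ≤ ⊤)) (φ.v 0 u) (φ.v 1 u)
  rw [hd'] at hs
  have d := φ.dual u hu
  have d0 := congrArg (fun β : Plane →L[ℝ] Plane →L[ℝ] ℝ => β (φ.v 0 u) (φ.v 1 u))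
    (φ.dη_zero u hu)
  have d1 := congrArg (fun β : Plane →L[ℝ] Plane →L[ℝ] ℝ => β (φ.v 0 u) (φ.v 1 u))
    (φ.dη_one u hu)
  simp [extD_apply, wedgeR_apply, d] at d0 d1
  simp [d] at hs
  rw [hess_zero, hess_one, connCoeff, connCoeff]
  linear_combination hs - φ.grad ℓ 0 u * d0 - φ.grad ℓ 1 u * d1

theorem hasFDerivAt_frame {f : Plane → ℝ} (hf : ContDiffOn ℝ ∞ f φ.U) (hu : u ∈ φ.U) :
    HasFDerivAt f (fderiv ℝ f u (φ.v 0 u) • φ.η 0 u + fderiv ℝ f u (φ.v 1 u) • φ.η 1 u) u := by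
  rw [← covector_eq hu]
  exact (differentiableAt_of_contDiffOn hf hu).hasFDerivAt

theorem fderiv_exp_apply (hℓ : ContDiffOn ℝ ∞ ℓ φ.U) (hu : u ∈ φ.U) (c : ℝ) (j : Fin 2) :
    fderiv ℝ (fun u => Real.exp (c * ℓ u)) u (φ.v j u) =
      c * Real.exp (c * ℓ u) * φ.grad ℓ j u := by
  have h := ((differentiableAt_of_contDiffOn hℓ hu).hasFDerivAt.const_mul c).exp
  rw [h.fderiv]
  simp [grad]
  ring

theorem fderiv_grad_zero_zero (ℓ : Plane → ℝ) (u : Plane) :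
    fderiv ℝ (φ.grad ℓ 0) u (φ.v 0 u) = -φ.grad ℓ 1 u * φ.connCoeff 0 u +
      (2 * Real.exp (2 * ℓ u) * φ.tensor ℓ 0 u + φ.grad ℓ 0 u ^ 2 - Real.exp (2 * ℓ u) ^ 2) := by
  have h : 2 * Real.exp (2 * ℓ u) * φ.tensor ℓ 0 u =
      φ.hess ℓ 0 0 u - φ.grad ℓ 0 u ^ 2 + Real.exp (2 * ℓ u) ^ 2 :=
    mul_div_cancel₀ _ (by positivity)
  rw [h, hess_zero]
  ring

theorem fderiv_grad_zero_one (ℓ : Plane → ℝ) (u : Plane) :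
    fderiv ℝ (φ.grad ℓ 0) u (φ.v 1 u) = -φ.grad ℓ 1 u * φ.connCoeff 1 u +
      (2 * Real.exp (2 * ℓ u) * φ.tensor ℓ 1 u + φ.grad ℓ 0 u * φ.grad ℓ 1 u) := by
  have h : 2 * Real.exp (2 * ℓ u) * φ.tensor ℓ 1 u =
      φ.hess ℓ 0 1 u - φ.grad ℓ 0 u * φ.grad ℓ 1 u :=
    mul_div_cancel₀ _ (by positivity)
  rw [h, hess_zero]
  ring

theorem fderiv_grad_one_zero (hℓ : ContDiffOn ℝ ∞ ℓ φ.U) (hu : u ∈ φ.U) :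
    fderiv ℝ (φ.grad ℓ 1) u (φ.v 0 u) = φ.grad ℓ 0 u * φ.connCoeff 0 u +
      (2 * Real.exp (2 * ℓ u) * φ.tensor ℓ 1 u + φ.grad ℓ 0 u * φ.grad ℓ 1 u) := by
  have h : 2 * Real.exp (2 * ℓ u) * φ.tensor ℓ 1 u =
      φ.hess ℓ 0 1 u - φ.grad ℓ 0 u * φ.grad ℓ 1 u :=
    mul_div_cancel₀ _ (by positivity)
  rw [h, ← hess_symm hℓ hu, hess_one]
  ring

theorem fderiv_grad_one_one (ℓ : Plane → ℝ) (u : Plane) :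
    fderiv ℝ (φ.grad ℓ 1) u (φ.v 1 u) = φ.grad ℓ 0 u * φ.connCoeff 1 u +
      (2 * Real.exp (2 * ℓ u) * φ.tensor ℓ 2 u + φ.grad ℓ 1 u ^ 2 - Real.exp (2 * ℓ u) ^ 2) := by
  have h : 2 * Real.exp (2 * ℓ u) * φ.tensor ℓ 2 u =
      φ.hess ℓ 1 1 u - φ.grad ℓ 1 u ^ 2 + Real.exp (2 * ℓ u) ^ 2 :=
    mul_div_cancel₀ _ (by positivity)
  rw [h, hess_one]
  ring

/-- The condition `k m = p ⊗ p` on the surface. -/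
def IntegrableAt (φ : LocalFraming g e) (ℓ : Plane → ℝ) (u : Plane) : Prop :=
  Real.exp (2 * ℓ u) * φ.tensor ℓ 0 u = φ.grad ℓ 0 u ^ 2 ∧
  Real.exp (2 * ℓ u) * φ.tensor ℓ 1 u = φ.grad ℓ 0 u * φ.grad ℓ 1 u ∧
  Real.exp (2 * ℓ u) * φ.tensor ℓ 2 u = φ.grad ℓ 1 u ^ 2

theorem eventually_not_integrableAt (hℓ : ContDiffOn ℝ ∞ ℓ φ.U) (hu : u ∈ φ.U)
    (h : ¬ φ.IntegrableAt ℓ u) : ∀ᶠ w in 𝓝 u, ¬ φ.IntegrableAt ℓ w := by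
  have hU := φ.isOpen_U.mem_nhds hu
  have hc : ∀ {f : Plane → ℝ}, ContDiffOn ℝ ∞ f φ.U → ContinuousAt f u := fun hf =>
    (hf.contDiffAt hU).continuousAt
  have hk := hc (smooth_exp hℓ)
  have hp := fun i => hc (smooth_grad hℓ i)
  have hm := fun i => hc (smooth_tensor hℓ i)
  simp only [IntegrableAt, not_and_or] at h ⊢
  rcases h with h | h | h
  · filter_upwards [((hk.mul (hm 0)).ne_iff_eventually_ne ((hp 0).pow 2)).1 h] with w hw
    exact Or.inl hw
  · filter_upwards [((hk.mul (hm 1)).ne_iff_eventually_ne ((hp 0).mul (hp 1))).1 h] with w hw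
    exact Or.inr (Or.inl hw)
  · filter_upwards [((hk.mul (hm 2)).ne_iff_eventually_ne ((hp 1).pow 2)).1 h] with w hw
    exact Or.inr (Or.inr hw)

variable (φ ℓ) in
/-- The rank condition at a point of the surface. -/
def RankConditionAt (u : Plane) : Prop :=
  EmbeddingCoframe.RankCondition (Real.exp (2 * ℓ u)) (fun i => φ.grad ℓ i u)
    (fun i => φ.tensor ℓ i u)
    (fun j => fderiv ℝ (φ.tensor ℓ 0) u (φ.v j u) + 2 * φ.connCoeff j u * φ.tensor ℓ 1 u)

/-- Where `p ≠ 0`, the rank condition in a neighbourhood implies `k m = p ⊗ p`: the alternative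
`k m = - p^⊥ ⊗ p^⊥` is not compatible with the conditions on the derivatives of `m`. -/
theorem integrableAt_of_grad_ne_zero (hℓ : ContDiffOn ℝ ∞ ℓ φ.U)
    (h : ∀ u ∈ φ.U, φ.RankConditionAt ℓ u) (hu : u ∈ φ.U)
    (hp : φ.grad ℓ 0 u ≠ 0 ∨ φ.grad ℓ 1 u ≠ 0) : φ.IntegrableAt ℓ u := by
  by_contra hcon
  have hU := φ.isOpen_U.mem_nhds hu
  have hc : ∀ i, ContinuousAt (φ.grad ℓ i) u := fun i =>
    ((smooth_grad hℓ i).contDiffAt hU).continuousAt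
  have hp' : ∀ᶠ w in 𝓝 u, φ.grad ℓ 0 w ≠ 0 ∨ φ.grad ℓ 1 w ≠ 0 := by
    rcases hp with hp | hp
    · filter_upwards [(hc 0).eventually_ne hp] with w hw using Or.inl hw
    · filter_upwards [(hc 1).eventually_ne hp] with w hw using Or.inr hw
  have hev : ∀ᶠ w in 𝓝 u, Real.exp (2 * ℓ w) * φ.tensor ℓ 0 w = -φ.grad ℓ 1 w ^ 2 ∧
      Real.exp (2 * ℓ w) * φ.tensor ℓ 1 w = φ.grad ℓ 0 w * φ.grad ℓ 1 w ∧
      Real.exp (2 * ℓ w) * φ.tensor ℓ 2 w = -φ.grad ℓ 0 w ^ 2 := by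
    filter_upwards [hp', eventually_not_integrableAt hℓ hu hcon, hU] with w hw hw' hwU
    exact (RankCondition.dichotomy (h w hwU) (Real.exp_pos _).ne' hw).1.resolve_left hw'
  obtain ⟨-, e7, e8⟩ := RankCondition.dichotomy (h u hu) (Real.exp_pos _).ne' hp
  obtain ⟨m0, m1, m2⟩ := hev.self_of_nhds
  have hfd : fderiv ℝ (fun w => Real.exp (2 * ℓ w) * φ.tensor ℓ 0 w) u =
      fderiv ℝ (fun w => -φ.grad ℓ 1 w ^ 2) u := by
    refine Filter.EventuallyEq.fderiv_eq ?_
    filter_upwards [hev] with w hw using hw.1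
  have hk := (differentiableAt_of_contDiffOn (smooth_exp hℓ) hu)
  have ht := (differentiableAt_of_contDiffOn (smooth_tensor hℓ 0) hu)
  have hg := (differentiableAt_of_contDiffOn (smooth_grad hℓ 1) hu)
  replace hfd := (hk.hasFDerivAt.mul ht.hasFDerivAt).fderiv.symm.trans
    (hfd.trans (hg.hasFDerivAt.pow 2).neg.fderiv)
  have f0 := congrArg (fun α : Plane →L[ℝ] ℝ => α (φ.v 0 u)) hfd
  have f1 := congrArg (fun α : Plane →L[ℝ] ℝ => α (φ.v 1 u)) hfd
  simp [fderiv_exp_apply hℓ hu, fderiv_grad_one_zero hℓ hu, fderiv_grad_one_one] at f0 f1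
  have hkpos := Real.exp_pos (2 * ℓ u)
  generalize fderiv ℝ (φ.tensor ℓ 0) u (φ.v 0 u) = t0 at *
  generalize fderiv ℝ (φ.tensor ℓ 0) u (φ.v 1 u) = t1 at *
  generalize Real.exp (2 * ℓ u) = k at *
  generalize φ.grad ℓ 0 u = p0 at *
  generalize φ.grad ℓ 1 u = p1 at *
  generalize φ.tensor ℓ 0 u = a at *
  generalize φ.tensor ℓ 1 u = b at *
  generalize φ.tensor ℓ 2 u = c at *
  generalize φ.connCoeff 0 u = h0 at *
  generalize φ.connCoeff 1 u = h1 at *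
  have g0 : p0 * k ^ 2 = 0 := by
    linear_combination -(f0 + k * e7 - 6 * p0 * m0 - (4 * p1 - 2 * h0) * m1) / 2
  have g1 : p1 * k ^ 2 = 0 := by
    linear_combination -(f1 + k * e8 - 2 * p1 * m0 - (4 * p0 - 2 * h1) * m1 - 4 * p1 * m2) / 2
  have hk2 : k ^ 2 ≠ 0 := by positivity
  rcases hp with hp | hp
  · exact hp ((mul_eq_zero.1 g0).resolve_right hk2)
  · exact hp ((mul_eq_zero.1 g1).resolve_right hk2)

/-- The rank condition on an open set implies `k m = p ⊗ p`. -/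
theorem integrableAt_of_rankCondition (hℓ : ContDiffOn ℝ ∞ ℓ φ.U)
    (h : ∀ u ∈ φ.U, φ.RankConditionAt ℓ u) (hu : u ∈ φ.U) : φ.IntegrableAt ℓ u := by
  by_contra hcon
  have hU := φ.isOpen_U.mem_nhds hu
  -- Otherwise `p` vanishes in a neighbourhood, so that the curvature is constant there.
  have hev : ∀ᶠ w in 𝓝 u, φ.grad ℓ 0 w = 0 ∧ φ.grad ℓ 1 w = 0 := by
    filter_upwards [eventually_not_integrableAt hℓ hu hcon, hU] with w hw hwU
    by_contra hne
    exact hw (integrableAt_of_grad_ne_zero hℓ h hwU (by tauto))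
  have z : ∀ i, fderiv ℝ (φ.grad ℓ i) u = 0 := by
    intro i
    have : φ.grad ℓ i =ᶠ[𝓝 u] fun _ => 0 := by
      filter_upwards [hev] with w hw
      fin_cases i
      · exact hw.1
      · exact hw.2
    rw [this.fderiv_eq]
    simp
  obtain ⟨p0, p1⟩ := hev.self_of_nhds
  have t0 := fderiv_grad_zero_zero (φ := φ) ℓ u
  have t1 := fderiv_grad_zero_one (φ := φ) ℓ u
  have t2 := fderiv_grad_one_one (φ := φ) ℓ u
  simp [z, p0, p1] at t0 t1 t2
  obtain ⟨μ, ν, h1, -⟩ := h u hu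
  have hk := Real.exp_pos (2 * ℓ u)
  simp only [p0, p1, t1] at h1
  have s0 : φ.tensor ℓ 0 u = Real.exp (2 * ℓ u) / 2 :=
    mul_left_cancel₀ (mul_ne_zero two_ne_zero hk.ne') (by linear_combination -t0)
  have s2 : φ.tensor ℓ 2 u = Real.exp (2 * ℓ u) / 2 :=
    mul_left_cancel₀ (mul_ne_zero two_ne_zero hk.ne') (by linear_combination -t2)
  rw [s0, s2] at h1
  have : Real.exp (2 * ℓ u) ^ 2 = 0 := by linear_combination -4 * h1
  exact (pow_pos hk 2).ne' this

end LocalFraming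

end Plane

/-! ### The coframe of the isometric embedding system -/

section Pullback

variable {E F : Type*} [NormedAddCommGroup E] [NormedSpace ℝ E]
  [NormedAddCommGroup F] [InnerProductSpace ℝ F]

/-- By the symmetry of the second derivative of `g`, the exterior derivative of the one-form
`⟨f, dg⟩` is `⟨df ∧ dg⟩`. -/
theorem extD_inner_fderiv {f g : E → F} {y : E} (hf : ContDiffAt ℝ ∞ f y)
    (hg : ContDiffAt ℝ ∞ g y) (v w : E) :
    extD (fun y => (innerSL ℝ (f y)).comp (fderiv ℝ g y)) y v w =
      inner ℝ (fderiv ℝ f y v) (fderiv ℝ g y w) - inner ℝ (fderiv ℝ f y w) (fderiv ℝ g y v) := by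
  have hf' := (hf.differentiableAt (by simp)).hasFDerivAt
  have hg' := ((hg.fderiv_right (m := ∞) (by simp)).differentiableAt (by simp)).hasFDerivAt
  have hs := hg.isSymmSndFDerivAt (by simp; norm_cast) v w
  have h := ((innerSL ℝ (E := F)).hasFDerivAt.comp y hf').clm_comp hg'
  have h' : HasFDerivAt (fun y => (innerSL ℝ (f y)).comp (fderiv ℝ g y)) _ y := h
  rw [extD_apply, h'.fderiv]
  simp [hs]
  rfl

/-- The exterior derivative commutes with pull-backs. -/
theorem extD_comp_fderiv {G : Type*} [NormedAddCommGroup G] [NormedSpace ℝ G]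
    {b : E → G} {α : G → G →L[ℝ] ℝ} {y : E} (hb : ContDiffAt ℝ ∞ b y)
    (hα : DifferentiableAt ℝ α (b y)) (v w : E) :
    extD (fun y => (α (b y)).comp (fderiv ℝ b y)) y v w =
      extD α (b y) (fderiv ℝ b y v) (fderiv ℝ b y w) := by
  have hb' := (hb.differentiableAt (by simp)).hasFDerivAt
  have hb2 := ((hb.fderiv_right (m := ∞) (by simp)).differentiableAt (by simp)).hasFDerivAt
  have hs := hb.isSymmSndFDerivAt (by simp; norm_cast) v w
  have h := (hα.hasFDerivAt.comp y hb').clm_comp hb2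
  have h' : HasFDerivAt (fun y => (α (b y)).comp (fderiv ℝ b y)) _ y := h
  rw [extD_apply, extD_apply, h'.fderiv]
  simp [hs]

end Pullback

namespace FramePatch

variable {U : Set Plane} (c : FramePatch U) {y : Model8}

/-- The adapted orthonormal basis of `ℝ³`. -/
def basis (hy : y ∈ c.O) : OrthonormalBasis (Fin 3) ℝ Space :=
  OrthonormalBasis.mk (c.frame_orthonormal y hy)
    ((c.frame_orthonormal y hy).linearIndependent.span_eq_top_of_card_eq_finrank (by simp)).ge

theorem basis_apply (hy : y ∈ c.O) (i : Fin 3) : c.basis hy i = c.frame i y := by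
  simp [basis]

theorem inner_eq_sum (hy : y ∈ c.O) (z w : Space) : inner ℝ z w =
    ∑ i, inner ℝ (c.frame i y) z * inner ℝ (c.frame i y) w := by
  rw [← (c.basis hy).sum_inner_mul_inner z w]
  simp [basis_apply, real_inner_comm]

theorem eq_zero_of_inner_frame (hy : y ∈ c.O) {z : Space}
    (h : ∀ i, inner ℝ (c.frame i y) z = (0 : ℝ)) : z = 0 := by
  have := c.inner_eq_sum hy z z
  simpa [h] using this

theorem contDiffAt_of_contDiffOn {G : Type*} [NormedAddCommGroup G] [NormedSpace ℝ G]
    {f : Model8 → G} (hf : ContDiffOn ℝ ∞ f c.O) (hy : y ∈ c.O) : ContDiffAt ℝ ∞ f y :=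
  hf.contDiffAt (c.isOpen_O.mem_nhds hy)

/-- The connection forms are skew, since the frame is orthonormal at all points. -/
theorem omegaConn_skew (hy : y ∈ c.O) (i j : Fin 3) (w : Model8) :
    c.omegaConn j i y w = -c.omegaConn i j y w := by
  have hi := ((c.contDiffAt_of_contDiffOn (c.smooth_frame i) hy).differentiableAt
    (by simp)).hasFDerivAt
  have hj := ((c.contDiffAt_of_contDiffOn (c.smooth_frame j) hy).differentiableAt
    (by simp)).hasFDerivAt
  have he : (fun y => inner ℝ (c.frame i y) (c.frame j y)) =ᶠ[𝓝 y]
      fun _ => if i = j then (1 : ℝ) else 0 := by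
    filter_upwards [c.isOpen_O.mem_nhds hy] with z hz
    exact orthonormal_iff_ite.1 (c.frame_orthonormal z hz) i j
  have h := he.fderiv_eq (𝕜 := ℝ)
  have hin : HasFDerivAt (fun y => inner ℝ (c.frame i y) (c.frame j y)) _ y := hi.inner ℝ hj
  rw [hin.fderiv] at h
  have h' := congrArg (fun α : Model8 →L[ℝ] ℝ => α w) h
  simp at h'
  have h1 : c.omegaConn i j y w = inner ℝ (c.frame i y) (fderiv ℝ (c.frame j) y w) := rfl
  have h2 : c.omegaConn j i y w = inner ℝ (fderiv ℝ (c.frame i) y w) (c.frame j y) :=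
    real_inner_comm (fderiv ℝ (c.frame i) y w) (c.frame j y)
  rw [h1, h2]
  linarith

theorem extD_omega (hy : y ∈ c.O) (i : Fin 3) (v w : Model8) : extD (c.omega i) y v w =
    ∑ j, (c.omegaConn j i y v * c.omega j y w - c.omegaConn j i y w * c.omega j y v) := by
  have h := extD_inner_fderiv (c.contDiffAt_of_contDiffOn (c.smooth_frame i) hy)
    (c.contDiffAt_of_contDiffOn c.smooth_pos hy) v w
  rw [c.inner_eq_sum hy, c.inner_eq_sum hy, ← Finset.sum_sub_distrib] at h
  exact h

theorem extD_omegaConn (hy : y ∈ c.O) (i j : Fin 3) (v w : Model8) :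
    extD (c.omegaConn i j) y v w = ∑ k, (c.omegaConn k i y v * c.omegaConn k j y w -
      c.omegaConn k i y w * c.omegaConn k j y v) := by
  have h := extD_inner_fderiv (c.contDiffAt_of_contDiffOn (c.smooth_frame i) hy)
    (c.contDiffAt_of_contDiffOn (c.smooth_frame j) hy) v w
  rw [c.inner_eq_sum hy, c.inner_eq_sum hy, ← Finset.sum_sub_distrib] at h
  exact h

theorem smooth_omega (i : Fin 3) : ContDiffOn ℝ ∞ (c.omega i) c.O :=
  ((innerSL ℝ).contDiff.comp_contDiffOn (c.smooth_frame i)).clm_comp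
    (c.smooth_pos.fderiv_of_isOpen c.isOpen_O (by simp))

theorem smooth_omegaConn (i j : Fin 3) : ContDiffOn ℝ ∞ (c.omegaConn i j) c.O :=
  ((innerSL ℝ).contDiff.comp_contDiffOn (c.smooth_frame i)).clm_comp
    ((c.smooth_frame j).fderiv_of_isOpen c.isOpen_O (by simp))

theorem smooth_comp_base {G : Type*} [NormedAddCommGroup G] [NormedSpace ℝ G] {f : Plane → G}
    (hf : ContDiffOn ℝ ∞ f U) : ContDiffOn ℝ ∞ (fun y => f (c.base y)) c.O :=
  hf.comp c.smooth_base c.base_mem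

theorem smooth_pull {α : Plane → Plane →L[ℝ] ℝ} (hα : ContDiffOn ℝ ∞ α U) :
    ContDiffOn ℝ ∞ (c.pull α) c.O :=
  (c.smooth_comp_base hα).clm_comp (c.smooth_base.fderiv_of_isOpen c.isOpen_O (by simp))

theorem extD_pull {α : Plane → Plane →L[ℝ] ℝ} (hU : IsOpen U) (hα : ContDiffOn ℝ ∞ α U)
    (hy : y ∈ c.O) (v w : Model8) : extD (c.pull α) y v w =
      extD α (c.base y) (fderiv ℝ c.base y v) (fderiv ℝ c.base y w) :=
  extD_comp_fderiv (c.contDiffAt_of_contDiffOn c.smooth_base hy)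
    ((hα.contDiffAt (hU.mem_nhds (c.base_mem y hy))).differentiableAt (by simp)) v w

end FramePatch

section DualFrame

variable {E : Type*} [NormedAddCommGroup E] [NormedSpace ℝ E] [FiniteDimensional ℝ E]

/-- A smooth coframe has a smooth dual frame. -/
theorem exists_dual_frame {n : ℕ} (hn : Module.finrank ℝ E = n) {O : Set E}
    {χ : Fin n → E → E →L[ℝ] ℝ} (hχ : ∀ a, ContDiffOn ℝ ∞ (χ a) O)
    (hinj : ∀ y ∈ O, ∀ v, (∀ a, χ a y v = 0) → v = 0) :
    ∃ e : Fin n → E → E, (∀ a, ContDiffOn ℝ ∞ (e a) O) ∧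
      (∀ y ∈ O, ∀ a b, χ a y (e b y) = if a = b then 1 else 0) ∧
      ∀ y ∈ O, ∀ v, ∑ a, χ a y v • e a y = v := by
  set L : E → E →L[ℝ] (Fin n → ℝ) := fun y => ContinuousLinearMap.pi fun a => χ a y with hL
  have hLs : ContDiffOn ℝ ∞ L O := by
    rw [contDiffOn_clm_apply]
    intro v
    rw [contDiffOn_pi]
    exact fun a => (hχ a).clm_apply contDiffOn_const
  have heq : ∀ y ∈ O, ∃ A : E ≃L[ℝ] (Fin n → ℝ), (A : E →L[ℝ] (Fin n → ℝ)) = L y := by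
    intro y hy
    have hker : Function.Injective (L y).toLinearMap := by
      rw [← LinearMap.ker_eq_bot, LinearMap.ker_eq_bot']
      exact fun v hv => hinj y hy v fun a => congrFun hv a
    refine ⟨(LinearEquiv.ofInjectiveOfFinrankEq _ hker
      (by simp [hn])).toContinuousLinearEquiv, ?_⟩
    ext v
    rfl
  refine ⟨fun b y => (L y).inverse (Pi.single b 1), fun b => ?_, ?_, ?_⟩
  · refine ContDiffOn.clm_apply (fun y hy => ?_) contDiffOn_const
    obtain ⟨A, hA⟩ := heq y hy
    have h : ContDiffAt ℝ ∞ ContinuousLinearMap.inverse (L y) := hA ▸ contDiffAt_map_inverse A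
    exact h.comp_contDiffWithinAt y (hLs y hy)
  · intro y hy a b
    obtain ⟨A, hA⟩ := heq y hy
    have h : L y ((L y).inverse (Pi.single b 1)) = Pi.single b 1 := by
      rw [← hA]; simp
    have h' := congrFun h a
    simpa [hL, Pi.single_apply] using h'
  · intro y hy v
    obtain ⟨A, hA⟩ := heq y hy
    have h : (L y).inverse (L y v) = v := by
      rw [← hA]; simp
    have h2 : L y v = ∑ a, χ a y v • (Pi.single a 1 : Fin n → ℝ) := by
      funext b
      simp [hL, Finset.sum_apply, Pi.single_apply]
    rw [h2, map_sum] at h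
    simpa using h

end DualFrame

section Coframe

variable {M : Type*} [TopologicalSpace M] [ChartedSpace Plane M] [IsManifold (𝓡 2) ∞ M]
  {g : Metric M} {e : OpenPartialHomeomorph M Plane}

variable (φ : LocalFraming g e) (c : FramePatch φ.U)

/-- The coframe `(θ₀, θ₁, θ₂, θ₃, ω¹₃, ω²₃, η¹, η²)`. -/
def embeddingCoframe : Fin 8 → Model8 → Model8 →L[ℝ] ℝ :=
  ![c.omega 2, c.omega 0 - c.pull (φ.η 0), c.omega 1 - c.pull (φ.η 1),
    c.omegaConn 0 1 - c.pull φ.η12, c.omegaConn 0 2, c.omegaConn 1 2, c.pull (φ.η 0),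
    c.pull (φ.η 1)]

theorem smooth_embeddingCoframe (a : Fin 8) : ContDiffOn ℝ ∞ (embeddingCoframe φ c a) c.O := by
  have h0 := c.smooth_pull (φ.smooth_η 0)
  have h1 := c.smooth_pull (φ.smooth_η 1)
  have h2 := c.smooth_pull φ.smooth_η12
  fin_cases a
  · exact c.smooth_omega 2
  · exact (c.smooth_omega 0).sub h0
  · exact (c.smooth_omega 1).sub h1
  · exact (c.smooth_omegaConn 0 1).sub h2
  · exact c.smooth_omegaConn 0 2
  · exact c.smooth_omegaConn 1 2
  · exact h0
  · exact h1

variable {φ c} {y : Model8}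

theorem embeddingCoframe_injective (hy : y ∈ c.O) (w : Model8)
    (h : ∀ a, embeddingCoframe φ c a y w = 0) : w = 0 := by
  have e6 : φ.η 0 (c.base y) (fderiv ℝ c.base y w) = 0 := h 6
  have e7 : φ.η 1 (c.base y) (fderiv ℝ c.base y w) = 0 := h 7
  have hb : fderiv ℝ c.base y w = 0 := LocalFraming.eq_zero_of_eta (c.base_mem y hy) e6 e7
  have hpull : ∀ α, c.pull α y w = 0 := fun α => by simp [FramePatch.pull, hb]
  have e0 : c.omega 2 y w = 0 := h 0
  have e1 : c.omega 0 y w - c.pull (φ.η 0) y w = 0 := h 1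
  have e2 : c.omega 1 y w - c.pull (φ.η 1) y w = 0 := h 2
  have e3 : c.omegaConn 0 1 y w - c.pull φ.η12 y w = 0 := h 3
  have e4 : c.omegaConn 0 2 y w = 0 := h 4
  have e5 : c.omegaConn 1 2 y w = 0 := h 5
  rw [hpull, sub_zero] at e1 e2 e3
  refine c.immersion y hy w hb (c.eq_zero_of_inner_frame hy fun i => ?_) fun j =>
    c.eq_zero_of_inner_frame hy fun i => ?_
  · change c.omega i y w = 0
    fin_cases i <;> assumption
  · change c.omegaConn i j y w = 0
    have hs := c.omegaConn_skew hy
    have hd : ∀ i, c.omegaConn i i y w = 0 := fun i => by linarith [hs i i w]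
    fin_cases i <;> fin_cases j <;>
      first | exact hd _ | assumption | (refine (hs _ _ w).trans ?_; rw [neg_eq_zero]; assumption)

/-- The connection form on the product in terms of the coframe. -/
theorem pull_eta12 (hy : y ∈ c.O) (w : Model8) : c.pull φ.η12 y w =
    φ.connCoeff 0 (c.base y) * c.pull (φ.η 0) y w +
      φ.connCoeff 1 (c.base y) * c.pull (φ.η 1) y w := by
  have h := congrArg (fun α : Plane →L[ℝ] ℝ => α (fderiv ℝ c.base y w))
    (LocalFraming.covector_eq (c.base_mem y hy) (φ.η12 (c.base y)))
  simpa [FramePatch.pull, LocalFraming.connCoeff] using h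

/-- The structure equations, from those of the frame bundle of `ℝ³` and of the surface. -/
theorem extD_embeddingCoframe {k : ℝ} (hy : y ∈ c.O)
    (hk : extD φ.η12 (c.base y) = k ^ 2 • wedgeR (φ.η 0 (c.base y)) (φ.η 1 (c.base y)))
    (v w : Model8) (a : Fin 8) : extD (embeddingCoframe φ c a) y v w =
      structureForm k (φ.connCoeff 0 (c.base y)) (φ.connCoeff 1 (c.base y))
        (fun b => embeddingCoframe φ c b y v) (fun b => embeddingCoframe φ c b y w) a := by
  have hs := c.omegaConn_skew hy
  have hd : ∀ i w, c.omegaConn i i y w = 0 := fun i w => by linarith [hs i i w]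
  have hω : ∀ i, DifferentiableAt ℝ (c.omega i) y := fun i =>
    (c.contDiffAt_of_contDiffOn (c.smooth_omega i) hy).differentiableAt (by simp)
  have hωc : ∀ i j, DifferentiableAt ℝ (c.omegaConn i j) y := fun i j =>
    (c.contDiffAt_of_contDiffOn (c.smooth_omegaConn i j) hy).differentiableAt (by simp)
  have hp : ∀ {α}, ContDiffOn ℝ ∞ α φ.U → DifferentiableAt ℝ (c.pull α) y := fun hα =>
    (c.contDiffAt_of_contDiffOn (c.smooth_pull hα) hy).differentiableAt (by simp)
  have hbU := c.base_mem y hy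
  have p0 : ∀ v w, extD (c.pull (φ.η 0)) y v w =
      -(c.pull φ.η12 y v * c.pull (φ.η 1) y w - c.pull φ.η12 y w * c.pull (φ.η 1) y v) := by
    intro v w
    rw [c.extD_pull φ.isOpen_U (φ.smooth_η 0) hy, φ.dη_zero _ hbU]
    simp [wedgeR_apply, FramePatch.pull]
  have p1 : ∀ v w, extD (c.pull (φ.η 1)) y v w =
      c.pull φ.η12 y v * c.pull (φ.η 0) y w - c.pull φ.η12 y w * c.pull (φ.η 0) y v := by
    intro v w
    rw [c.extD_pull φ.isOpen_U (φ.smooth_η 1) hy, φ.dη_one _ hbU]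
    simp [wedgeR_apply, FramePatch.pull]
  have p2 : ∀ v w, extD (c.pull φ.η12) y v w =
      k ^ 2 * (c.pull (φ.η 0) y v * c.pull (φ.η 1) y w -
        c.pull (φ.η 0) y w * c.pull (φ.η 1) y v) := by
    intro v w
    rw [c.extD_pull φ.isOpen_U φ.smooth_η12 hy, hk]
    simp [wedgeR_apply, FramePatch.pull]
  have hsub : ∀ {α β : Model8 → Model8 →L[ℝ] ℝ}, DifferentiableAt ℝ α y →
      DifferentiableAt ℝ β y → extD (α - β) y v w = extD α y v w - extD β y v w := by
    intro α β hα hβ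
    have h : HasFDerivAt (α - β) _ y := hα.hasFDerivAt.sub hβ.hasFDerivAt
    simp only [extD_apply, h.fderiv]
    simp
    ring
  have f0 : ∀ z, embeddingCoframe φ c 0 y z = c.omega 2 y z := fun z => rfl
  have f1 : ∀ z, embeddingCoframe φ c 1 y z = c.omega 0 y z - c.pull (φ.η 0) y z := fun z => rfl
  have f2 : ∀ z, embeddingCoframe φ c 2 y z = c.omega 1 y z - c.pull (φ.η 1) y z := fun z => rfl
  have f3 : ∀ z, embeddingCoframe φ c 3 y z = c.omegaConn 0 1 y z -
    (φ.connCoeff 0 (c.base y) * c.pull (φ.η 0) y z +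
      φ.connCoeff 1 (c.base y) * c.pull (φ.η 1) y z) := fun z => by
    rw [← pull_eta12 hy]; rfl
  have f4 : ∀ z, embeddingCoframe φ c 4 y z = c.omegaConn 0 2 y z := fun z => rfl
  have f5 : ∀ z, embeddingCoframe φ c 5 y z = c.omegaConn 1 2 y z := fun z => rfl
  have f6 : ∀ z, embeddingCoframe φ c 6 y z = c.pull (φ.η 0) y z := fun z => rfl
  have f7 : ∀ z, embeddingCoframe φ c 7 y z = c.pull (φ.η 1) y z := fun z => rfl
  have s10 := hs 0 1
  have s20 := hs 0 2
  have s21 := hs 1 2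
  simp only [pull_eta12 hy] at p0 p1
  have o := c.extD_omega hy
  have oc := c.extD_omegaConn hy
  simp only [Fin.sum_univ_three] at o oc
  have q0 := hsub (hω 0) (hp (φ.smooth_η 0))
  have q1 := hsub (hω 1) (hp (φ.smooth_η 1))
  have q2 := hsub (hωc 0 1) (hp φ.smooth_η12)
  rw [o, p0] at q0
  rw [o, p1] at q1
  rw [oc, p2] at q2
  fin_cases a
  · refine (o 2 v w).trans ?_
    simp [structureForm, f0, f1, f2, f3, f4, f5, f6, f7, hd]
  · refine q0.trans ?_
    simp [structureForm, f0, f1, f2, f3, f4, f5, f6, f7, s10, s20, hd]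
    ring
  · refine q1.trans ?_
    simp [structureForm, f0, f1, f2, f3, f4, f5, f6, f7, s21, hd]
    ring
  · refine q2.trans ?_
    simp [structureForm, f0, f1, f2, f3, f4, f5, f6, f7, s10, s20, s21, hd]
  · refine (oc 0 2 v w).trans ?_
    simp [structureForm, f0, f1, f2, f3, f4, f5, f6, f7, s10, s20, hd]
    ring
  · refine (oc 1 2 v w).trans ?_
    simp [structureForm, f0, f1, f2, f3, f4, f5, f6, f7, s21, hd]
  · refine (p0 v w).trans ?_
    simp [structureForm, f0, f1, f2, f3, f4, f5, f6, f7]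
  · refine (p1 v w).trans ?_
    simp [structureForm, f0, f1, f2, f3, f4, f5, f6, f7]

/-- The differential of the pull-back of a function on the surface. -/
theorem hasFDerivAt_comp_base {f : Plane → ℝ} (hf : ContDiffOn ℝ ∞ f φ.U) (hy : y ∈ c.O) :
    HasFDerivAt (fun y => f (c.base y))
      (fderiv ℝ f (c.base y) (φ.v 0 (c.base y)) • embeddingCoframe φ c 6 y +
        fderiv ℝ f (c.base y) (φ.v 1 (c.base y)) • embeddingCoframe φ c 7 y) y := by
  have h := (LocalFraming.hasFDerivAt_frame hf (c.base_mem y hy)).comp y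
    ((c.contDiffAt_of_contDiffOn c.smooth_base hy).differentiableAt (by simp)).hasFDerivAt
  refine h.congr_fderiv ?_
  ext v
  rfl

/-- The local geometry of the isometric embedding system of a surface with curvature `exp 4ℓ`. Here
`k = exp 2ℓ` and `p = dℓ`. -/
theorem exists_embeddingCoframe {ℓ : Plane → ℝ} (hℓ : ContDiffOn ℝ ∞ ℓ φ.U)
    (hK : ∀ u ∈ φ.U, extD φ.η12 u = Real.exp (2 * ℓ u) ^ 2 • wedgeR (φ.η 0 u) (φ.η 1 u))
    (c : FramePatch φ.U) : ∃ D : EmbeddingCoframe c.O,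
      D.χ = embeddingCoframe φ c ∧ (∀ y, D.k y = Real.exp (2 * ℓ (c.base y))) ∧
      (∀ i y, D.h i y = φ.connCoeff i (c.base y)) ∧ (∀ i y, D.p i y = φ.grad ℓ i (c.base y)) ∧
      (∀ i y, D.m i y = φ.tensor ℓ i (c.base y)) ∧
      ∀ i j y, D.dm i j y = fderiv ℝ (φ.tensor ℓ i) (c.base y) (φ.v j (c.base y)) := by
  obtain ⟨f, hf, hfd, hfe⟩ := exists_dual_frame (by simp)
    (smooth_embeddingCoframe φ c) fun y hy => embeddingCoframe_injective hy
  have hk := LocalFraming.smooth_exp hℓ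
  have hp := LocalFraming.smooth_grad hℓ
  refine ⟨{
    isOpen_O := c.isOpen_O
    χ := embeddingCoframe φ c
    e := f
    k := fun y => Real.exp (2 * ℓ (c.base y))
    h := fun i y => φ.connCoeff i (c.base y)
    p := fun i y => φ.grad ℓ i (c.base y)
    m := fun i y => φ.tensor ℓ i (c.base y)
    dm := fun i j y => fderiv ℝ (φ.tensor ℓ i) (c.base y) (φ.v j (c.base y))
    smooth_χ := smooth_embeddingCoframe φ c
    smooth_e := hf
    smooth_k := c.smooth_comp_base hk
    smooth_p := fun i => c.smooth_comp_base (hp i)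
    k_ne_zero := fun y _ => (Real.exp_pos _).ne'
    dual := hfd
    expand := hfe
    extD_χ := fun y hy v w a => extD_embeddingCoframe hy (hK _ (c.base_mem y hy)) v w a
    deriv_k := fun y hy => ?_
    deriv_p0 := fun y hy => ?_
    deriv_p1 := fun y hy => ?_
    deriv_m := fun y hy i => hasFDerivAt_comp_base (LocalFraming.smooth_tensor hℓ i) hy },
    rfl, fun _ => rfl, fun _ _ => rfl, fun _ _ => rfl, fun _ _ => rfl, fun _ _ _ => rfl⟩
  · have h := hasFDerivAt_comp_base hk hy
    rwa [LocalFraming.fderiv_exp_apply hℓ (c.base_mem y hy),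
      LocalFraming.fderiv_exp_apply hℓ (c.base_mem y hy)] at h
  · have h := hasFDerivAt_comp_base (hp 0) hy
    rwa [LocalFraming.fderiv_grad_zero_zero, LocalFraming.fderiv_grad_zero_one] at h
  · have h := hasFDerivAt_comp_base (hp 1) hy
    rwa [LocalFraming.fderiv_grad_one_zero hℓ (c.base_mem y hy),
      LocalFraming.fderiv_grad_one_one] at h

end Coframe

/-! ### Local coordinates on the frame bundle -/

section Coordinates

theorem hasFDerivAt_coord (i : Fin 8) (y : Model8) :
    HasFDerivAt (fun y : Model8 => y i) (EuclideanSpace.proj (𝕜 := ℝ) i) y :=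
  (EuclideanSpace.proj (𝕜 := ℝ) i : Model8 →L[ℝ] ℝ).hasFDerivAt

theorem contDiff_coord (i : Fin 8) : ContDiff ℝ ∞ fun y : Model8 => y i :=
  (EuclideanSpace.proj (𝕜 := ℝ) i : Model8 →L[ℝ] ℝ).contDiff

/-- The moving frame of `ℝ³` whose last vector has longitude `y 5` and latitude `y 6`, and whose
other two vectors are turned by the angle `y 7` in the plane orthogonal to it. -/
def angleFrame (i : Fin 3) (y : Model8) : Space :=
  ![!₂[-(Real.cos (y 7) * Real.sin (y 5)) - Real.sin (y 7) * Real.sin (y 6) * Real.cos (y 5),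
      Real.cos (y 7) * Real.cos (y 5) - Real.sin (y 7) * Real.sin (y 6) * Real.sin (y 5),
      Real.sin (y 7) * Real.cos (y 6)],
    !₂[Real.sin (y 7) * Real.sin (y 5) - Real.cos (y 7) * Real.sin (y 6) * Real.cos (y 5),
      -(Real.sin (y 7) * Real.cos (y 5)) - Real.cos (y 7) * Real.sin (y 6) * Real.sin (y 5),
      Real.cos (y 7) * Real.cos (y 6)],
    !₂[Real.cos (y 6) * Real.cos (y 5), Real.cos (y 6) * Real.sin (y 5), Real.sin (y 6)]] i

theorem contDiff_angleFrame (i : Fin 3) : ContDiff ℝ ∞ (angleFrame i) := by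
  have h := contDiff_coord
  rw [contDiff_euclidean]
  intro j
  have c5 := (h 5).cos
  have c6 := (h 6).cos
  have c7 := (h 7).cos
  have s5 := (h 5).sin
  have s6 := (h 6).sin
  have s7 := (h 7).sin
  fin_cases i <;> fin_cases j
  · exact (c7.mul s5).neg.sub ((s7.mul s6).mul c5)
  · exact (c7.mul c5).sub ((s7.mul s6).mul s5)
  · exact s7.mul c6
  · exact (s7.mul s5).sub ((c7.mul s6).mul c5)
  · exact (s7.mul c5).neg.sub ((c7.mul s6).mul s5)
  · exact c7.mul c6
  · exact c6.mul c5
  · exact c6.mul s5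
  · exact s6

theorem orthonormal_angleFrame (y : Model8) : Orthonormal ℝ fun i => angleFrame i y := by
  rw [orthonormal_iff_ite]
  have h5 := Real.sin_sq_add_cos_sq (y 5)
  have h6 := Real.sin_sq_add_cos_sq (y 6)
  have h7 := Real.sin_sq_add_cos_sq (y 7)
  have hin : ∀ x z : Space, inner ℝ x z = x 0 * z 0 + x 1 * z 1 + x 2 * z 2 := fun x z => by
    simp [PiLp.inner_apply, Fin.sum_univ_three, mul_comm]
  intro i j
  rw [hin]
  generalize hs5 : Real.sin (y 5) = s5 at *
  generalize hs6 : Real.sin (y 6) = s6 at *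
  generalize hs7 : Real.sin (y 7) = s7 at *
  generalize hc5 : Real.cos (y 5) = c5 at *
  generalize hc6 : Real.cos (y 6) = c6 at *
  generalize hc7 : Real.cos (y 7) = c7 at *
  fin_cases i <;> fin_cases j <;> simp [angleFrame, hs5, hs6, hs7, hc5, hc6, hc7]
  · linear_combination (c7 ^ 2 + s7 ^ 2 * s6 ^ 2) * h5 + s7 ^ 2 * h6 + h7
  · linear_combination s7 * c7 * (s6 ^ 2 - 1) * h5 + s7 * c7 * h6
  · linear_combination -c6 * s7 * s6 * h5
  · linear_combination s7 * c7 * (s6 ^ 2 - 1) * h5 + s7 * c7 * h6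
  · linear_combination (s7 ^ 2 + c7 ^ 2 * s6 ^ 2) * h5 + c7 ^ 2 * h6 + h7
  · linear_combination -c6 * c7 * s6 * h5
  · linear_combination -c6 * s7 * s6 * h5
  · linear_combination -c6 * c7 * s6 * h5
  · linear_combination c6 ^ 2 * h5 + h6

/-- A covector which computes the differential of a component of a map vanishes wherever the
differential of the map does. -/
theorem apply_eq_zero_of_fderiv_eq_zero {n : ℕ} {f : Model8 → EuclideanSpace ℝ (Fin n)}
    {y w : Model8} (hf : ContDiff ℝ ∞ f) (h : fderiv ℝ f y w = 0) (j : Fin n)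
    {L : Model8 →L[ℝ] ℝ} (hL : HasFDerivAt (fun z => f z j) L y) : L w = 0 := by
  have h1 := (EuclideanSpace.proj (𝕜 := ℝ) j : EuclideanSpace ℝ (Fin n) →L[ℝ] ℝ).hasFDerivAt.comp y
    ((hf.differentiable (by simp)).differentiableAt (x := y)).hasFDerivAt
  have h2 : HasFDerivAt (fun z => f z j) _ y := h1
  rw [hL.unique h2]
  simp [h]

/-- The base point as a function of the first two coordinates. -/
def coordBase (y : Model8) : Plane := !₂[y 0, y 1]

/-- The position as a function of the next three coordinates. -/
def coordPos (y : Model8) : Space := !₂[y 2, y 3, y 4]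

theorem contDiff_coordBase : ContDiff ℝ ∞ coordBase := by
  rw [contDiff_euclidean]
  intro j
  fin_cases j
  · exact contDiff_coord 0
  · exact contDiff_coord 1

theorem contDiff_coordPos : ContDiff ℝ ∞ coordPos := by
  rw [contDiff_euclidean]
  intro j
  fin_cases j
  · exact contDiff_coord 2
  · exact contDiff_coord 3
  · exact contDiff_coord 4

/-- Coordinates on the product of a plane domain with the frame bundle of `ℝ³`. -/
def anglePatch {U : Set Plane} (hU : IsOpen U) : FramePatch U where
  O := {y | coordBase y ∈ U ∧ Real.cos (y 6) ≠ 0}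
  isOpen_O := (hU.preimage contDiff_coordBase.continuous).inter
    (isOpen_ne.preimage (contDiff_coord 6).cos.continuous)
  base := coordBase
  pos := coordPos
  frame := angleFrame
  smooth_base := contDiff_coordBase.contDiffOn
  smooth_pos := contDiff_coordPos.contDiffOn
  smooth_frame i := (contDiff_angleFrame i).contDiffOn
  base_mem _ hy := hy.1
  frame_orthonormal y _ := orthonormal_angleFrame y
  immersion y hy w hb hp hf := by
    have w0 : w 0 = 0 := apply_eq_zero_of_fderiv_eq_zero contDiff_coordBase hb 0
      (hasFDerivAt_coord 0 y)
    have w1 : w 1 = 0 := apply_eq_zero_of_fderiv_eq_zero contDiff_coordBase hb 1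
      (hasFDerivAt_coord 1 y)
    have w2 : w 2 = 0 := apply_eq_zero_of_fderiv_eq_zero contDiff_coordPos hp 0
      (hasFDerivAt_coord 2 y)
    have w3 : w 3 = 0 := apply_eq_zero_of_fderiv_eq_zero contDiff_coordPos hp 1
      (hasFDerivAt_coord 3 y)
    have w4 : w 4 = 0 := apply_eq_zero_of_fderiv_eq_zero contDiff_coordPos hp 2
      (hasFDerivAt_coord 4 y)
    have h5 := hasFDerivAt_coord 5 y
    have h6 := hasFDerivAt_coord 6 y
    have h7 := hasFDerivAt_coord 7 y
    have hc := hy.2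
    have f22 := apply_eq_zero_of_fderiv_eq_zero (contDiff_angleFrame 2) (hf 2) 2 h6.sin
    have w6 : w 6 = 0 := by simpa [hc] using f22
    have f20 := apply_eq_zero_of_fderiv_eq_zero (contDiff_angleFrame 2) (hf 2) 0
      (h6.cos.mul h5.cos)
    have f21 := apply_eq_zero_of_fderiv_eq_zero (contDiff_angleFrame 2) (hf 2) 1
      (h6.cos.mul h5.sin)
    have f02 := apply_eq_zero_of_fderiv_eq_zero (contDiff_angleFrame 0) (hf 0) 2
      (h7.sin.mul h6.cos)
    have f12 := apply_eq_zero_of_fderiv_eq_zero (contDiff_angleFrame 1) (hf 1) 2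
      (h7.cos.mul h6.cos)
    simp [w6] at f20 f21 f02 f12
    have hsc : ∀ {a x : ℝ}, (Real.cos (y 6) = 0 ∨ Real.sin a = 0 ∨ x = 0) →
        (Real.cos (y 6) = 0 ∨ Real.cos a = 0 ∨ x = 0) → x = 0 := by
      intro a x hs' hc'
      have h1 := Real.sin_sq_add_cos_sq a
      rcases hs'.resolve_left hc with hs' | hx
      · rcases hc'.resolve_left hc with hc' | hx
        · simp [hs', hc'] at h1
        · exact hx
      · exact hx
    have w5 : w 5 = 0 := hsc f20 f21
    have w7 : w 7 = 0 := hsc f12 f02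
    ext i
    fin_cases i <;> assumption

theorem exists_base_eq {U : Set Plane} (hU : IsOpen U) {u : Plane} (hu : u ∈ U) :
    ∃ y ∈ (anglePatch hU).O, (anglePatch hU).base y = u := by
  have h : coordBase !₂[u 0, u 1, 0, 0, 0, 0, 0, 0] = u := by
    ext i
    fin_cases i <;> rfl
  refine ⟨!₂[u 0, u 1, 0, 0, 0, 0, 0, 0], ⟨?_, ?_⟩, h⟩
  · rwa [h]
  · simp

end Coordinates

/-! ### The invariant `q` -/

section Invariant

variable {M : Type*} [TopologicalSpace M] [ChartedSpace Plane M] [IsManifold (𝓡 2) ∞ M]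
  {g : Metric M} {e : OpenPartialHomeomorph M Plane}

namespace LocalFraming

variable {φ : LocalFraming g e} {ℓ : Plane → ℝ} {u : Plane}

/-- The condition `k m = p ⊗ p` as an equation for the second covariant derivative of `ℓ`. -/
theorem integrableAt_iff (ℓ : Plane → ℝ) (u : Plane) : φ.IntegrableAt ℓ u ↔
    φ.hess ℓ 0 0 u - 3 * φ.grad ℓ 0 u ^ 2 = -Real.exp (2 * ℓ u) ^ 2 ∧
    φ.hess ℓ 0 1 u - 3 * (φ.grad ℓ 0 u * φ.grad ℓ 1 u) = 0 ∧
    φ.hess ℓ 1 1 u - 3 * φ.grad ℓ 1 u ^ 2 = -Real.exp (2 * ℓ u) ^ 2 := by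
  have hk := (Real.exp_pos (2 * ℓ u)).ne'
  have h0 : 2 * (Real.exp (2 * ℓ u) * φ.tensor ℓ 0 u) =
      φ.hess ℓ 0 0 u - φ.grad ℓ 0 u ^ 2 + Real.exp (2 * ℓ u) ^ 2 := by
    simp only [tensor, Matrix.cons_val]; field_simp
  have h1 : 2 * (Real.exp (2 * ℓ u) * φ.tensor ℓ 1 u) =
      φ.hess ℓ 0 1 u - φ.grad ℓ 0 u * φ.grad ℓ 1 u := by
    simp only [tensor, Matrix.cons_val]; field_simp
  have h2 : 2 * (Real.exp (2 * ℓ u) * φ.tensor ℓ 2 u) =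
      φ.hess ℓ 1 1 u - φ.grad ℓ 1 u ^ 2 + Real.exp (2 * ℓ u) ^ 2 := by
    simp only [tensor, Matrix.cons_val]; field_simp
  refine and_congr ⟨fun h => ?_, fun h => ?_⟩
    (and_congr ⟨fun h => ?_, fun h => ?_⟩ ⟨fun h => ?_, fun h => ?_⟩) <;> linarith

/-- The second covariant derivative of `q = exp (-3ℓ)`. -/
theorem cov₂_eq (hℓ : ContDiffOn ℝ ∞ ℓ φ.U) {q : M → ℝ}
    (hq : ∀ w, q (e.symm w) = Real.exp (-3 * ℓ w)) (hu : u ∈ φ.U) (i j : Fin 2) :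
    φ.cov₂ q i j u = -3 * Real.exp (-3 * ℓ u) *
      (φ.hess ℓ i j u - 3 * (φ.grad ℓ i u * φ.grad ℓ j u)) := by
  have hcov : ∀ w ∈ φ.U, ∀ i, φ.cov q i w = -3 * Real.exp (-3 * ℓ w) * φ.grad ℓ i w := by
    intro w hw i
    rw [cov, funext hq, fderiv_exp_apply hℓ hw]
  have hE : ContDiffOn ℝ ∞ (fun w => Real.exp (-3 * ℓ w)) φ.U := (contDiffOn_const.mul hℓ).exp
  have hE' := (differentiableAt_of_contDiffOn hE hu).hasFDerivAt
  have hg := (differentiableAt_of_contDiffOn (smooth_grad hℓ i) hu).hasFDerivAt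
  have he : φ.cov q i =ᶠ[𝓝 u] fun w => -3 * Real.exp (-3 * ℓ w) * φ.grad ℓ i w := by
    filter_upwards [φ.isOpen_U.mem_nhds hu] with w hw using hcov w hw i
  have hd := he.fderiv_eq.trans ((hE'.const_mul (-3)).mul hg).fderiv
  rw [cov₂, hd]
  simp only [hcov u hu, hess, Fin.sum_univ_two]
  simp only [add_apply, smul_apply, smul_eq_mul, fderiv_exp_apply hℓ hu]
  ring

theorem integrableAt_iff_cov₂ (hℓ : ContDiffOn ℝ ∞ ℓ φ.U) {q : M → ℝ}
    (hq : ∀ w, q (e.symm w) = Real.exp (-3 * ℓ w)) (hu : u ∈ φ.U) : φ.IntegrableAt ℓ u ↔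
      φ.cov₂ q 0 0 u = 3 * q (e.symm u) ^ (-(1 / 3) : ℝ) ∧
      φ.cov₂ q 1 1 u = 3 * q (e.symm u) ^ (-(1 / 3) : ℝ) ∧
      φ.cov₂ q 0 1 u = 0 ∧ φ.cov₂ q 1 0 u = 0 := by
  have hr : q (e.symm u) ^ (-(1 / 3) : ℝ) = Real.exp (-3 * ℓ u) * Real.exp (2 * ℓ u) ^ 2 := by
    rw [hq, ← Real.exp_mul, ← Real.exp_nat_mul, ← Real.exp_add]
    congr 1
    push_cast
    ring
  have hE := (Real.exp_pos (-3 * ℓ u)).ne'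
  have hdiag : ∀ x : ℝ, -3 * Real.exp (-3 * ℓ u) * x =
      3 * (Real.exp (-3 * ℓ u) * Real.exp (2 * ℓ u) ^ 2) ↔ x = -Real.exp (2 * ℓ u) ^ 2 := by
    intro x
    constructor
    · intro h
      exact mul_left_cancel₀ (mul_ne_zero (by norm_num : (-3 : ℝ) ≠ 0) hE)
        (by linear_combination h)
    · rintro rfl
      ring
  rw [integrableAt_iff, hr]
  simp only [cov₂_eq hℓ hq hu, hdiag, hess_symm hℓ hu]
  simp only [mul_eq_zero, hE, mul_comm (φ.grad ℓ 1 u) (φ.grad ℓ 0 u), pow_two (φ.grad ℓ _ u)]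
  norm_num
  tauto

end LocalFraming

/-- The Gauss curvature is smooth on the domain of a framing, being a component of `dη¹₂`. -/
theorem IsGaussCurvature.contDiffOn {K : M → ℝ} (hK : IsGaussCurvature g K)
    (he : e ∈ atlas Plane M) (φ : LocalFraming g e) :
    ContDiffOn ℝ ∞ (fun u => K (e.symm u)) φ.U := by
  have hd := φ.smooth_η12.fderiv_of_isOpen φ.isOpen_U (m := ∞) (by simp)
  refine (((hd.clm_apply (φ.smooth_v 0)).clm_apply (φ.smooth_v 1)).sub
    ((hd.clm_apply (φ.smooth_v 1)).clm_apply (φ.smooth_v 0))).congr fun u hu => ?_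
  have h := congrArg (fun β : Plane →L[ℝ] Plane →L[ℝ] ℝ => β (φ.v 0 u) (φ.v 1 u))
    (hK e he φ u hu)
  simpa [extD_apply, wedgeR_apply, φ.dual u hu] using h.symm

end Invariant

end DarbouxEmbedding

end

open DarbouxEmbedding in
theorem mainTheorem2 {M : Type*} [TopologicalSpace M] [ChartedSpace Plane M]
    [IsManifold (𝓡 2) ∞ M] (hM : IsOrientedAtlas M) (g : Metric M)
    (K : M → ℝ) (hK : IsGaussCurvature g K) (hpos : ∀ x, 0 < K x)
    (q : M → ℝ) (hq : ∀ x, q x = K x ^ (-(3 / 4) : ℝ)) :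
    EmbeddingSystemIsDarbouxIntegrable g ↔
      ∀ e ∈ atlas Plane M, ∀ φ : LocalFraming g e, ∀ u ∈ φ.U,
        φ.cov₂ q 0 0 u = 3 * q (e.symm u) ^ (-(1 / 3) : ℝ) ∧
        φ.cov₂ q 1 1 u = 3 * q (e.symm u) ^ (-(1 / 3) : ℝ) ∧
        φ.cov₂ q 0 1 u = 0 ∧ φ.cov₂ q 1 0 u = 0 := by
  refine forall₃_congr fun e he φ => ?_
  -- With this `ℓ` one has `k = exp 2ℓ`, `p = dℓ` and `q = exp (-3ℓ)`.
  set ℓ : Plane → ℝ := fun u => Real.log (K (e.symm u)) / 4 with hℓdef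
  have hℓ : ContDiffOn ℝ ∞ ℓ φ.U :=
    ((hK.contDiffOn he φ).log fun u _ => (hpos _).ne').div_const 4
  have hq' : ∀ w, q (e.symm w) = Real.exp (-3 * ℓ w) := fun w => by
    rw [hq, Real.rpow_def_of_pos (hpos _)]
    congr 1
    simp only [hℓdef]
    ring
  have hK' : ∀ u ∈ φ.U,
      extD φ.η12 u = Real.exp (2 * ℓ u) ^ 2 • wedgeR (φ.η 0 u) (φ.η 1 u) := fun u hu => by
    rw [hK e he φ u hu, ← Real.exp_nat_mul]
    congr 1
    rw [← Real.exp_log (hpos (e.symm u))]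
    congr 1
    simp only [hℓdef]
    push_cast
    ring
  have hχ : ∀ (c : FramePatch φ.U) (i : Fin 4),
      embeddingForms φ c i = embeddingCoframe φ c (i.castAdd 4) := fun c i => by
    fin_cases i <;> rfl
  refine Iff.trans ?_ (forall₂_congr fun u hu => LocalFraming.integrableAt_iff_cov₂ hℓ hq' hu)
  constructor
  · intro h u hu
    refine LocalFraming.integrableAt_of_rankCondition hℓ (fun u hu => ?_) hu
    obtain ⟨y, hy, rfl⟩ := exists_base_eq φ.isOpen_U hu
    obtain ⟨D, hDχ, hk, hh, hp, hm, hdm⟩ := exists_embeddingCoframe hℓ hK' (anglePatch φ.isOpen_U)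
    have hr := D.rankCondition_of_isEllipticDarbouxIntegrable
      (fun i => by rw [hDχ]; exact hχ _ i) (h (anglePatch φ.isOpen_U)) hy
    simpa only [LocalFraming.RankConditionAt, hk, hh, hp, hm, hdm] using hr
  · intro h c
    obtain ⟨D, hDχ, hk, -, hp, hm, -⟩ := exists_embeddingCoframe hℓ hK' c
    refine D.isEllipticDarbouxIntegrable (fun i => by rw [hDχ]; exact hχ c i) fun y hy => ?_
    have hi := h (c.base y) (c.base_mem y hy)
    simpa only [EmbeddingCoframe.IntegrableAt, LocalFraming.IntegrableAt, hk, hp, hm] using hi
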